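/- Conventions. A weighted multigraph $\Gamma$ is a finite graph in which loops and parallel edges are allowed and every vertex is an end of at least one edge, with a positive integer multiplicity $n(E)$ assigned to each edge $E$; $\Gamma$ also denotes the underlying topological space, obtained by gluing the ends of one copy of $[0,1]$ for each edge to the vertices. Let $M$ be a closed smooth manifold with a Riemannian metric $g$ of class $C^k$, $3\le k\le\infty$. A $\Gamma$-net on $M$ is a continuous map $f:\Gamma\to M$ whose restriction to each edge is a $C^2$ immersion. Its length is $\mathrm{L}_g(f)=\sum_E n(E)\,\mathrm{L}_g(f|_E)$. It is a stationary geodesic net if $\frac{d}{ds}\big|_{s=0}\mathrm{L}_g(\tilde f_s)=0$ for every one-parameter family $(\tilde f_s)_{s\in(-\delta,\delta)}$ of $\Gamma$-nets with $\tilde f_0=f$ that is continuous on $(-\delta,\delta)\times\Gamma$ and of class $C^2$ on $(-\delta,\delta)\times E$ for each edge $E$. It is embedded if it is injective. The multiplicity of $f$ at $p\in M$ is $$\sum_E n(E)\Big(\#\{t\in(0,1): f|_E(t)=p\}+\tfrac12\,\#\{t\in\{0,1\}: f|_E(t)=p\}\Big),$$ where each edge $E$ is parametrized by $[0,1]$.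 A weighted multigraph is good if either it is connected and every vertex has at least three incoming edges, a loop at a vertex being counted twice there, or it is a simple loop with multiplicity (one vertex and one edge). Lemma. Let $f:\Gamma\to(M,g)$ be a stationary geodesic net. Then there exist a weighted multigraph $\tilde\Gamma$ and an embedded stationary geodesic net $\tilde f:\tilde\Gamma\to(M,g)$ such that $\tilde f$ has the same image as $f$ and the same multiplicity as $f$ at every point of $M$, and each connected component of $\tilde\Gamma$ is good. In particular, $\mathrm{L}_g(\tilde f)=\mathrm{L}_g(f)$. -/

import Mathlib

open Set Manifold Bundle
open scoped ContDiff ENNReal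

/-- A weighted multigraph: finitely many vertices, finitely many edges (loops and parallel edges are
allowed), each edge `e` being identified with `[0, 1]` and attached at the vertices
`endpt e false` (parameter `0`) and `endpt e true` (parameter `1`), and carrying a positive integer
multiplicity. -/
structure WeightedMultigraph : Type 1 where
  /-- the vertices -/
  V : Type
  /-- the edges -/
  E : Type
  [finiteV : Finite V]
  [fintypeE : Fintype E]
  /-- the two end points of an edge -/
  endpt : E → Bool → V
  /-- the multiplicity of an edge -/
  mult : E → ℕ
  mult_pos : ∀ e, 0 < mult e

namespace WeightedMultigraph

variable (G : WeightedMultigraph)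

instance : Finite G.V := G.finiteV

instance : Fintype G.E := G.fintypeE

/-! ### Combinatorics -/

/-- Every vertex is an end point of some edge. -/
def NoIsolatedVertex : Prop := ∀ v : G.V, ∃ e i, G.endpt e i = v

/-- Two vertices are adjacent if they are the two ends of an edge. -/
def Adj (v w : G.V) : Prop := ∃ e i, G.endpt e i = v ∧ G.endpt e (!i) = w

/-- Two vertices are joined by a finite chain of edges. -/
def Reachable (v w : G.V) : Prop := Relation.ReflTransGen G.Adj v w

/-- A weighted multigraph is connected. -/
def IsConnected : Prop := Nonempty G.V ∧ ∀ v w : G.V, G.Reachable v w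

/-- The number of edges coming in at `v`: the pairs (edge, end of that edge) attached at `v`.
A loop at `v` comes in at `v` twice. -/
noncomputable def degree (v : G.V) : ℕ := Nat.card {h : G.E × Bool // G.endpt h.1 h.2 = v}

/-- Good* weighted multigraphs: connected, with at least three incoming edges at every vertex. -/
def IsGoodStar : Prop := G.IsConnected ∧ ∀ v : G.V, 3 ≤ G.degree v

/-- A simple loop with multiplicity: a single vertex and a single edge, which is then a loop. -/
def IsSimpleLoop : Prop := Nat.card G.V = 1 ∧ Nat.card G.E = 1

/-- Good weighted multigraphs. -/
def IsGood : Prop := G.IsGoodStar ∨ G.IsSimpleLoop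

theorem reachable_endpt {v : G.V} {e : G.E} (h : G.Reachable v (G.endpt e false)) (i : Bool) :
    G.Reachable v (G.endpt e i) := by
  cases i with
  | false => exact h
  | true => exact Relation.ReflTransGen.tail h ⟨e, false, rfl, rfl⟩

/-- The connected component of the vertex `v`, with all its edges and their multiplicities. -/
noncomputable def component (v : G.V) : WeightedMultigraph where
  V := {w : G.V // G.Reachable v w}
  E := {e : G.E // G.Reachable v (G.endpt e false)}
  fintypeE := Fintype.ofFinite _
  endpt e i := ⟨G.endpt e.1 i, G.reachable_endpt e.2 i⟩
  mult e := G.mult e.1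
  mult_pos e := G.mult_pos e.1

/-! ### The underlying one-dimensional complex -/

/-- The disjoint union of the (discrete) vertices and one copy of `[0, 1]` for each edge. -/
def PreRealization : Type := G.V ⊕ (G.E × unitInterval)

instance : TopologicalSpace G.PreRealization :=
  letI : TopologicalSpace G.V := ⊥
  letI : TopologicalSpace G.E := ⊥
  inferInstanceAs (TopologicalSpace (G.V ⊕ (G.E × unitInterval)))

/-- Each end of each edge is glued to the vertex at which it is attached. -/
inductive Glue : G.PreRealization → G.PreRealization → Prop
  | zero (e : G.E) : Glue (Sum.inl (G.endpt e false)) (Sum.inr (e, 0))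
  | one (e : G.E) : Glue (Sum.inl (G.endpt e true)) (Sum.inr (e, 1))

/-- The topological space underlying a weighted multigraph, with the quotient topology. -/
def Realization : Type := Quot G.Glue

instance : TopologicalSpace G.Realization := inferInstanceAs (TopologicalSpace (Quot G.Glue))

/-- The vertex `v` as a point of the underlying space. -/
def vertexPt (v : G.V) : G.Realization := Quot.mk _ (Sum.inl v)

/-- The point of the edge `e` with parameter `t`. -/
def edgePt (e : G.E) (t : unitInterval) : G.Realization := Quot.mk _ (Sum.inr (e, t))

variable {G} {M : Type*}

/-- The restriction of `f` to the edge `e`, as a path parametrized by `[0, 1]` (and extended by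
constants outside `[0, 1]`). -/
noncomputable def edgePath (f : G.Realization → M) (e : G.E) (t : ℝ) : M :=
  f (G.edgePt e (projIcc 0 1 zero_le_one t))

/-- The multiplicity of `f` at the point `p`: the number of points of the underlying space which `f`
maps to `p`, where an interior point of an edge counts with the multiplicity of the edge, and where
each end of an edge counts with half of the multiplicity of the edge (so that the subdivision of an
edge by a new vertex does not change the multiplicities). -/
noncomputable def multiplicityAt (f : G.Realization → M) (p : M) : ℝ≥0∞ :=
  ∑ e : G.E, (G.mult e : ℝ≥0∞) *
    (({t : ℝ | t ∈ Ioo 0 1 ∧ edgePath f e t = p}.encard : ℝ≥0∞) +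
      ({t : ℝ | t ∈ ({0, 1} : Set ℝ) ∧ edgePath f e t = p}.encard : ℝ≥0∞) / 2)

section Net

variable {n : ℕ} [TopologicalSpace M] [ChartedSpace (EuclideanSpace ℝ (Fin n)) M]

/-- `f` is a net: it is continuous, and a `C²` immersion on each edge. -/
structure IsNet (f : G.Realization → M) : Prop where
  continuous : Continuous f
  contMDiffOn : ∀ e : G.E, ContMDiffOn 𝓘(ℝ, ℝ) (𝓡 n) 2 (edgePath f e) (Icc 0 1)
  immersion : ∀ e : G.E, ∀ t ∈ Icc (0 : ℝ) 1,
    Function.Injective (mfderivWithin 𝓘(ℝ, ℝ) (𝓡 n) (edgePath f e) (Icc 0 1) t)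

/-- `F` is a one-parameter family of nets with parameter in `(-δ, δ)` and `F 0 = f`: it is jointly
continuous, each `F s` is a net, and `F` is of class `C²` on the product of `(-δ, δ)` with each
edge. -/
structure IsNetFamily (f : G.Realization → M) (δ : ℝ) (F : ℝ → G.Realization → M) : Prop where
  zero : F 0 = f
  continuousOn : ContinuousOn (fun q : ℝ × G.Realization => F q.1 q.2) (Ioo (-δ) δ ×ˢ univ)
  isNet : ∀ s ∈ Ioo (-δ) δ, IsNet (n := n) (F s)
  contMDiffOn : ∀ e : G.E, ContMDiffOn 𝓘(ℝ, ℝ × ℝ) (𝓡 n) 2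
    (fun q : ℝ × ℝ => edgePath (F q.1) e q.2) (Ioo (-δ) δ ×ˢ Icc 0 1)

/-- The length of a net: the lengths of the edges, counted with multiplicity. -/
noncomputable def length (n : ℕ) [ChartedSpace (EuclideanSpace ℝ (Fin n)) M]
    [RiemannianBundle (fun x : M => TangentSpace (𝓡 n) x)] (f : G.Realization → M) : ℝ :=
  ∑ e : G.E, (G.mult e : ℝ) * (pathELength (𝓡 n) (edgePath f e) 0 1).toReal

/-- `f` is a stationary geodesic net: a net which is a critical point of the length functional,
with respect to all one-parameter families of nets through `f`. -/
structure IsStationary [RiemannianBundle (fun x : M => TangentSpace (𝓡 n) x)]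
    (f : G.Realization → M) : Prop where
  isNet : IsNet (n := n) f
  critical : ∀ δ : ℝ, 0 < δ → ∀ F : ℝ → G.Realization → M, IsNetFamily (n := n) f δ F →
    HasDerivAt (fun s => length n (F s)) 0 0

end Net

end WeightedMultigraph

open Filter
open scoped Topology

set_option linter.unusedSectionVars false

noncomputable section

/-! By the first variation formula (`hasDerivAt_length_eq`), the edges of a stationary net are
geodesics (`isGeodesicAt_of_isStationary`), and at each point of M the unit vectors of the edge ends
located there, pointing inward and weighted by multiplicity, have sum zero (`sum_weight_eq_zero`).
Conversely a net of geodesics with this balance at its vertices is stationary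
(`isStationary_of_isGeodesicAt`). A stationary net is thus a finite balanced system of geodesic
arcs, each taken in both directions.

All that has to be preserved is encoded in one function on the tangent bundle, `ArcSystem.count`:
the weighted number of passages of the oriented arcs through a vector, the start of an arc being
counted and its end not. The double counting `sum_darts` shows that point multiplicities, total
length and the balance sums depend on `count` only, and the multiplicities determine the image. It
therefore suffices to find a better system of arcs with the same `count`.

Geodesics through the same vector agree as long as both are defined, and geodesics with different
vectors at a point separate at once. With compactness, all but finitely many points of M are crossed
by at most one undirected trajectory of the system. Let P be a finite "cut" containing the
exceptional points and met by every arc. Off P the balance makes `count` invariant under reversal,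
so it is constant along a trajectory between consecutive points of P. Cutting the arcs at P and
merging pieces that overlap gives arcs which meet only at their ends, with `count` as multiplicity:
an embedded net (`exists_isSimplified`).

Goodness comes from taking P of least cardinality. At a point of P with fewer than three outgoing
vectors, balance forces exactly two, opposite and of equal multiplicity: the trajectory goes
straight through. Such a point could be removed from P, unless the trajectory returns to it before
meeting the rest of P (`IsCut.closes_up`); its component is then a simple loop.

The combinatorial half uses only the axioms of `PartialFlow`. For geodesics these follow from the
Hamiltonian form of the geodesic equation, whose vector field is C¹ for a C² metric, so that its
solutions are unique. -/

namespace GeodesicNet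

/-! ### Partially defined reversible flows -/

/-- A partially defined reversible flow on `X`, whose trajectories project to curves in `M` that
are locally injective and locally determined by their initial vector: `R x t y` says that the
trajectory of `x` is at `y` after the time `t`. -/
structure PartialFlow (X M : Type*) [TopologicalSpace M] where
  R : X → ℝ → X → Prop
  proj : X → M
  rev : X → X
  nonneg : ∀ {x t y}, R x t y → 0 ≤ t
  zero_eq : ∀ {x y}, R x 0 y → x = y
  functional : ∀ {x t y z}, R x t y → R x t z → y = z
  split : ∀ {x t z s}, R x t z → 0 ≤ s → s ≤ t → ∃ y, R x s y ∧ R y (t - s) z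
  concat : ∀ {x s y t z}, R x s y → R y t z → R x (s + t) z
  rev_rel : ∀ {x t y}, R x t y → R (rev y) t (rev x)
  rev_rev : ∀ x, rev (rev x) = x
  proj_rev : ∀ x, proj (rev x) = proj x
  -- Required only where a trajectory starts: the zero tangent vector is its own reverse.
  rev_ne : ∀ {x t y}, R x t y → rev x ≠ x
  injective : ∀ x, ∃ ε > 0, ∀ s t z z', s ≤ ε → t ≤ ε → R x s z → R x t z' →
    proj z = proj z' → s = t
  separated : ∀ x y, x ≠ y → proj x = proj y → ∃ ε > 0, ∀ s t z z', s ≤ ε → t ≤ ε →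
    R x s z → R y t z' → proj z = proj z' → s = 0 ∧ t = 0
  continuous : ∀ {x t y}, R x t y → ∃ c : ℝ → M, ContinuousOn c (Icc 0 t) ∧
    ∀ s z, s ≤ t → R x s z → proj z = c s

namespace PartialFlow

variable {X M : Type*} [TopologicalSpace M] (F : PartialFlow X M) {x y z : X} {s t : ℝ}

lemma refl_left (h : F.R x t y) : F.R x 0 x := by
  obtain ⟨w, hw, -⟩ := F.split h le_rfl (F.nonneg h)
  rwa [← F.zero_eq hw] at hw

lemma rev_rel' (h : F.R (F.rev y) t (F.rev x)) : F.R x t y := by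
  simpa [F.rev_rev] using F.rev_rel h

lemma rev_rel_left (h : F.R (F.rev y) t x) : F.R (F.rev x) t y := by
  simpa [F.rev_rev] using F.rev_rel h

lemma rev_rel_right (h : F.R x t (F.rev y)) : F.R y t (F.rev x) := by
  simpa [F.rev_rev] using F.rev_rel h

lemma rev_injective : Function.Injective F.rev := fun x y h => by
  rw [← F.rev_rev x, h, F.rev_rev]

lemma tail (h : F.R x s y) (h' : F.R x t z) (hst : s ≤ t) : F.R y (t - s) z := by
  obtain ⟨w, hw, hw'⟩ := F.split h' (F.nonneg h) hst
  rwa [F.functional h hw]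

lemma tail' (h : F.R x s z) (h' : F.R y t z) (hst : s ≤ t) : F.R y (t - s) x :=
  F.rev_rel' (F.tail (F.rev_rel h) (F.rev_rel h') hst)

/-- Such a trajectory would be its own reversal, so its midpoint would be a vector equal to its
reverse. -/
lemma not_rel_rev (h : F.R x t (F.rev x)) : False := by
  have h0 := F.nonneg h
  obtain ⟨m, hm, hm'⟩ := F.split h (s := t / 2) (by linarith) (by linarith)
  have h2 := F.rev_rel_right hm'
  rw [show t - t / 2 = t / 2 by ring] at h2
  exact F.rev_ne hm' (F.functional h2 hm)

/-- Local injectivity of the trajectory, applied forwards and backwards at each time r, leaves at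
most one hit on either side of r; compactness of `Icc 0 t` does the rest. -/
lemma finite_hits (h : F.R x t y) (p : M) :
    {s | s ≤ t ∧ ∃ z, F.R x s z ∧ F.proj z = p}.Finite := by
  set S := {s | s ≤ t ∧ ∃ z, F.R x s z ∧ F.proj z = p} with hS
  have hsub : S ⊆ Icc 0 t := fun s hs => ⟨F.nonneg hs.2.choose_spec.1, hs.1⟩
  suffices H : (Icc 0 t ∩ S).Finite from H.subset (subset_inter hsub subset_rfl)
  refine isCompact_Icc.induction_on (p := fun u => (u ∩ S).Finite) (by simp)
    (fun u v huv hv => hv.subset (inter_subset_inter_left _ huv))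
    (fun u v hu hv => by rw [union_inter_distrib_right]; exact hu.union hv) fun r hr => ?_
  obtain ⟨w, hw, hw'⟩ := F.split h hr.1 hr.2
  obtain ⟨ε₁, hε₁, H₁⟩ := F.injective w
  obtain ⟨ε₂, hε₂, H₂⟩ := F.injective (F.rev w)
  refine ⟨Icc (r - ε₂) (r + ε₁), mem_nhdsWithin_of_mem_nhds
    (Icc_mem_nhds (by linarith) (by linarith)), ?_⟩
  have hfin : ((Icc (r - ε₂) r ∩ S) ∪ (Icc r (r + ε₁) ∩ S)).Finite := by
    refine Set.Finite.union (Set.Subsingleton.finite ?_) (Set.Subsingleton.finite ?_)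
    · rintro a ⟨ha, -, z, hz, hzp⟩ b ⟨hb, -, z', hz', hzp'⟩
      have := H₂ (r - a) (r - b) _ _ (by linarith [ha.1]) (by linarith [hb.1])
        (F.rev_rel (F.tail hz hw ha.2)) (F.rev_rel (F.tail hz' hw hb.2))
        (by rw [F.proj_rev, F.proj_rev, hzp, hzp'])
      linarith
    · rintro a ⟨ha, -, z, hz, hzp⟩ b ⟨hb, -, z', hz', hzp'⟩
      have := H₁ (a - r) (b - r) _ _ (by linarith [ha.2]) (by linarith [hb.2])
        (F.tail hw hz ha.1) (F.tail hw hz' hb.1) (by rw [hzp, hzp'])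
      linarith
  refine hfin.subset ?_
  rintro a ⟨ha, haS⟩
  rcases le_total a r with h | h
  · exact Or.inl ⟨⟨ha.1, h⟩, haS⟩
  · exact Or.inr ⟨⟨h, ha.2⟩, haS⟩

lemma finite_hits_set (h : F.R x t y) {P : Set M} (hP : P.Finite) :
    {s | s ≤ t ∧ ∃ z, F.R x s z ∧ F.proj z ∈ P}.Finite := by
  refine (hP.biUnion fun p _ => F.finite_hits h p).subset ?_
  rintro s ⟨hs, z, hz, hzp⟩
  exact mem_biUnion hzp ⟨hs, z, hz, rfl⟩

lemma exists_first_hit (h : F.R x t y) (ht : 0 < t) {P : Set M} (hP : P.Finite)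
    (hy : F.proj y ∈ P) : ∃ r w, 0 < r ∧ F.R x r w ∧ F.proj w ∈ P ∧
      ∀ s z, 0 < s → s < r → F.R x s z → F.proj z ∉ P := by
  obtain ⟨r, ⟨⟨hrt, w, hw, hwP⟩, hr⟩, hmin⟩ := Set.exists_min_image
    ({s | s ≤ t ∧ ∃ z, F.R x s z ∧ F.proj z ∈ P} ∩ Ioi 0) id
    ((F.finite_hits_set h hP).inter_of_left _) ⟨t, ⟨le_rfl, y, h, hy⟩, ht⟩
  refine ⟨r, w, hr, hw, hwP, fun s z hs hsr hz hzP => ?_⟩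
  exact absurd (hmin s ⟨⟨hsr.le.trans hrt, z, hz, hzP⟩, hs⟩) (not_le.2 hsr)

lemma exists_pos_forall_notMem (h : F.R x t y) {P : Set M} (hP : P.Finite) :
    ∃ ε > 0, ∀ s z, 0 < s → s ≤ ε → s ≤ t → F.R x s z → F.proj z ∉ P := by
  have hfin := (F.finite_hits_set h hP).inter_of_left (Ioi 0)
  have h0 : ({s | s ≤ t ∧ ∃ z, F.R x s z ∧ F.proj z ∈ P} ∩ Ioi 0)ᶜ ∈ 𝓝 (0 : ℝ) :=
    hfin.isClosed.isOpen_compl.mem_nhds (fun h => lt_irrefl (0 : ℝ) h.2)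
  obtain ⟨ε, hε, hsub⟩ := Metric.mem_nhds_iff.1 h0
  refine ⟨ε / 2, by positivity, fun s z hs hsε hst hz hzP => ?_⟩
  exact hsub (a := s) (by simp [abs_of_pos hs]; linarith) ⟨⟨hst, z, hz, hzP⟩, hs⟩

end PartialFlow

/-! ### Systems of arcs and their counting function -/

/-- A finite family of trajectories with multiplicities, stable under reversal. -/
structure ArcSystem {X M : Type*} [TopologicalSpace M] (F : PartialFlow X M) where
  A : Type
  [fintypeA : Fintype A]
  start : A → X
  len : A → ℝ
  mult : A → ℕ
  rev : A → A
  len_pos : ∀ a, 0 < len a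
  mult_pos : ∀ a, 0 < mult a
  rev_rev : ∀ a, rev (rev a) = a
  len_rev : ∀ a, len (rev a) = len a
  mult_rev : ∀ a, mult (rev a) = mult a
  -- The start of the reversed arc points back along the arc; the final vector of the arc is its
  -- reverse.
  rel : ∀ a, F.R (start a) (len a) (F.rev (start (rev a)))

namespace ArcSystem

variable {X M : Type*} [TopologicalSpace M] {F : PartialFlow X M} (S : ArcSystem F)

instance : Fintype S.A := S.fintypeA

/-- The times at which the arc `a` passes through `x`. -/
def visits (a : S.A) (x : X) : Set ℝ := {t | t ∈ Ico 0 (S.len a) ∧ F.R (S.start a) t x}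

/-- The number of passages of the arcs through `x`, with multiplicities. -/
def count (x : X) : ℕ := ∑ a, S.mult a * (S.visits a x).ncard

/-- The end points of the arcs. -/
def ends : Set M := range fun a => F.proj (S.start a)

/-- Reversal of arcs, as a permutation. -/
def revEquiv : S.A ≃ S.A := ⟨S.rev, S.rev, S.rev_rev, S.rev_rev⟩

variable {x y z : X} {s t : ℝ}

lemma finite_ends : S.ends.Finite := finite_range _

lemma finite_visits (a : S.A) (x : X) : (S.visits a x).Finite := by
  refine (F.finite_hits (S.rel a) (F.proj x)).subset ?_
  rintro t ⟨ht, h⟩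
  exact ⟨ht.2.le, x, h, rfl⟩

lemma count_pos : 0 < S.count x ↔ ∃ a, (S.visits a x).Nonempty := by
  rw [count, Finset.sum_pos_iff]
  refine ⟨fun ⟨a, _, h⟩ => ⟨a, ?_⟩, fun ⟨a, h⟩ => ⟨a, Finset.mem_univ _, ?_⟩⟩
  · exact nonempty_of_ncard_ne_zero (Nat.pos_of_mul_pos_left h).ne'
  · exact Nat.mul_pos (S.mult_pos a) ((ncard_pos (S.finite_visits a x)).2 h)

/-- The passages through y are those through x delayed by t: a passage through y that is younger
than t would have its arc starting on the way, and a passage through x with less than t left would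
have its arc ending there. -/
lemma count_step (h : F.R x t y) (ht : 0 < t)
    (hP : ∀ s z, 0 < s → s ≤ t → F.R x s z → F.proj z ∉ S.ends) : S.count y = S.count x := by
  unfold count
  refine Finset.sum_congr rfl fun a _ => ?_
  have : S.visits a y = (· + t) '' S.visits a x := by
    ext r
    constructor
    · rintro ⟨hr, hry⟩
      have htr : t ≤ r := by
        by_contra hlt
        push Not at hlt
        have h1 := F.tail' hry h hlt.le
        exact hP (t - r) _ (by linarith) (by linarith [hr.1]) h1 (mem_range_self a)
      exact ⟨r - t, ⟨⟨by linarith, by linarith [hr.2]⟩, F.tail' h hry htr⟩, by simp⟩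
    · rintro ⟨r, ⟨hr, hrx⟩, rfl⟩
      refine ⟨⟨by linarith [hr.1], ?_⟩, F.concat hrx h⟩
      by_contra hlt
      push Not at hlt
      have h1 := F.tail hrx (S.rel a) hr.2.le
      refine hP (S.len a - r) _ (by linarith [hr.2]) (by linarith) h1 ?_
      rw [F.proj_rev]
      exact mem_range_self _
  rw [this, ncard_image_of_injective _ (add_left_injective t)]

/-- Immediately after x the trajectory avoids the finitely many ends, even if x itself lies over
one. -/
lemma exists_pos_count_eq (h : F.R x t y) :
    ∃ ε > 0, ∀ s z, s ≤ ε → s ≤ t → F.R x s z → S.count z = S.count x := by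
  obtain ⟨ε, hε, H⟩ := F.exists_pos_forall_notMem h S.finite_ends
  refine ⟨ε, hε, fun s z hsε hst hz => ?_⟩
  rcases (F.nonneg hz).eq_or_lt with rfl | hs
  · rw [F.zero_eq hz]
  · exact S.count_step hz hs fun r w hr hrs hw => H r w hr (hrs.trans hsε) (hrs.trans hst) hw

/-- Along a trajectory which avoids a set off which the counting function is symmetric, the
counting function is constant. -/
lemma count_const {P : Set M} (hsym : ∀ x, F.proj x ∉ P → S.count (F.rev x) = S.count x)
    (h : F.R x t y) (ht : 0 < t) (hP : ∀ s z, 0 < s → s < t → F.R x s z → F.proj z ∉ P) :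
    S.count (F.rev y) = S.count x ∧ ∀ s z, s < t → F.R x s z → S.count z = S.count x := by
  have hex : ∀ s, ∃ z, s ∈ Icc 0 t → F.R x s z := fun s => by
    by_cases hs : s ∈ Icc 0 t
    · exact (F.split h hs.1 hs.2).imp fun z hz _ => hz.1
    · exact ⟨x, fun h => absurd h hs⟩
  choose c hc using hex
  have right : ∀ s ∈ Ico 0 t, ∃ ε > 0, ∀ r, s ≤ r → r ≤ s + ε → r < t →
      S.count (c r) = S.count (c s) := by
    intro s hs
    have hs' : s ∈ Icc 0 t := ⟨hs.1, hs.2.le⟩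
    obtain ⟨ε, hε, H⟩ := S.exists_pos_count_eq (F.tail (hc s hs') h hs.2.le)
    refine ⟨ε, hε, fun r hr hrε hrt => H (r - s) _ (by linarith) (by linarith)
      (F.tail (hc s hs') (hc r ⟨hs.1.trans hr, hrt.le⟩) hr)⟩
  -- Constancy to the left of s is constancy to the right for the reversed trajectory. It compares
  -- with the reverse of `c s`, and symmetry is used only at times in the open interval, since the
  -- final point may lie in P.
  have left : ∀ s ∈ Ioc 0 t, ∃ ε > 0, ∀ r, s - ε ≤ r → 0 < r → r < s →
      S.count (c r) = S.count (F.rev (c s)) := by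
    intro s hs
    have hs' : s ∈ Icc 0 t := ⟨hs.1.le, hs.2⟩
    obtain ⟨ε, hε, H⟩ := S.exists_pos_count_eq (F.rev_rel (hc s hs'))
    refine ⟨ε, hε, fun r hr hr0 hrs => ?_⟩
    have hr' : r ∈ Icc 0 t := ⟨hr0.le, hrs.le.trans hs.2⟩
    rw [← hsym _ (hP r _ hr0 (hrs.trans_le hs.2) (hc r hr'))]
    exact H (s - r) _ (by linarith) (by linarith) (F.rev_rel (F.tail (hc r hr') (hc s hs') hrs.le))
  -- A continuous function to the discrete space ℕ is constant on an interval.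
  have hcont : ContinuousOn (fun s => S.count (c s)) (Ico 0 t) := by
    intro s hs
    obtain ⟨ε₁, hε₁, H₁⟩ := right s hs
    refine (continuousWithinAt_const (b := S.count (c s))).congr_of_eventuallyEq ?_ rfl
    rcases hs.1.eq_or_lt with rfl | hs0
    · filter_upwards [self_mem_nhdsWithin, mem_nhdsWithin_of_mem_nhds
        (Iio_mem_nhds (show (0 : ℝ) < 0 + ε₁ by linarith))] with r hr hr'
      exact H₁ r hr.1 (le_of_lt hr') hr.2
    · obtain ⟨ε₂, hε₂, H₂⟩ := left s ⟨hs0, hs.2.le⟩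
      filter_upwards [self_mem_nhdsWithin, mem_nhdsWithin_of_mem_nhds
        (Ioo_mem_nhds (show s - ε₂ < s by linarith) (show s < s + ε₁ by linarith)),
        mem_nhdsWithin_of_mem_nhds (Ioi_mem_nhds hs0)] with r hr hr' hr0
      rcases le_or_gt s r with hsr | hsr
      · exact H₁ r hsr hr'.2.le hr.2
      · rw [H₂ r hr'.1.le hr0 hsr]
        exact hsym _ (hP s _ hs0 hs.2 (hc s ⟨hs.1, hs.2.le⟩))
  have h0 : c 0 = x := (F.zero_eq (hc 0 ⟨le_rfl, ht.le⟩)).symm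
  have hconst : ∀ s ∈ Ico 0 t, S.count (c s) = S.count x := fun s hs => by
    have := isPreconnected_Ico.constant hcont hs (⟨le_rfl, ht⟩ : (0 : ℝ) ∈ Ico 0 t)
    rwa [h0] at this
  constructor
  · obtain ⟨ε, hε, H⟩ := left t ⟨ht, le_rfl⟩
    have hct : c t = y := F.functional (hc t ⟨ht.le, le_rfl⟩) h
    -- Any time in (0, t) within ε of t would do.
    have h1 := H (max (t - ε) (t / 2)) (le_max_left _ _)
      (lt_max_of_lt_right (by linarith)) (max_lt (by linarith) (by linarith))
    rw [← hct, ← h1]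
    exact hconst _ ⟨le_max_of_le_right (by linarith), max_lt (by linarith) (by linarith)⟩
  · intro s z hs hz
    have hs0 := F.nonneg hz
    rw [F.functional hz (hc s ⟨hs0, hs.le⟩)]
    exact hconst s ⟨hs0, hs⟩

end ArcSystem

/-! ### Singular points and minimal cuts -/

namespace ArcSystem

variable {X M : Type*} [TopologicalSpace M] {F : PartialFlow X M} (S : ArcSystem F)
variable {x y z : X} {s t : ℝ}

/-- The points through which two different undirected trajectories of the system pass. -/
def singular : Set M := {p | ∃ x z, 0 < S.count x ∧ 0 < S.count z ∧ F.proj x = p ∧ F.proj z = p ∧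
  z ≠ x ∧ z ≠ F.rev x}

lemma eventually_of_exists {p : ℝ → Prop} (h : ∃ ε > 0, p ε) (hp : ∀ ε ε', ε ≤ ε' → p ε' → p ε) :
    ∀ᶠ ε in 𝓝[>] (0 : ℝ), p ε := by
  obtain ⟨ε, hε, h⟩ := h
  filter_upwards [Ioc_mem_nhdsGT hε] with δ hδ using hp δ ε hδ.2 h

/-- Singular points are isolated. Arcs come close to p only at times close to a passage through p,
so every vector of the system over a nearby q lies, up to reversal, on a short trajectory issued
from one of finitely many vectors W at p. Short trajectories from W are injective and meet one
another only at p. -/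
lemma exists_nhds_inter_singular_subset [T2Space M] (p : M) :
    ∃ U ∈ 𝓝 p, U ∩ S.singular ⊆ {p} := by
  set T : S.A → Set ℝ := fun a =>
    {s | s ≤ S.len a ∧ ∃ z, F.R (S.start a) s z ∧ F.proj z = p} with hT
  have hTfin : ∀ a, (T a).Finite := fun a => F.finite_hits (S.rel a) p
  have hex : ∀ a s, ∃ z, s ∈ T a → F.R (S.start a) s z ∧ F.proj z = p := fun a s => by
    by_cases hs : s ∈ T a
    · obtain ⟨z, hz⟩ := hs.2
      exact ⟨z, fun _ => hz⟩
    · exact ⟨S.start a, fun h => absurd h hs⟩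
  choose c hc using hex
  set C : Set X := ⋃ a, c a '' T a with hC
  have hCfin : C.Finite := finite_iUnion fun a => (hTfin a).image _
  have hCp : ∀ w ∈ C, F.proj w = p := by
    intro w hw
    obtain ⟨a, s, hs, rfl⟩ := mem_iUnion.1 hw
    exact (hc a s hs).2
  -- Reverses are included in order to treat times before a passage as times after the reversed
  -- passage.
  set W : Set X := C ∪ F.rev '' C with hW
  have hWfin : W.Finite := hCfin.union (hCfin.image _)
  have hWp : ∀ w ∈ W, F.proj w = p := by
    rintro w (hw | ⟨w, hw, rfl⟩)
    · exact hCp w hw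
    · rw [F.proj_rev]; exact hCp w hw
  have ev1 : ∀ᶠ ε in 𝓝[>] (0 : ℝ), ∀ w ∈ W, ∀ s t z z', s ≤ ε → t ≤ ε → F.R w s z → F.R w t z' →
      F.proj z = F.proj z' → s = t := by
    refine (eventually_all_finite hWfin).2 fun w _ => eventually_of_exists (F.injective w) ?_
    exact fun ε ε' h H s t z z' hs ht => H s t z z' (hs.trans h) (ht.trans h)
  have ev2 : ∀ᶠ ε in 𝓝[>] (0 : ℝ), ∀ w ∈ W, ∀ w' ∈ W, w ≠ w' → ∀ s t z z', s ≤ ε → t ≤ ε →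
      F.R w s z → F.R w' t z' → F.proj z = F.proj z' → s = 0 ∧ t = 0 := by
    refine (eventually_all_finite hWfin).2 fun w hw => (eventually_all_finite hWfin).2
      fun w' hw' => ?_
    by_cases hne : w = w'
    · exact Eventually.of_forall fun _ h => absurd hne h
    · refine eventually_of_exists ((F.separated w w' hne (by rw [hWp w hw, hWp w' hw'])).imp
        fun ε h => ⟨h.1, fun _ => h.2⟩) ?_
      exact fun ε ε' h H hne s t z z' hs ht => H hne s t z z' (hs.trans h) (ht.trans h)
  obtain ⟨ε, ⟨H₁, H₂⟩, hε⟩ := ((ev1.and ev2).and self_mem_nhdsWithin).exists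
  have hε : 0 < ε := hε
  choose g hgc hg using fun a => F.continuous (S.rel a)
  -- The times at distance at least ε from all passages of a through p. Their image is compact and
  -- misses p, so its complement is a neighbourhood of p.
  set K : S.A → Set ℝ := fun a => Icc 0 (S.len a) \ ⋃ s ∈ T a, Ioo (s - ε) (s + ε) with hK
  have hKc : ∀ a, IsCompact (K a) := fun a =>
    isCompact_Icc.diff (isOpen_biUnion fun s _ => isOpen_Ioo)
  have hgK : ∀ a, p ∉ g a '' K a := by
    rintro a ⟨s, hs, hsp⟩
    obtain ⟨z, hz, -⟩ := F.split (S.rel a) hs.1.1 hs.1.2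
    have hsT : s ∈ T a := ⟨hs.1.2, z, hz, by rw [hg a s z hs.1.2 hz, hsp]⟩
    exact hs.2 (mem_biUnion hsT ⟨by linarith, by linarith⟩)
  refine ⟨⋂ a, (g a '' K a)ᶜ, iInter_mem.2 fun a => ?_, ?_⟩
  · exact ((hKc a).image_of_continuousOn ((hgc a).mono sdiff_subset)).isClosed.isOpen_compl.mem_nhds
      (hgK a)
  rintro q ⟨hqU, x, z, hx, hz, hxq, hzq, hzx, hzx'⟩
  have near : ∀ x, 0 < S.count x → F.proj x = q →
      ∃ w ∈ W, ∃ r ≤ ε, F.R w r x ∨ F.R w r (F.rev x) := by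
    intro x hx hxq
    obtain ⟨a, s, hs, hsx⟩ := S.count_pos.1 hx
    have hsK : s ∉ K a := by
      intro hsK
      refine (mem_iInter.1 hqU a) ⟨s, hsK, ?_⟩
      rw [← hg a s x hs.2.le hsx, hxq]
    have : s ∈ ⋃ s ∈ T a, Ioo (s - ε) (s + ε) := by
      by_contra h
      exact hsK ⟨⟨hs.1, hs.2.le⟩, h⟩
    obtain ⟨r, hr, hsr⟩ := mem_iUnion₂.1 this
    have hrc := (hc a r hr).1
    have hmem : c a r ∈ C := mem_iUnion.2 ⟨a, mem_image_of_mem _ hr⟩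
    rcases le_total r s with h | h
    · exact ⟨_, Or.inl hmem, s - r, by linarith [hsr.2], Or.inl (F.tail hrc hsx h)⟩
    · exact ⟨_, Or.inr (mem_image_of_mem _ hmem), r - s, by linarith [hsr.1],
        Or.inr (F.rev_rel (F.tail hsx hrc h))⟩
  by_contra hqp
  have hqp : q ≠ p := hqp
  -- From the same w, equal projections force equal times, hence equal vectors; from different ones,
  -- both times are zero and q = p.
  have clash : ∀ x' z' w w' r r', (x' = x ∨ x' = F.rev x) → (z' = z ∨ z' = F.rev z) →
      w ∈ W → w' ∈ W → r ≤ ε → r' ≤ ε → F.R w r x' → F.R w' r' z' → False := by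
    intro x' z' w w' r r' hx' hz' hw hw' hr hr' h h'
    have hpx : F.proj x' = q := by rcases hx' with rfl | rfl <;> simp [F.proj_rev, hxq]
    have hpz : F.proj z' = q := by rcases hz' with rfl | rfl <;> simp [F.proj_rev, hzq]
    by_cases hww : w = w'
    · subst hww
      have := H₁ w hw r r' x' z' hr hr' h h' (by rw [hpx, hpz])
      subst this
      have := F.functional h h'
      subst this
      rcases hx' with rfl | rfl <;> rcases hz' with h0 | h0
      · exact hzx h0.symm
      · exact hzx' (by rw [h0, F.rev_rev])
      · exact hzx' h0.symm
      · exact hzx (F.rev_injective h0.symm)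
    · obtain ⟨rfl, rfl⟩ := H₂ w hw w' hw' hww r r' x' z' hr hr' h h' (by rw [hpx, hpz])
      rw [← F.zero_eq h, hWp w hw] at hpx
      exact hqp hpx.symm
  obtain ⟨w, hw, r, hr, h⟩ := near x hx hxq
  obtain ⟨w', hw', r', hr', h'⟩ := near z hz hzq
  rcases h with h | h <;> rcases h' with h' | h'
  · exact clash x z w w' r r' (Or.inl rfl) (Or.inl rfl) hw hw' hr hr' h h'
  · exact clash x _ w w' r r' (Or.inl rfl) (Or.inr rfl) hw hw' hr hr' h h'
  · exact clash _ z w w' r r' (Or.inr rfl) (Or.inl rfl) hw hw' hr hr' h h'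
  · exact clash _ _ w w' r r' (Or.inr rfl) (Or.inr rfl) hw hw' hr hr' h h'

lemma finite_singular [T2Space M] [CompactSpace M] : S.singular.Finite := by
  have := isCompact_univ.induction_on (p := fun u : Set M => (u ∩ S.singular).Finite) (by simp)
    (fun u v huv hv => hv.subset (inter_subset_inter_left _ huv))
    (fun u v hu hv => by rw [union_inter_distrib_right]; exact hu.union hv) fun p _ => by
      obtain ⟨U, hU, hsub⟩ := S.exists_nhds_inter_singular_subset p
      exact ⟨U, mem_nhdsWithin_of_mem_nhds hU, (finite_singleton p).subset hsub⟩
  simpa using this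

/-- The system is balanced: if only two vectors at a point carry arcs, then they are opposite and
carry the same multiplicity. -/
def Balanced : Prop := ∀ x y, 0 < S.count x →
  (∀ z, F.proj z = F.proj x → 0 < S.count z → z = x ∨ z = y) →
    y = F.rev x ∧ S.count y = S.count x

/-- A finite set of points of the arcs off which the arcs do not cross, and which each arc meets. -/
structure IsCut (P : Set M) : Prop where
  finite : P.Finite
  exists_count_pos : ∀ p ∈ P, ∃ x, 0 < S.count x ∧ F.proj x = p
  regular : ∀ x z, 0 < S.count x → 0 < S.count z → F.proj z = F.proj x → F.proj x ∉ P →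
    z = x ∨ z = F.rev x
  hits : ∀ x, 0 < S.count x → ∃ t y, 0 < t ∧ F.R x t y ∧ F.proj y ∈ P

lemma count_start_pos (a : S.A) : 0 < S.count (S.start a) :=
  S.count_pos.2 ⟨a, 0, ⟨le_rfl, S.len_pos a⟩, F.refl_left (S.rel a)⟩

/-- The ends of the arcs are included so that every trajectory of the system runs into the cut. -/
lemma exists_isCut [T2Space M] [CompactSpace M] : ∃ P, S.IsCut P := by
  refine ⟨S.ends ∪ S.singular, S.finite_ends.union S.finite_singular, ?_, ?_, ?_⟩
  · rintro p (⟨a, rfl⟩ | ⟨x, -, hx, -, hxp, -⟩)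
    · exact ⟨_, S.count_start_pos a, rfl⟩
    · exact ⟨x, hx, hxp⟩
  · intro x z hx hz hzx hxP
    by_contra hcon
    push Not at hcon
    exact hxP (Or.inr ⟨x, z, hx, hz, rfl, hzx, hcon.1, hcon.2⟩)
  · intro x hx
    obtain ⟨a, t, ht, htx⟩ := S.count_pos.1 hx
    refine ⟨S.len a - t, _, by linarith [ht.2], F.tail htx (S.rel a) ht.2.le, Or.inl ?_⟩
    rw [F.proj_rev]
    exact mem_range_self _

lemma exists_minimal_isCut [T2Space M] [CompactSpace M] :
    ∃ P, S.IsCut P ∧ ∀ P', S.IsCut P' → P.ncard ≤ P'.ncard := by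
  obtain ⟨P₀, h₀⟩ := S.exists_isCut
  obtain ⟨P, hP, hmin⟩ := WellFounded.has_min (measure (fun P : Set M => P.ncard)).wf
    {P | S.IsCut P} ⟨P₀, h₀⟩
  exact ⟨P, hP, fun P' hP' => not_lt.1 (hmin P' hP')⟩

variable {S} {P : Set M}

/-- Off the cut only x and its reverse can carry arcs, so the balance condition compares exactly
these two. -/
lemma IsCut.count_rev (hP : S.IsCut P) (hS : S.Balanced) (hx : F.proj x ∉ P) :
    S.count (F.rev x) = S.count x := by
  have key : ∀ x, F.proj x ∉ P → 0 < S.count x → S.count (F.rev x) = S.count x := by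
    intro x hx h
    exact (hS x (F.rev x) h fun z hzx hz => hP.regular x z h hz hzx hx).2
  rcases Nat.eq_zero_or_pos (S.count x) with h | h
  · rcases Nat.eq_zero_or_pos (S.count (F.rev x)) with h' | h'
    · rw [h, h']
    · rw [← key _ (by rwa [F.proj_rev]) h', F.rev_rev]
  · exact key x hx h

lemma IsCut.exists_first_hit (hP : S.IsCut P) (hS : S.Balanced) (hx : 0 < S.count x) :
    ∃ t y, 0 < t ∧ F.R x t y ∧ F.proj y ∈ P ∧ S.count (F.rev y) = S.count x ∧
      ∀ s z, 0 < s → s < t → F.R x s z → F.proj z ∉ P ∧ S.count z = S.count x := by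
  obtain ⟨t, y, ht, h, hy⟩ := hP.hits x hx
  obtain ⟨r, w, hr, hw, hwP, H⟩ := F.exists_first_hit h ht hP.finite hy
  have hc := S.count_const (fun x hx => hP.count_rev hS hx) hw hr H
  exact ⟨r, w, hr, hw, hwP, hc.1, fun s z h0 hs hz => ⟨H s z h0 hs hz, hc.2 s z hs hz⟩⟩

/-- At a point of a minimal cut through which only one undirected trajectory passes, this
trajectory closes up before meeting the cut elsewhere. -/
lemma IsCut.closes_up (hP : S.IsCut P) (hS : S.Balanced)
    (hmin : ∀ P', S.IsCut P' → P.ncard ≤ P'.ncard) (hx : 0 < S.count x) (hxP : F.proj x ∈ P)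
    (hD : ∀ z, F.proj z = F.proj x → 0 < S.count z → z = x ∨ z = y) :
    ∃ t, 0 < t ∧ F.R x t x ∧ ∀ s z, 0 < s → s < t → F.R x s z → F.proj z ∉ P := by
  obtain ⟨rfl, hyx⟩ := hS x y hx hD
  obtain ⟨t, e, ht, hte, heP, hce, He⟩ := hP.exists_first_hit hS hx
  by_cases hep : F.proj e = F.proj x
  · rcases hD (F.rev e) (by rw [F.proj_rev, hep]) (by omega) with h | h
    · refine (F.not_rel_rev (x := x) (t := t) ?_).elim
      rw [← h, F.rev_rev, h]; exact hte
    · rw [F.rev_injective h] at hte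
      exact ⟨t, ht, hte, fun s z h0 h1 hz => (He s z h0 h1 hz).1⟩
  -- Otherwise the first hits e forwards and e' backwards both lie over other points of P, and P
  -- without this point is a smaller cut.
  exfalso
  obtain ⟨t', e', ht', hte', heP', hce', He'⟩ := hP.exists_first_hit hS (x := F.rev x) (by omega)
  have hep' : F.proj e' ≠ F.proj x := by
    intro hep'
    rcases hD (F.rev e') (by rw [F.proj_rev, hep']) (by omega) with h | h
    · have hl : F.R x t' x := by
        have := F.rev_rel hte'
        rwa [h, F.rev_rev] at this
      -- A backward return makes the trajectory of x periodic with period t', which contradicts the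
      -- first forward hit e at time t being over another point.
      rcases lt_trichotomy t t' with h1 | rfl | h1
      · obtain ⟨w, hw, hw'⟩ := F.split hl ht.le h1.le
        rw [F.functional hw hte] at hw'
        have h3 := (He' (t' - t) (F.rev e) (by linarith) (by linarith) (F.rev_rel hw')).1
        rw [F.proj_rev] at h3
        exact h3 heP
      · exact hep (by rw [F.functional hte hl])
      · exact (He t' x ht' h1 hl).1 hxP
    · rw [F.rev_injective h] at hte'
      exact F.not_rel_rev (x := F.rev x) (by rwa [F.rev_rev])
  have hcut : S.IsCut (P \ {F.proj x}) := by
    refine ⟨hP.finite.sdiff, fun p hp => hP.exists_count_pos p hp.1, ?_, ?_⟩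
    · intro x' z hx' hz hzx' hx'P
      by_cases hx'x : F.proj x' = F.proj x
      · rcases hD x' hx'x hx' with rfl | rfl
        · exact hD z hzx' hz
        · rw [F.rev_rev]
          exact (hD z (by rw [hzx', hx'x]) hz).symm
      · exact hP.regular x' z hx' hz hzx' fun h => hx'P ⟨h, hx'x⟩
    · intro x' hx'
      obtain ⟨r, w, hr, hrw, hwP, hcw, -⟩ := hP.exists_first_hit hS hx'
      -- A trajectory which hits the removed point continues along x or its reverse to e or e',
      -- which stay in the cut.
      by_cases hwx : F.proj w = F.proj x
      · rcases hD (F.rev w) (by rw [F.proj_rev, hwx]) (by omega) with h | h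
        · rw [← h, F.rev_rev] at hte'
          exact ⟨r + t', e', by linarith, F.concat hrw hte', heP', hep'⟩
        · rw [← F.rev_injective h] at hte
          refine ⟨r + t, e, by linarith, F.concat hrw hte, heP, hep⟩
      · exact ⟨r, w, hr, hrw, hwP, hwx⟩
  have := hmin _ hcut
  have h2 := ncard_sdiff_singleton_lt_of_mem hxP hP.finite
  omega

end ArcSystem

/-! ### Quantities determined by the counting function -/

namespace ArcSystem

variable {X M : Type*} [TopologicalSpace M] {F : PartialFlow X M} (S : ArcSystem F)
variable {x y z : X} {s t : ℝ} {P : Set M}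

/-- The vectors at points of `P` which carry arcs of the system. -/
def darts (P : Set M) : Set X := {x | 0 < S.count x ∧ F.proj x ∈ P}

/-- The times at which the arc `a` meets `P`. -/
def times (P : Set M) (a : S.A) : Set ℝ :=
  {t | t ∈ Ico 0 (S.len a) ∧ ∃ z, F.R (S.start a) t z ∧ F.proj z ∈ P}

lemma finite_times (hP : P.Finite) (a : S.A) : (S.times P a).Finite := by
  refine (F.finite_hits_set (S.rel a) hP).subset ?_
  rintro t ⟨ht, h⟩
  exact ⟨ht.2.le, h⟩

/-- The vector of the arc `a` at time `t`. -/
def point (a : S.A) (t : ℝ) : X :=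
  -- The value `S.start a` is a default; it plays no role for times in `Icc 0 (S.len a)`.
  open Classical in if h : ∃ z, F.R (S.start a) t z then h.choose else S.start a

lemma point_eq {a : S.A} (h : F.R (S.start a) t z) : S.point a t = z := by
  have hex : ∃ z, F.R (S.start a) t z := ⟨z, h⟩
  rw [point, dif_pos hex]
  exact F.functional hex.choose_spec h

lemma rel_point {a : S.A} (ht : t ∈ Icc 0 (S.len a)) : F.R (S.start a) t (S.point a t) := by
  obtain ⟨z, hz, -⟩ := F.split (S.rel a) ht.1 ht.2
  rwa [S.point_eq hz]

lemma mem_times {a : S.A} : t ∈ S.times P a ↔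
    t ∈ Ico 0 (S.len a) ∧ F.proj (S.point a t) ∈ P := by
  refine and_congr_right fun ht => ⟨fun ⟨z, hz, hzP⟩ => by rwa [S.point_eq hz], fun h => ?_⟩
  exact ⟨_, S.rel_point ⟨ht.1, ht.2.le⟩, h⟩

lemma count_point_pos {a : S.A} (ht : t ∈ Ico 0 (S.len a)) : 0 < S.count (S.point a t) :=
  S.count_pos.2 ⟨a, t, ht, S.rel_point ⟨ht.1, ht.2.le⟩⟩

lemma visits_eq (a : S.A) (x : X) :
    S.visits a x = {t | t ∈ Ico 0 (S.len a) ∧ S.point a t = x} := by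
  ext t
  refine and_congr_right fun ht => ⟨fun h => S.point_eq h, fun h => ?_⟩
  rw [← h]
  exact S.rel_point ⟨ht.1, ht.2.le⟩

lemma finite_darts (hP : P.Finite) : (S.darts P).Finite := by
  refine (finite_iUnion fun a => (S.finite_times hP a).image (S.point a)).subset ?_
  rintro x ⟨hx, hxP⟩
  obtain ⟨a, t, ht, htx⟩ := S.count_pos.1 hx
  refine mem_iUnion.2 ⟨a, t, S.mem_times.2 ⟨ht, ?_⟩, S.point_eq htx⟩
  rwa [S.point_eq htx]

/-- Double counting of the passages over P, grouped by vector on one side and by arc on the other.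
The left-hand side depends on the system only through `count`. -/
lemma sum_darts (hP : P.Finite) (g : X → ℝ) :
    ∑ x ∈ (S.finite_darts hP).toFinset, S.count x * g x =
      ∑ a, S.mult a * ∑ t ∈ (S.finite_times hP a).toFinset, g (S.point a t) := by
  classical
  have h1 : ∀ a, ∑ t ∈ (S.finite_times hP a).toFinset, g (S.point a t) =
      ∑ x ∈ (S.finite_darts hP).toFinset, ((S.visits a x).ncard : ℝ) * g x := by
    intro a
    rw [← Finset.sum_fiberwise_of_maps_to (t := (S.finite_darts hP).toFinset) (g := S.point a)]
    · refine Finset.sum_congr rfl fun x hx => ?_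
      rw [Finset.sum_congr rfl (g := fun _ => g x)
        (fun t ht => by rw [(Finset.mem_filter.1 ht).2]), Finset.sum_const, nsmul_eq_mul]
      congr 2
      rw [← ncard_coe_finset]
      congr 1
      ext t
      have hx : F.proj x ∈ P := ((Set.Finite.mem_toFinset _).1 hx).2
      simp only [Finset.coe_filter, Set.Finite.mem_toFinset, S.mem_times, S.visits_eq,
        mem_ofPred_eq]
      refine ⟨fun h => ⟨h.1.1, h.2⟩, fun h => ⟨⟨h.1, ?_⟩, h.2⟩⟩
      rwa [h.2]
    · intro t ht
      rw [Set.Finite.mem_toFinset, S.mem_times] at ht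
      rw [Set.Finite.mem_toFinset]
      exact ⟨S.count_point_pos ht.1, ht.2⟩
  simp_rw [h1, count, Nat.cast_sum, Nat.cast_mul, Finset.sum_mul, Finset.mul_sum]
  rw [Finset.sum_comm]
  simp_rw [mul_assoc]

variable {S} in
lemma darts_eq_of_count_eq {S' : ArcSystem F} (h : S'.count = S.count) (P : Set M) :
    S'.darts P = S.darts P := by
  unfold darts; rw [h]

/-- The case of constant weight 1 in `sum_darts`; for P a single point the sum is twice the
multiplicity of the net there. -/
lemma sum_mult_ncard_times {S' : ArcSystem F} (h : S'.count = S.count) (hP : P.Finite) :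
    ∑ a, S'.mult a * (S'.times P a).ncard = ∑ a, S.mult a * (S.times P a).ncard := by
  have key : ∀ S : ArcSystem F, ((∑ a, S.mult a * (S.times P a).ncard : ℕ) : ℝ) =
      ∑ x ∈ (S.finite_darts hP).toFinset, S.count x * (1 : ℝ) := by
    intro S
    rw [S.sum_darts hP]
    push_cast
    refine Finset.sum_congr rfl fun a _ => ?_
    rw [Finset.sum_const, nsmul_eq_mul, mul_one, ← ncard_coe_finset, Set.Finite.coe_toFinset]
  have h2 := (key S').trans (Eq.trans ?_ (key S).symm)
  · exact_mod_cast h2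
  · rw [h]
    refine Finset.sum_congr ?_ fun _ _ => rfl
    ext x
    simp [darts_eq_of_count_eq h]

/-- The intervals from t to t + τ t tile the interval from m to ℓ, so the sum telescopes; induction
removes the least element. -/
lemma sum_eq_sub_of_tiling {ℓ : ℝ} {τ : ℝ → ℝ} (T : Finset ℝ) :
    (∀ t ∈ T, t < ℓ ∧ 0 < τ t ∧ (t + τ t = ℓ ∨ t + τ t ∈ T) ∧
      ∀ s ∈ T, t < s → t + τ t ≤ s) → ∀ m ∈ T, (∀ t ∈ T, m ≤ t) → ∑ t ∈ T, τ t = ℓ - m := by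
  induction T using Finset.induction_on_min with
  | empty => simp
  | insert a s has ih =>
    intro H m hm hmin
    have ham : a = m := by
      rcases Finset.mem_insert.1 hm with h | h
      · exact h.symm
      · exact absurd (hmin a (Finset.mem_insert_self _ _)) (not_le.2 (has m h))
    subst ham
    have ha : a ∉ s := fun h => lt_irrefl _ (has a h)
    rw [Finset.sum_insert ha]
    obtain ⟨h1, h2, h3, h4⟩ := H a (Finset.mem_insert_self _ _)
    have H' : ∀ t ∈ s, t < ℓ ∧ 0 < τ t ∧ (t + τ t = ℓ ∨ t + τ t ∈ s) ∧
        ∀ r ∈ s, t < r → t + τ t ≤ r := by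
      intro t ht
      obtain ⟨k1, k2, k3, k4⟩ := H t (Finset.mem_insert_of_mem ht)
      refine ⟨k1, k2, k3.imp_right fun h => ?_, fun r hr => k4 r (Finset.mem_insert_of_mem hr)⟩
      refine (Finset.mem_insert.1 h).resolve_left fun h0 => ?_
      linarith [has t ht]
    rcases h3 with h3 | h3
    · have : s = ∅ := by
        refine Finset.eq_empty_of_forall_notMem fun t ht => ?_
        have := h4 t (Finset.mem_insert_of_mem ht) (has t ht)
        linarith [(H' t ht).1]
      subst this
      simp; linarith
    · have h3' : a + τ a ∈ s := (Finset.mem_insert.1 h3).resolve_left (by linarith)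
      rw [ih H' _ h3' fun t ht => h4 t (Finset.mem_insert_of_mem ht) (has t ht)]
      ring

/-- The total length is determined by the counting function. -/
lemma sum_mult_len {S' : ArcSystem F} (h : S'.count = S.count) :
    ∑ a, S'.mult a * S'.len a = ∑ a, S.mult a * S.len a := by
  classical
  set P : Set M := S.ends ∪ S'.ends with hPdef
  have hP : P.Finite := S.finite_ends.union S'.finite_ends
  -- The first positive hitting time of P, or 0 if there is none. It depends on the vector and not
  -- on the system, and P contains the ends of both systems, so that both lengths are sums of τ over
  -- the vectors at P.
  set τ : X → ℝ := fun x => if h : ∃ r w, 0 < r ∧ F.R x r w ∧ F.proj w ∈ P ∧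
      ∀ s z, 0 < s → s < r → F.R x s z → F.proj z ∉ P then h.choose else 0 with hτ
  have hτspec : ∀ x t y, F.R x t y → 0 < t → F.proj y ∈ P → 0 < τ x ∧
      (∃ w, F.R x (τ x) w ∧ F.proj w ∈ P) ∧
      ∀ s z, 0 < s → s < τ x → F.R x s z → F.proj z ∉ P := by
    intro x t y hxy ht hy
    have hex := F.exists_first_hit hxy ht hP hy
    have hx : τ x = hex.choose := dif_pos hex
    rw [hx]
    obtain ⟨w, h1, h2, h3, h4⟩ := hex.choose_spec
    exact ⟨h1, ⟨w, h2, h3⟩, h4⟩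
  have key : ∀ S : ArcSystem F, S.ends ⊆ P → ∑ a, S.mult a * S.len a =
      ∑ x ∈ (S.finite_darts hP).toFinset, S.count x * τ x := by
    intro S hS
    rw [S.sum_darts hP]
    refine Finset.sum_congr rfl fun a _ => ?_
    congr 1
    have h0 : (0 : ℝ) ∈ S.times P a :=
      ⟨⟨le_rfl, S.len_pos a⟩, _, F.refl_left (S.rel a), hS (mem_range_self a)⟩
    rw [sum_eq_sub_of_tiling (ℓ := S.len a) (τ := fun t => τ (S.point a t))
      (S.finite_times hP a).toFinset ?_ 0 (by simpa using h0) ?_, sub_zero]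
    · intro t ht
      rw [Set.Finite.mem_toFinset, S.mem_times] at ht
      have hpt := S.rel_point (a := a) ⟨ht.1.1, ht.1.2.le⟩
      have hend : F.proj (F.rev (S.start (S.rev a))) ∈ P := by
        rw [F.proj_rev]; exact hS (mem_range_self _)
      have htail := F.tail hpt (S.rel a) ht.1.2.le
      obtain ⟨k1, ⟨w, k2, k2'⟩, k3⟩ := hτspec _ _ _ htail (by linarith [ht.1.2]) hend
      have hle : ∀ s z, t < s → F.R (S.start a) s z → F.proj z ∈ P → t + τ (S.point a t) ≤ s := by
        intro s z hts hz hzP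
        by_contra hlt
        push Not at hlt
        exact k3 (s - t) z (by linarith) (by linarith) (F.tail hpt hz hts.le) hzP
      refine ⟨ht.1.2, k1, ?_, ?_⟩
      · rcases (hle _ _ ht.1.2 (S.rel a) hend).eq_or_lt with h | h
        · exact Or.inl h
        · right
          rw [Set.Finite.mem_toFinset]
          exact ⟨⟨by linarith [ht.1.1], h⟩, w, F.concat hpt k2, k2'⟩
      · intro s hs hts
        rw [Set.Finite.mem_toFinset, S.mem_times] at hs
        exact hle s _ hts (S.rel_point ⟨hs.1.1, hs.1.2.le⟩) hs.2
    · intro t ht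
      rw [Set.Finite.mem_toFinset] at ht
      exact ht.1.1
  rw [key S subset_union_left, key S' subset_union_right, h]
  refine Finset.sum_congr ?_ fun _ _ => rfl
  ext x
  simp [darts_eq_of_count_eq h]

/-- For an odd weight `wt` supported over a point `p`, only the ends of the arcs contribute to the
sum of the weights of all passages. -/
lemma sum_mult_start {wt : X → ℝ} (p : M) (hwt : ∀ x, wt (F.rev x) = -wt x)
    (hp : ∀ x, F.proj x ≠ p → wt x = 0) :
    ∑ a, S.mult a * wt (S.start a) =
      ∑ x ∈ (S.finite_darts (finite_singleton p)).toFinset, S.count x * wt x := by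
  classical
  rw [S.sum_darts (finite_singleton p)]
  set T : S.A → Finset ℝ := fun a => (S.finite_times (finite_singleton p) a).toFinset with hT
  -- The contribution of all passages other than the start of the arc.
  set J : S.A → ℝ := fun a => ∑ t ∈ (T a).erase 0, wt (S.point a t) with hJ
  have hpoint0 : ∀ a, S.point a 0 = S.start a := fun a => S.point_eq (F.refl_left (S.rel a))
  have hsplit : ∀ a, ∑ t ∈ T a, wt (S.point a t) = wt (S.start a) + J a := by
    intro a
    by_cases h0 : (0 : ℝ) ∈ T a
    · rw [← Finset.add_sum_erase _ _ h0, hpoint0]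
    · have : wt (S.start a) = 0 := by
        refine hp _ fun h => h0 ?_
        rw [hT, Set.Finite.mem_toFinset, S.mem_times, hpoint0]
        exact ⟨⟨le_rfl, S.len_pos a⟩, h⟩
      rw [this, zero_add, hJ]
      show _ = ∑ t ∈ (T a).erase 0, wt (S.point a t)
      rw [Finset.erase_eq_of_notMem h0]
  -- The passage of a at time t is matched with the passage of the reversed arc at time `S.len a -
  -- t`, where the vector is reversed and the weight changes sign. Only t = 0 has no partner,
  -- because the final time is not counted.
  have hmaps : ∀ a, ∀ t ∈ (T a).erase 0, S.len a - t ∈ (T (S.rev a)).erase 0 ∧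
      S.point (S.rev a) (S.len a - t) = F.rev (S.point a t) := by
    intro a t ht
    rw [Finset.mem_erase, hT, Set.Finite.mem_toFinset, S.mem_times] at ht
    obtain ⟨h0, ht, htp⟩ := ht
    have hr := F.rev_rel_right (F.tail (S.rel_point ⟨ht.1, ht.2.le⟩) (S.rel a) ht.2.le)
    have hpt := S.point_eq hr
    refine ⟨?_, hpt⟩
    rw [Finset.mem_erase, hT, Set.Finite.mem_toFinset, S.mem_times, hpt, F.proj_rev, S.len_rev]
    exact ⟨by linarith [ht.2], ⟨by linarith [ht.2], by linarith [ht.1.lt_of_ne' h0]⟩, htp⟩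
  have hJrev : ∀ a, J (S.rev a) = -J a := by
    intro a
    rw [hJ]
    simp only
    rw [← Finset.sum_neg_distrib]
    symm
    refine Finset.sum_bij' (fun t _ => S.len a - t) (fun t _ => S.len a - t)
      (fun t ht => (hmaps a t ht).1) (fun t ht => ?_) (fun t _ => by ring) (fun t _ => by ring)
      (fun t ht => ?_)
    · have := (hmaps _ t ht).1
      rwa [S.rev_rev, S.len_rev] at this
    · rw [(hmaps a t ht).2, hwt]
  have hzero : ∑ a, S.mult a * J a = 0 := by
    have h1 : ∑ a, S.mult a * J a = ∑ a, -(S.mult a * J a) := by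
      conv_lhs => rw [← Equiv.sum_comp S.revEquiv]
      refine Finset.sum_congr rfl fun a _ => ?_
      have : S.revEquiv a = S.rev a := rfl
      rw [this, hJrev, S.mult_rev, mul_neg]
    rw [Finset.sum_neg_distrib] at h1
    linarith
  rw [Finset.sum_congr rfl fun a _ => congrArg (fun r => (S.mult a : ℝ) * r) (hsplit a)]
  simp_rw [mul_add, Finset.sum_add_distrib, hzero, add_zero]

/-- Transfers the balance at p, which is expressed by starts of arcs, to any system with the same
counting function. -/
lemma sum_mult_start_eq {S' : ArcSystem F} (h : S'.count = S.count) {wt : X → ℝ} (p : M)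
    (hwt : ∀ x, wt (F.rev x) = -wt x) (hp : ∀ x, F.proj x ≠ p → wt x = 0) :
    ∑ a, S'.mult a * wt (S'.start a) = ∑ a, S.mult a * wt (S.start a) := by
  rw [S.sum_mult_start p hwt hp, S'.sum_mult_start p hwt hp, h]
  refine Finset.sum_congr ?_ fun _ _ => rfl
  ext x
  simp [darts_eq_of_count_eq h]

/-! ### The simplified system of arcs -/

/-- The system of the arcs of `S` between successive points of a minimal cut, without repetition. -/
structure IsSimplified (S S' : ArcSystem F) : Prop where
  count_eq : S'.count = S.count
  rev_ne : ∀ a, S'.rev a ≠ a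
  interior : ∀ a t z, 0 < t → t < S'.len a → F.R (S'.start a) t z → F.proj z ∉ S'.ends
  injOn : ∀ a b s t y z, 0 < s → s < S'.len a → 0 < t → t < S'.len b → F.R (S'.start a) s y →
    F.R (S'.start b) t z → F.proj y = F.proj z →
      (a = b ∧ s = t) ∨ (b = S'.rev a ∧ t = S'.len a - s)
  -- With b = a this says, together with `rev_ne`, that no point is the start of a single arc.
  closes_up : ∀ a b, (∀ c, F.proj (S'.start c) = F.proj (S'.start a) → c = a ∨ c = b) →
    b = S'.rev a

/-- Each vector over a minimal cut that carries arcs is followed up to its first return to the cut,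
with its count as multiplicity. Since the count is constant up to that return, the reverse of the
final vector again starts an arc, of the same multiplicity. Every vector of the old system lies on
exactly one new arc, exactly once, whence the counting functions agree. -/
theorem exists_isSimplified [T2Space M] [CompactSpace M] (hS : S.Balanced) :
    ∃ S' : ArcSystem F, IsSimplified S S' := by
  obtain ⟨P, hP, hmin⟩ := S.exists_minimal_isCut
  have hDfin := S.finite_darts hP.finite
  have hfd : Finite (S.darts P) := hDfin
  -- The arcs are indexed by `Fin r` since the index type lives in `Type`, whatever the universe of
  -- X.
  obtain ⟨r, ⟨e⟩⟩ := Finite.exists_equiv_fin (S.darts P)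
  set start : Fin r → X := fun i => (e.symm i : X) with hstart
  have hinj : Function.Injective start := Subtype.val_injective.comp e.symm.injective
  have hmem : ∀ i, start i ∈ S.darts P := fun i => (e.symm i).2
  have hsurj : ∀ x ∈ S.darts P, ∃ i, start i = x := fun x hx => ⟨e ⟨x, hx⟩, by simp [hstart]⟩
  choose len final hlen hrel hfinalP hfinalc hint using
    fun i => hP.exists_first_hit hS (hmem i).1
  have hfinal : ∀ i, ∃ j, start j = F.rev (final i) := fun i =>
    hsurj _ ⟨by rw [hfinalc]; exact (hmem i).1, by rw [F.proj_rev]; exact hfinalP i⟩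
  choose rev hrev using hfinal
  have hrel' : ∀ i, F.R (start i) (len i) (F.rev (start (rev i))) := fun i => by
    rw [hrev, F.rev_rev]; exact hrel i
  have hlen_eq : ∀ i t y, 0 < t → F.R (start i) t y → F.proj y ∈ P →
      (∀ s z, 0 < s → s < t → F.R (start i) s z → F.proj z ∉ P) → t = len i := by
    intro i t y ht hy hyP H
    rcases lt_trichotomy t (len i) with h | h | h
    · exact absurd hyP (hint i t y ht h hy).1
    · exact h
    · exact absurd (hfinalP i) (H _ _ (hlen i) h (hrel i))
  -- The reversed arc returns to its source after the same time and does not meet P earlier, so its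
  -- own first hitting time is the same.
  have hback : ∀ i, len i = len (rev i) := by
    intro i
    refine hlen_eq (rev i) (len i) (F.rev (start i)) (hlen i) ?_ ?_ ?_
    · exact F.rev_rel_right (hrel' i)
    · rw [F.proj_rev]; exact (hmem i).2
    · intro s z hs hsl hz
      have h1 : F.R (start i) (len i - s) (F.rev z) := by
        have := F.tail hz (F.rev_rel_right (hrel' i)) hsl.le
        exact F.rev_rel' (by simpa [F.rev_rev] using this)
      have := (hint i (len i - s) _ (by linarith) (by linarith) h1).1
      rwa [F.proj_rev] at this
  have hrevrev : ∀ i, rev (rev i) = i := by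
    intro i
    apply hinj
    have h1 := hrel' (rev i)
    rw [← hback] at h1
    exact F.rev_injective (F.functional h1 (F.rev_rel_right (hrel' i)))
  set S' : ArcSystem F :=
    { A := Fin r, start := start, len := len, mult := fun i => S.count (start i), rev := rev,
      len_pos := hlen, mult_pos := fun i => (hmem i).1, rev_rev := hrevrev,
      len_rev := fun i => (hback i).symm,
      mult_rev := fun i => by rw [hrev]; exact hfinalc i
      rel := hrel' } with hS'
  have hcv : ∀ (i : Fin r) (y : X), ∀ t ∈ S'.visits i y, S.count y = S.count (start i) := by
    rintro i y t ⟨ht, hy⟩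
    rcases ht.1.eq_or_lt with rfl | h0
    · rw [← F.zero_eq hy]
    · exact (hint i t y h0 ht.2 hy).2
  -- Two passages through y at different ages would put the start of the younger arc, a point of P,
  -- in the interior of the older one; at equal ages the starts coincide.
  have huniq : ∀ (i j : Fin r) (y : X), ∀ s ∈ S'.visits i y, ∀ t ∈ S'.visits j y,
      i = j ∧ s = t := by
    have key : ∀ (i j : Fin r) (y : X), ∀ s ∈ S'.visits i y, ∀ t ∈ S'.visits j y, s ≤ t →
        i = j ∧ s = t := by
      rintro i j y s ⟨hs, hy⟩ t ⟨ht, hy'⟩ hst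
      have h1 : F.R (start j) (t - s) (start i) := F.tail' hy hy' hst
      rcases hst.eq_or_lt with rfl | hlt
      · rw [sub_self] at h1
        exact ⟨(hinj (F.zero_eq h1)).symm, rfl⟩
      · exact absurd (hmem i).2
          (hint j (t - s) _ (by linarith) (by linarith [ht.2, hs.1]) h1).1
    intro i j y s hs t ht
    rcases le_total s t with h | h
    · exact key i j y s hs t ht h
    · exact (key j i y t ht s hs h).imp Eq.symm Eq.symm
  have hexv : ∀ y, 0 < S.count y → ∃ (i : Fin r) (t : ℝ), t ∈ S'.visits i y := by
    intro y hy
    by_cases hyP : F.proj y ∈ P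
    · obtain ⟨i, rfl⟩ := hsurj y ⟨hy, hyP⟩
      exact ⟨i, 0, ⟨le_rfl, hlen i⟩, F.refl_left (hrel i)⟩
    · have hy' : 0 < S.count (F.rev y) := by rwa [hP.count_rev hS hyP]
      -- Running backwards from y to the first point of P finds the arc through y. That arc cannot
      -- stop before reaching y, since its final point would be an earlier hit.
      obtain ⟨t, w, ht, hw, hwP, hwc, hwint⟩ := hP.exists_first_hit hS hy'
      obtain ⟨i, hi⟩ := hsurj (F.rev w) ⟨by rwa [hwc], by rwa [F.proj_rev]⟩
      have hiy : F.R (start i) t y := by rw [hi]; exact F.rev_rel_left hw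
      refine ⟨i, t, ⟨ht.le, ?_⟩, hiy⟩
      show t < len i
      by_contra hlt
      push Not at hlt
      rcases hlt.eq_or_lt with h | h
      · rw [← h] at hiy
        rw [F.functional hiy (hrel i)] at hyP
        exact hyP (hfinalP i)
      · have h1 := F.tail (hrel i) hiy h.le
        refine absurd ?_ (hwint (t - len i) _ (by linarith) (by linarith [hlen i])
          (F.rev_rel h1)).1
        rw [F.proj_rev]; exact hfinalP i
  have hcount : S'.count = S.count := by
    ext y
    show ∑ i : Fin r, S.count (start i) * (S'.visits i y).ncard = S.count y
    rcases Nat.eq_zero_or_pos (S.count y) with h | h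
    · rw [h]
      refine Finset.sum_eq_zero fun i _ => ?_
      have : S'.visits i y = ∅ := by
        refine eq_empty_of_forall_notMem fun t ht => ?_
        have h1 := hcv i y t ht
        have h2 := (hmem i).1
        omega
      rw [this, ncard_empty, mul_zero]
    · obtain ⟨i, t, ht⟩ := hexv y h
      rw [Finset.sum_eq_single i]
      · have : S'.visits i y = {t} := by
          ext s
          exact ⟨fun hs => (huniq i i y s hs t ht).2, fun hs => by rw [hs]; exact ht⟩
        rw [this, ncard_singleton, mul_one, hcv i y t ht]
      · intro j _ hji
        have : S'.visits j y = ∅ := eq_empty_of_forall_notMem fun s hs =>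
          hji (huniq j i y s hs t ht).1
        rw [this, ncard_empty, mul_zero]
      · simp
  have hrevne : ∀ i, rev i ≠ i := by
    intro i hi
    have := hrel' i
    rw [hi] at this
    exact F.not_rel_rev this
  have hends : S'.ends ⊆ P := by
    rintro p ⟨i, rfl⟩
    exact (hmem i).2
  refine ⟨S', hcount, hrevne, ?_, ?_, ?_⟩
  · intro i t z h0 h1 hz hzP
    exact (hint i t z h0 h1 hz).1 (hends hzP)
  · intro i j s t y z hs0 hs1 ht0 ht1 hy hz hyz
    have hs1 : s < len i := hs1
    have hyi := hint i s y hs0 hs1 hy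
    have hzj := hint j t z ht0 ht1 hz
    have hcy : 0 < S.count y := by rw [hyi.2]; exact (hmem i).1
    have hcz : 0 < S.count z := by rw [hzj.2]; exact (hmem j).1
    rcases hP.regular y z hcy hcz hyz.symm hyi.1 with rfl | rfl
    · exact Or.inl (huniq i j z s ⟨⟨hs0.le, hs1⟩, hy⟩ t ⟨⟨ht0.le, ht1⟩, hz⟩)
    · right
      have h1 : F.R (start (rev i)) (len i - s) (F.rev y) :=
        F.rev_rel_right (F.tail hy (hrel' i) hs1.le)
      have := huniq j (rev i) _ t ⟨⟨ht0.le, ht1⟩, hz⟩ (len i - s)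
        ⟨⟨by linarith, show len i - s < len (rev i) by rw [← hback]; linarith⟩, h1⟩
      exact this
  · intro i j hij
    obtain ⟨t, ht, htx, hti⟩ := hP.closes_up hS hmin (x := start i) (y := start j) (hmem i).1
      (hmem i).2 (fun z hz hcz => by
        obtain ⟨k, rfl⟩ := hsurj z ⟨hcz, by rw [hz]; exact (hmem i).2⟩
        exact (hij k hz).imp (congrArg start) (congrArg start))
    have hl := hlen_eq i t _ ht htx (hmem i).2 hti
    subst hl
    -- The arc closes up, so its reversal starts over the same point; it differs from the arc, so it
    -- must be the second one.
    have h1 := F.functional htx (hrel' i)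
    have h2 : F.proj (start (rev i)) = F.proj (start i) := by
      conv_rhs => rw [h1]
      rw [F.proj_rev]
    exact ((hij (rev i) h2).resolve_left (hrevne i)).symm

end ArcSystem

/-! ### Points and maps of the space underlying a multigraph -/

section Realization
open WeightedMultigraph

variable {G : WeightedMultigraph} {Y : Type*}

lemma edgePt_zero (e : G.E) : G.edgePt e 0 = G.vertexPt (G.endpt e false) :=
  (Quot.sound (Glue.zero e)).symm

lemma edgePt_one (e : G.E) : G.edgePt e 1 = G.vertexPt (G.endpt e true) :=
  (Quot.sound (Glue.one e)).symm

lemma exists_vertexPt_or_edgePt (z : G.Realization) :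
    (∃ v, z = G.vertexPt v) ∨ ∃ e t, z = G.edgePt e t := by
  induction z using Quot.ind with
  | mk z =>
    rcases z with v | ⟨e, t⟩
    · exact Or.inl ⟨v, rfl⟩
    · exact Or.inr ⟨e, t, rfl⟩

lemma exists_edgePt (hG : G.NoIsolatedVertex) (z : G.Realization) : ∃ e t, z = G.edgePt e t := by
  rcases exists_vertexPt_or_edgePt z with ⟨v, rfl⟩ | h
  · obtain ⟨e, i, rfl⟩ := hG v
    cases i with
    | false => exact ⟨e, 0, (edgePt_zero e).symm⟩
    | true => exact ⟨e, 1, (edgePt_one e).symm⟩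
  · exact h

lemma continuous_edgePt (e : G.E) : Continuous (G.edgePt e) := by
  let _ : TopologicalSpace G.V := ⊥
  let _ : TopologicalSpace G.E := ⊥
  have h : Continuous fun t : unitInterval => (Sum.inr (e, t) : G.V ⊕ (G.E × unitInterval)) := by
    fun_prop
  exact continuous_quot_mk.comp h

/-- The space is a quotient of the disjoint union of discrete vertices and edges, so only the edges
impose a condition. -/
lemma continuous_of_edges [TopologicalSpace Y] {g : G.Realization → Y}
    (hg : ∀ e, Continuous fun t => g (G.edgePt e t)) : Continuous g := by
  let _ : TopologicalSpace G.V := ⊥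
  let _ : TopologicalSpace G.E := ⊥
  have : DiscreteTopology G.V := ⟨rfl⟩
  have : DiscreteTopology G.E := ⟨rfl⟩
  refine continuous_coinduced_dom.2 ?_
  have h : Continuous fun z : G.V ⊕ (G.E × unitInterval) =>
      g (Quot.mk _ (z : G.PreRealization)) := by
    refine continuous_sum_dom.2 ⟨continuous_of_discreteTopology, ?_⟩
    exact continuous_prod_of_discrete_left.2 fun e => hg e
  exact h

instance : CompactSpace G.Realization := by
  let _ : TopologicalSpace G.V := ⊥
  let _ : TopologicalSpace G.E := ⊥
  have : CompactSpace (G.V ⊕ (G.E × unitInterval)) := inferInstance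
  have : CompactSpace G.PreRealization := this
  exact inferInstanceAs (CompactSpace (Quot G.Glue))

/-- The map on the underlying space with given restrictions to the vertices and the edges. -/
def glueMap (a : G.V → Y) (b : G.E → ℝ → Y) (h0 : ∀ e, b e 0 = a (G.endpt e false))
    (h1 : ∀ e, b e 1 = a (G.endpt e true)) : G.Realization → Y :=
  Quot.lift (fun z : G.V ⊕ (G.E × unitInterval) => Sum.elim a (fun p => b p.1 p.2) z) (by
    rintro _ _ (e | e)
    · exact (h0 e).symm
    · exact (h1 e).symm)

variable {a : G.V → Y} {b : G.E → ℝ → Y} {h0 : ∀ e, b e 0 = a (G.endpt e false)}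
  {h1 : ∀ e, b e 1 = a (G.endpt e true)}

lemma glueMap_edgePt (e : G.E) (t : unitInterval) : glueMap a b h0 h1 (G.edgePt e t) = b e t := rfl

lemma edgePath_glueMap {e : G.E} {t : ℝ} (ht : t ∈ Icc (0 : ℝ) 1) :
    edgePath (glueMap a b h0 h1) e t = b e t := by
  rw [edgePath, glueMap_edgePt, projIcc_of_mem _ ht]

lemma continuous_glueMap [TopologicalSpace Y] (hb : ∀ e, ContinuousOn (b e) (Icc 0 1)) :
    Continuous (glueMap a b h0 h1) :=
  continuous_of_edges fun e => (hb e).comp_continuous continuous_subtype_val fun t => t.2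

lemma continuous_edgePath [TopologicalSpace Y] {g : G.Realization → Y} (hg : Continuous g)
    (e : G.E) : Continuous (edgePath g e) :=
  hg.comp ((continuous_edgePt e).comp continuous_projIcc)

lemma edgePath_zero (g : G.Realization → Y) (e : G.E) :
    edgePath g e 0 = g (G.vertexPt (G.endpt e false)) := by
  rw [← edgePt_zero, edgePath, projIcc_left]; rfl

lemma edgePath_one (g : G.Realization → Y) (e : G.E) :
    edgePath g e 1 = g (G.vertexPt (G.endpt e true)) := by
  rw [← edgePt_one, edgePath, projIcc_right]; rfl

lemma edgePath_coe (g : G.Realization → Y) (e : G.E) (t : unitInterval) :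
    edgePath g e t = g (G.edgePt e t) := by
  rw [edgePath, projIcc_val]

end Realization

/-! ### Nets represented by systems of arcs -/

section Represents

variable {X Y : Type*} [TopologicalSpace Y] {Φ : PartialFlow X Y} {S : ArcSystem Φ}

lemma ArcSystem.point_rev {a : S.A} {t : ℝ} (ht : t ∈ Icc 0 (S.len a)) :
    S.point (S.rev a) (S.len a - t) = Φ.rev (S.point a t) :=
  S.point_eq (Φ.rev_rel_right (Φ.tail (S.rel_point ht) (S.rel a) ht.2))

lemma ArcSystem.times_rev (P : Set Y) (a : S.A) : S.times P (S.rev a) =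
    (S.len a - ·) '' {t | t ∈ Ioc 0 (S.len a) ∧ Φ.proj (S.point a t) ∈ P} := by
  ext t
  rw [S.mem_times, S.len_rev]
  constructor
  · rintro ⟨ht, h⟩
    refine ⟨S.len a - t, ⟨⟨by linarith [ht.2], by linarith [ht.1]⟩, ?_⟩, by ring⟩
    rw [← Φ.proj_rev, ← S.point_rev ⟨by linarith [ht.2], by linarith [ht.1]⟩, sub_sub_cancel]
    exact h
  · rintro ⟨r, ⟨hr, h⟩, rfl⟩
    refine ⟨⟨by linarith [hr.2], by linarith [hr.1]⟩, ?_⟩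
    rw [S.point_rev ⟨hr.1.le, hr.2⟩, Φ.proj_rev]
    exact h

open WeightedMultigraph

variable {G : WeightedMultigraph} {g : G.Realization → Y}

/-- The arcs of `S` are the edges of `g`, traversed in both directions. -/
structure Represents (S : ArcSystem Φ) (g : G.Realization → Y) where
  equiv : G.E × Bool ≃ S.A
  rev : ∀ e i, S.rev (equiv (e, i)) = equiv (e, !i)
  mult : ∀ e i, S.mult (equiv (e, i)) = G.mult e
  time : G.E → ℝ ≃o ℝ
  time_zero : ∀ e, time e 0 = 0
  time_one : ∀ e, time e 1 = S.len (equiv (e, false))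
  rel : ∀ e, ∀ t ∈ Icc (0 : ℝ) 1,
    Φ.proj (S.point (equiv (e, false)) (time e t)) = edgePath g e t

namespace Represents

variable (R : Represents S g)

include R

lemma sum_eq {A : Type*} [AddCommMonoid A] (h : S.A → A) :
    ∑ a, h a = ∑ e, (h (R.equiv (e, false)) + h (R.equiv (e, true))) := by
  rw [← R.equiv.sum_comp, Fintype.sum_prod_type]
  refine Finset.sum_congr rfl fun e _ => ?_
  rw [Fintype.sum_bool, add_comm]

lemma len_true (e : G.E) : S.len (R.equiv (e, true)) = S.len (R.equiv (e, false)) := by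
  rw [← S.len_rev (R.equiv (e, false)), R.rev]; rfl

lemma time_nonneg {e : G.E} {t : ℝ} : 0 ≤ R.time e t ↔ 0 ≤ t := by
  simpa only [R.time_zero] using (R.time e).le_iff_le (x := 0) (y := t)

lemma time_pos {e : G.E} {t : ℝ} : 0 < R.time e t ↔ 0 < t := by
  simpa only [R.time_zero] using (R.time e).lt_iff_lt (x := 0) (y := t)

lemma time_le {e : G.E} {t : ℝ} : R.time e t ≤ S.len (R.equiv (e, false)) ↔ t ≤ 1 := by
  simpa only [R.time_one] using (R.time e).le_iff_le (x := t) (y := 1)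

lemma time_lt {e : G.E} {t : ℝ} : R.time e t < S.len (R.equiv (e, false)) ↔ t < 1 := by
  simpa only [R.time_one] using (R.time e).lt_iff_lt (x := t) (y := 1)

lemma time_mem_Icc {e : G.E} {t : ℝ} :
    R.time e t ∈ Icc 0 (S.len (R.equiv (e, false))) ↔ t ∈ Icc (0 : ℝ) 1 :=
  and_congr R.time_nonneg R.time_le

lemma times_false (e : G.E) (P : Set Y) : S.times P (R.equiv (e, false)) =
    R.time e '' {t | t ∈ Ico (0 : ℝ) 1 ∧ edgePath g e t ∈ P} := by
  have key : ∀ t, R.time e t ∈ Ico 0 (S.len (R.equiv (e, false))) ↔ t ∈ Ico (0 : ℝ) 1 :=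
    fun t => and_congr R.time_nonneg R.time_lt
  ext r
  obtain ⟨t, rfl⟩ := (R.time e).surjective r
  rw [S.mem_times, (R.time e).injective.mem_set_image, key]
  refine and_congr_right fun ht => ?_
  rw [R.rel e t ⟨ht.1, ht.2.le⟩]

lemma ncard_times_true (e : G.E) (P : Set Y) : (S.times P (R.equiv (e, true))).ncard =
    {t | t ∈ Ioc (0 : ℝ) 1 ∧ edgePath g e t ∈ P}.ncard := by
  have key : ∀ t, R.time e t ∈ Ioc 0 (S.len (R.equiv (e, false))) ↔ t ∈ Ioc (0 : ℝ) 1 :=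
    fun t => and_congr R.time_pos R.time_le
  have h1 : R.equiv (e, true) = S.rev (R.equiv (e, false)) := (R.rev e false).symm
  rw [h1, S.times_rev, ncard_image_of_injective _ sub_right_injective,
    ← ncard_image_of_injective {t | t ∈ Ioc (0 : ℝ) 1 ∧ edgePath g e t ∈ P}
      (R.time e).injective]
  congr 1
  ext r
  obtain ⟨t, rfl⟩ := (R.time e).surjective r
  rw [(R.time e).injective.mem_set_image]
  show _ ∧ _ ↔ _ ∧ _
  rw [key]
  refine and_congr_right fun ht => ?_
  rw [R.rel e t ⟨ht.1.le, ht.2⟩]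

lemma finite_hits (e : G.E) (p : Y) : {t | t ∈ Icc (0 : ℝ) 1 ∧ edgePath g e t = p}.Finite := by
  refine ((Φ.finite_hits (S.rel (R.equiv (e, false))) p).preimage
    (R.time e).injective.injOn).subset ?_
  rintro t ⟨ht, h⟩
  have ht' := (R.time_mem_Icc (e := e)).2 ht
  exact ⟨ht'.2, _, S.rel_point ht', by rw [R.rel e t ht, h]⟩

/-- Time intervals are half-open: the forward arc sees the parameters in [0, 1), the reversed arc
those in (0, 1]. Interior hits count twice and each end once, which accounts for the factor one half
in the multiplicity. -/
lemma ncard_times_add (e : G.E) (p : Y) :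
    (S.times {p} (R.equiv (e, false))).ncard + (S.times {p} (R.equiv (e, true))).ncard =
      2 * {t : ℝ | t ∈ Ioo 0 1 ∧ edgePath g e t = p}.ncard +
        {t : ℝ | t ∈ ({0, 1} : Set ℝ) ∧ edgePath g e t = p}.ncard := by
  classical
  rw [R.ncard_times_true, R.times_false, ncard_image_of_injective _ (R.time e).injective]
  have hfin := R.finite_hits e p
  have hI : {t : ℝ | t ∈ Ioo 0 1 ∧ edgePath g e t = p}.Finite :=
    hfin.subset fun t ht => ⟨Ioo_subset_Icc_self ht.1, ht.2⟩
  have hsplit : ∀ s : Set ℝ, ∀ a : ℝ, a ∉ Ioo (0 : ℝ) 1 → s = insert a (Ioo 0 1) →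
      {t | t ∈ s ∧ edgePath g e t ∈ ({p} : Set Y)}.ncard =
        {t : ℝ | t ∈ Ioo 0 1 ∧ edgePath g e t = p}.ncard + if edgePath g e a = p then 1 else 0 := by
    rintro s a ha rfl
    by_cases hp : edgePath g e a = p
    · rw [if_pos hp, ← ncard_insert_of_notMem (fun h => ha h.1) hI]
      congr 1
      ext t
      simp only [mem_ofPred_eq, mem_insert_iff, mem_singleton_iff]
      constructor
      · rintro ⟨rfl | h, h'⟩
        · exact Or.inl rfl
        · exact Or.inr ⟨h, h'⟩
      · rintro (rfl | h)
        · exact ⟨Or.inl rfl, hp⟩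
        · exact ⟨Or.inr h.1, h.2⟩
    · rw [if_neg hp, add_zero]
      congr 1
      ext t
      simp only [mem_ofPred_eq, mem_insert_iff, mem_singleton_iff]
      constructor
      · rintro ⟨rfl | h, h'⟩
        · exact absurd h' hp
        · exact ⟨h, h'⟩
      · exact fun h => ⟨Or.inr h.1, h.2⟩
  have hends : {t : ℝ | t ∈ ({0, 1} : Set ℝ) ∧ edgePath g e t = p}.ncard =
      (if edgePath g e 0 = p then 1 else 0) + if edgePath g e 1 = p then 1 else 0 := by
    have : {t : ℝ | t ∈ ({0, 1} : Set ℝ) ∧ edgePath g e t = p} =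
        ((({0, 1} : Finset ℝ).filter fun t => edgePath g e t = p : Finset ℝ) : Set ℝ) := by
      ext t; simp
    rw [this, ncard_coe_finset, Finset.filter_insert, Finset.filter_singleton]
    split_ifs <;> simp
  rw [hsplit (Ico 0 1) 0 (by simp) (Ioo_insert_left zero_lt_one).symm,
    hsplit (Ioc 0 1) 1 (by simp) (Ioo_insert_right zero_lt_one).symm, hends]
  ring

lemma multiplicityAt_eq (p : Y) :
    multiplicityAt g p = ((∑ a, S.mult a * (S.times {p} a).ncard : ℕ) : ℝ≥0∞) / 2 := by
  rw [R.sum_eq, multiplicityAt, Nat.cast_sum, ENNReal.div_eq_inv_mul, Finset.mul_sum]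
  refine Finset.sum_congr rfl fun e _ => ?_
  have hfin := R.finite_hits e p
  have h1 : {t : ℝ | t ∈ Ioo 0 1 ∧ edgePath g e t = p}.Finite :=
    hfin.subset fun t ht => ⟨Ioo_subset_Icc_self ht.1, ht.2⟩
  have h2 : {t : ℝ | t ∈ ({0, 1} : Set ℝ) ∧ edgePath g e t = p}.Finite :=
    ((finite_singleton (1 : ℝ)).insert 0).subset fun t ht => ht.1
  rw [R.mult, R.mult, ← mul_add, R.ncard_times_add, ← h1.cast_ncard_eq, ← h2.cast_ncard_eq]
  push_cast
  rw [ENNReal.div_eq_inv_mul, mul_left_comm]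
  congr 1
  rw [mul_add, ← mul_assoc, ENNReal.inv_mul_cancel two_ne_zero ENNReal.ofNat_ne_top, one_mul]

lemma multiplicityAt_congr {S' : ArcSystem Φ} {G' : WeightedMultigraph} {g' : G'.Realization → Y}
    (R' : Represents S' g') (h : S'.count = S.count) (p : Y) :
    multiplicityAt g' p = multiplicityAt g p := by
  rw [R.multiplicityAt_eq, R'.multiplicityAt_eq, S.sum_mult_ncard_times h (finite_singleton p)]

lemma sum_mult_len_eq : ∑ e, (G.mult e : ℝ) * S.len (R.equiv (e, false)) =
    (∑ a, S.mult a * S.len a) / 2 := by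
  rw [R.sum_eq, Finset.sum_div]
  refine Finset.sum_congr rfl fun e _ => ?_
  rw [R.mult, R.mult, R.len_true]
  ring

end Represents

/-- The image of a net is determined by its multiplicities. -/
lemma range_eq_of_multiplicityAt (hG : G.NoIsolatedVertex) :
    range g = {p | multiplicityAt g p ≠ 0} := by
  ext p
  have hm : ∀ e, (G.mult e : ℝ≥0∞) ≠ 0 := fun e => by exact_mod_cast (G.mult_pos e).ne'
  constructor
  · rintro ⟨z, rfl⟩
    obtain ⟨e, t, rfl⟩ := exists_edgePt hG z
    intro h
    rw [multiplicityAt, Finset.sum_eq_zero_iff] at h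
    have h1 := (mul_eq_zero.1 (h e (Finset.mem_univ e))).resolve_left (hm e)
    rw [add_eq_zero, ENNReal.div_eq_zero_iff] at h1
    obtain ⟨h2, h3⟩ := h1
    have h3 := h3.resolve_right ENNReal.ofNat_ne_top
    rw [ENat.toENNReal_eq_zero, encard_eq_zero] at h2 h3
    by_cases ht : (t : ℝ) ∈ Ioo (0 : ℝ) 1
    · exact (eq_empty_iff_forall_notMem.1 h2 t) ⟨ht, edgePath_coe g e t⟩
    · refine (eq_empty_iff_forall_notMem.1 h3 t) ⟨?_, edgePath_coe g e t⟩
      rcases t.2.1.eq_or_lt with h | h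
      · exact Or.inl h.symm
      · exact Or.inr (le_antisymm t.2.2 (not_lt.1 fun h' => ht ⟨h, h'⟩))
  · intro h
    by_contra hp
    refine h (Finset.sum_eq_zero fun e _ => ?_)
    have key : ∀ s : Set ℝ, {t | t ∈ s ∧ edgePath g e t = p} = ∅ := fun s =>
      eq_empty_of_forall_notMem fun t ht => hp ⟨_, ht.2⟩
    have k1 := key (Ioo 0 1)
    have k2 := key {0, 1}
    rw [k1, k2]
    simp

end Represents

/-! ### Connected components of a multigraph -/

section Components

open WeightedMultigraph

variable {G : WeightedMultigraph}

lemma adj_symm {v w : G.V} (h : G.Adj v w) : G.Adj w v := by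
  obtain ⟨e, i, h1, h2⟩ := h
  exact ⟨e, !i, h2, by rw [Bool.not_not]; exact h1⟩

lemma reachable_symm {v w : G.V} (h : G.Reachable v w) : G.Reachable w v := by
  induction h with
  | refl => exact Relation.ReflTransGen.refl
  | tail _ h ih => exact Relation.ReflTransGen.head (adj_symm h) ih

lemma reachable_endpt_false {v : G.V} {e : G.E} {i : Bool} (h : G.Reachable v (G.endpt e i)) :
    G.Reachable v (G.endpt e false) := by
  cases i with
  | false => exact h
  | true => exact Relation.ReflTransGen.tail h ⟨e, true, rfl, rfl⟩

lemma component_isConnected (v : G.V) : (G.component v).IsConnected := by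
  have key : ∀ w (hw : G.Reachable v w),
      (G.component v).Reachable ⟨v, Relation.ReflTransGen.refl⟩ ⟨w, hw⟩ := by
    intro w hw
    induction hw with
    | refl => exact Relation.ReflTransGen.refl
    | @tail b c hb hbc ih =>
      obtain ⟨e, i, rfl, rfl⟩ := hbc
      exact Relation.ReflTransGen.tail ih ⟨⟨e, reachable_endpt_false hb⟩, i, rfl, rfl⟩
  exact ⟨⟨⟨v, Relation.ReflTransGen.refl⟩⟩, fun a b =>
    Relation.ReflTransGen.trans (reachable_symm (key a.1 a.2)) (key b.1 b.2)⟩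

lemma degree_component (v : G.V) (w : (G.component v).V) :
    (G.component v).degree w = G.degree w.1 :=
  Nat.card_congr
    { toFun := fun h => ⟨(h.1.1.1, h.1.2), congrArg Subtype.val h.2⟩
      invFun := fun h => ⟨(⟨h.1.1, reachable_endpt_false (i := h.1.2) (by rw [h.2]; exact w.2)⟩,
        h.1.2), Subtype.ext h.2⟩
      left_inv := fun _ => rfl
      right_inv := fun _ => rfl }

/-- A vertex to which only a loop is attached is a component of its own. -/
lemma isSimpleLoop_component {v : G.V} {e : G.E} {i : Bool} (hv : G.Reachable v (G.endpt e i))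
    (h : ∀ e' j, G.endpt e' j = G.endpt e i → e' = e) (hl : ∀ j, G.endpt e j = G.endpt e i) :
    (G.component v).IsSimpleLoop := by
  have key : ∀ w, G.Reachable v w → w = G.endpt e i := by
    intro w hw
    have h1 : G.Reachable (G.endpt e i) w :=
      Relation.ReflTransGen.trans (reachable_symm hv) hw
    induction h1 with
    | refl => rfl
    | tail _ hbc ih =>
      obtain ⟨e', j, h2, rfl⟩ := hbc
      have h3 := ih (Relation.ReflTransGen.tail hw (adj_symm ⟨e', j, h2, rfl⟩))
      obtain rfl := h e' j (h2.trans h3)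
      exact hl _
  constructor
  · refine Nat.card_eq_one_iff_unique.2 ⟨⟨fun a b => Subtype.ext ?_⟩, ⟨⟨_, hv⟩⟩⟩
    rw [key _ a.2, key _ b.2]
  · refine Nat.card_eq_one_iff_unique.2
      ⟨⟨fun a b => Subtype.ext ?_⟩, ⟨⟨e, reachable_endpt_false hv⟩⟩⟩
    rw [h _ _ (key _ a.2), h _ _ (key _ b.2)]

end Components

/-! ### The graph of a system of arcs -/

namespace ArcSystem

open WeightedMultigraph

variable {X M : Type*} [TopologicalSpace M] {F : PartialFlow X M} (S : ArcSystem F)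

/-- Two arcs are equivalent if they start at the same point. -/
def startSetoid : Setoid S.A := Setoid.ker fun a => F.proj (S.start a)

open Classical in
/-- The graph whose vertices are the starting points of the arcs, and whose edges are the arcs, up
to reversal. -/
def graph : WeightedMultigraph where
  V := Quotient S.startSetoid
  -- An arbitrary numbering of the arcs selects one orientation from each pair of opposite arcs.
  E := {a : S.A // Fintype.equivFin S.A a < Fintype.equivFin S.A (S.rev a)}
  finiteV := Quotient.finite _
  fintypeE := Fintype.ofFinite _
  endpt e i := Quotient.mk _ (bif i then S.rev e.1 else e.1)
  mult e := S.mult e.1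
  mult_pos e := S.mult_pos e.1

/-- The arc which starts at an end of an edge. -/
def dart (h : S.graph.E × Bool) : S.A := bif h.2 then S.rev h.1.1 else h.1.1

variable {S}

lemma endpt_eq_iff {a : S.A} {e : S.graph.E} {i : Bool} :
    S.graph.endpt e i = Quotient.mk S.startSetoid a ↔
      F.proj (S.start (S.dart (e, i))) = F.proj (S.start a) :=
  Quotient.eq (r := S.startSetoid)

lemma rev_dart (e : S.graph.E) (i : Bool) : S.rev (S.dart (e, i)) = S.dart (e, !i) := by
  cases i with
  | false => rfl
  | true => exact S.rev_rev _

lemma rev_ne_of_edge (e e' : S.graph.E) : e'.1 ≠ S.rev e.1 := by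
  intro h
  have h1 := e.2
  have h2 := e'.2
  rw [h, S.rev_rev] at h2
  exact h1.asymm h2

/-- Without arcs fixed by reversal, exactly one arc of each opposite pair is an edge, and its two
ends account for both arcs. -/
lemma dart_bijective (h : ∀ a, S.rev a ≠ a) : Function.Bijective S.dart := by
  constructor
  · rintro ⟨e, i⟩ ⟨e', i'⟩ hee
    cases i <;> cases i'
    · exact Prod.ext (Subtype.ext hee) rfl
    · exact absurd hee (rev_ne_of_edge _ _)
    · exact absurd hee.symm (rev_ne_of_edge _ _)
    · exact Prod.ext (Subtype.ext (S.revEquiv.injective hee)) rfl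
  · intro a
    rcases lt_or_gt_of_ne fun h' => h a ((Fintype.equivFin S.A).injective h').symm with h1 | h1
    · exact ⟨(⟨a, h1⟩, false), rfl⟩
    · exact ⟨(⟨S.rev a, by rw [S.rev_rev]; exact h1⟩, true), S.rev_rev a⟩

/-- The arcs are the pairs of an edge and an end of it. -/
def dartEquiv (h : ∀ a, S.rev a ≠ a) : S.graph.E × Bool ≃ S.A :=
  Equiv.ofBijective _ (dart_bijective h)

lemma noIsolatedVertex_graph (h : ∀ a, S.rev a ≠ a) : S.graph.NoIsolatedVertex := by
  intro v
  obtain ⟨a, rfl⟩ := Quotient.exists_rep v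
  obtain ⟨⟨e, i⟩, rfl⟩ := (dart_bijective h).surjective a
  exact ⟨e, i, rfl⟩

variable (S) in
/-- The position of a vertex. -/
def vertexPos : S.graph.V → M :=
  Quotient.lift (s := S.startSetoid) (fun a => F.proj (S.start a)) fun _ _ h => h

lemma vertexPos_injective : Function.Injective S.vertexPos := by
  intro v w h
  obtain ⟨a, rfl⟩ := Quotient.exists_rep v
  obtain ⟨b, rfl⟩ := Quotient.exists_rep w
  exact Quotient.sound h

lemma vertexPos_mem_ends (v : S.graph.V) : S.vertexPos v ∈ S.ends := by
  obtain ⟨a, rfl⟩ := Quotient.exists_rep v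
  exact mem_range_self _

lemma degree_graph (h : ∀ a, S.rev a ≠ a) (a : S.A) :
    S.graph.degree (Quotient.mk S.startSetoid a) =
      Nat.card {c // F.proj (S.start c) = F.proj (S.start a)} :=
  Nat.card_congr ((dartEquiv h).subtypeEquiv fun _ => endpt_eq_iff)

/-- The connected components of the graph of a simplified system of arcs are good. -/
theorem isGood_component {S₀ : ArcSystem F} (hS : IsSimplified S₀ S) (v : S.graph.V) :
    (S.graph.component v).IsGood := by
  by_cases h : ∀ w : (S.graph.component v).V, 3 ≤ (S.graph.component v).degree w
  · exact Or.inl ⟨component_isConnected v, h⟩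
  · right
    push Not at h
    obtain ⟨w, hlt⟩ := h
    rw [degree_component] at hlt
    have hw : S.graph.Reachable v w.1 := w.2
    obtain ⟨a, ha⟩ := Quotient.exists_rep w.1
    rw [← ha] at hlt hw
    have hlt' : ¬ 2 < Nat.card {c // F.proj (S.start c) = F.proj (S.start a)} := by
      rw [← degree_graph hS.rev_ne]
      exact fun h => absurd hlt (not_lt.2 h)
    classical
    rw [Nat.card_eq_fintype_card, Fintype.two_lt_card_iff] at hlt'
    -- With fewer than three arcs at the point, at most one b besides a starts there; b = a is
    -- allowed.
    obtain ⟨b, hb⟩ : ∃ b, ∀ c, F.proj (S.start c) = F.proj (S.start a) → c = a ∨ c = b := by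
      by_contra! h
      obtain ⟨c, hc, hca, -⟩ := h a
      obtain ⟨d, hd, hda, hdc⟩ := h c
      exact hlt' ⟨⟨a, rfl⟩, ⟨c, hc⟩, ⟨d, hd⟩, fun h => hca (congrArg Subtype.val h).symm,
        fun h => hda (congrArg Subtype.val h).symm, fun h => hdc (congrArg Subtype.val h).symm⟩
    obtain rfl := hS.closes_up a b hb
    -- If the reversal of a started elsewhere, a would be alone at its point, and `closes_up` with b
    -- = a would make it its own reversal.
    have hrev : F.proj (S.start (S.rev a)) = F.proj (S.start a) := by
      by_contra hne
      refine hS.rev_ne a (hS.closes_up a a fun c hc => ?_).symm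
      rcases hb c hc with h | rfl
      · exact Or.inl h
      · exact absurd hc hne
    obtain ⟨⟨e, i⟩, rfl⟩ := (dart_bijective hS.rev_ne).surjective a
    rw [rev_dart] at hb hrev
    refine isSimpleLoop_component (e := e) (i := i) hw (fun e' j hj => ?_) fun j => ?_
    · rcases hb _ (endpt_eq_iff.1 hj) with h | h
      · exact congrArg Prod.fst ((dart_bijective hS.rev_ne).injective h)
      · exact congrArg Prod.fst ((dart_bijective hS.rev_ne).injective h)
    · rcases Bool.eq_or_eq_not j i with rfl | rfl
      · rfl
      · exact endpt_eq_iff.2 hrev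

lemma exists_vertexPt_or_edgePt_Ioo {G : WeightedMultigraph} (z : G.Realization) :
    (∃ v, z = G.vertexPt v) ∨ ∃ e, ∃ t : unitInterval, (t : ℝ) ∈ Ioo (0 : ℝ) 1 ∧
      z = G.edgePt e t := by
  rcases exists_vertexPt_or_edgePt z with h | ⟨e, t, rfl⟩
  · exact Or.inl h
  · by_cases h0 : t = 0
    · exact Or.inl ⟨_, by rw [h0, edgePt_zero]⟩
    · by_cases h1 : t = 1
      · exact Or.inl ⟨_, by rw [h1, edgePt_one]⟩
      · exact Or.inr ⟨e, t, ⟨unitInterval.pos_iff_ne_zero.2 h0, unitInterval.lt_one_iff_ne_one.2 h1⟩,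
          rfl⟩

/-- The net given by a simplified system of arcs is embedded. -/
theorem injective_of_represents {S₀ : ArcSystem F} (hS : IsSimplified S₀ S)
    {g : S.graph.Realization → M} (R : Represents S g) (hR : ∀ h, R.equiv h = S.dart h)
    (hv : ∀ v, g (S.graph.vertexPt v) = S.vertexPos v) : Function.Injective g := by
  have key : ∀ (e : S.graph.E) (t : unitInterval), (t : ℝ) ∈ Ioo (0 : ℝ) 1 → ∃ z,
      0 < R.time e t ∧ R.time e t < S.len e.1 ∧ F.R (S.start e.1) (R.time e t) z ∧
      F.proj z = g (S.graph.edgePt e t) := by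
    intro e t ht
    have h1 : R.equiv (e, false) = e.1 := hR _
    have h2 := (R.time_lt (e := e)).2 ht.2
    have h3 := R.rel e t ⟨ht.1.le, ht.2.le⟩
    rw [h1] at h2 h3
    rw [edgePath_coe] at h3
    exact ⟨_, R.time_pos.2 ht.1, h2, S.rel_point ⟨R.time_nonneg.2 ht.1.le, h2.le⟩, h3⟩
  have hne : ∀ (v : S.graph.V) (e : S.graph.E) (t : unitInterval), (t : ℝ) ∈ Ioo (0 : ℝ) 1 →
      g (S.graph.vertexPt v) ≠ g (S.graph.edgePt e t) := by
    intro v e t ht h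
    obtain ⟨z, h1, h2, h3, h4⟩ := key e t ht
    refine hS.interior _ _ _ h1 h2 h3 ?_
    rw [h4, ← h, hv]
    exact vertexPos_mem_ends v
  intro x y hxy
  rcases exists_vertexPt_or_edgePt_Ioo x with ⟨v, rfl⟩ | ⟨e, t, ht, rfl⟩ <;>
    rcases exists_vertexPt_or_edgePt_Ioo y with ⟨v', rfl⟩ | ⟨e', t', ht', rfl⟩
  · rw [hv, hv] at hxy
    rw [vertexPos_injective hxy]
  · exact absurd hxy (hne _ _ _ ht')
  · exact absurd hxy.symm (hne _ _ _ ht)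
  · obtain ⟨z, h1, h2, h3, h4⟩ := key e t ht
    obtain ⟨z', h1', h2', h3', h4'⟩ := key e' t' ht'
    rcases hS.injOn _ _ _ _ _ _ h1 h2 h1' h2' h3 h3' (by rw [h4, h4', hxy]) with ⟨he, h⟩ | ⟨he, -⟩
    · obtain rfl := Subtype.ext he
      rw [Subtype.ext ((R.time e).injective h)]
    · exact absurd he (rev_ne_of_edge _ _)

end ArcSystem

/-! ### The metric and the Hamiltonian field in charts -/

variable {n : ℕ} {M : Type*} [TopologicalSpace M] [ChartedSpace (EuclideanSpace ℝ (Fin n)) M]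
  [IsManifold (𝓡 n) ∞ M]

local notation "𝔼" m:max => EuclideanSpace ℝ (Fin m)

/-- The coordinates of tangent vectors at `x` in the chart around `q`. -/
def coordL (q x : M) : TangentSpace (𝓡 n) x →L[ℝ] (𝔼 n) :=
  (trivializationAt (𝔼 n) (TangentSpace (𝓡 n) : M → Type _) q).continuousLinearMapAt ℝ x

/-- The tangent vector at `x` with given coordinates in the chart around `q`. -/
def lift (q x : M) : 𝔼 n →L[ℝ] TangentSpace (𝓡 n) x :=
  (trivializationAt (𝔼 n) (TangentSpace (𝓡 n) : M → Type _) q).symmL ℝ x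

lemma lift_coordL {q x : M} (hx : x ∈ (chartAt (𝔼 n) q).source) (v : TangentSpace (𝓡 n) x) :
    lift q x (coordL q x v) = v :=
  (trivializationAt (𝔼 n) (TangentSpace (𝓡 n) : M → Type _) q).symmL_continuousLinearMapAt (R := ℝ)
    (by simpa using hx) v

lemma coordL_lift {q x : M} (hx : x ∈ (chartAt (𝔼 n) q).source) (v : 𝔼 n) :
    coordL q x (lift q x v) = v :=
  (trivializationAt (𝔼 n) (TangentSpace (𝓡 n) : M → Type _) q).continuousLinearMapAt_symmL (R := ℝ)
    (by simpa using hx) v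

lemma coordL_eq_mfderiv {q x : M} (hx : x ∈ (chartAt (𝔼 n) q).source) :
    coordL q x = mfderiv (𝓡 n) 𝓘(ℝ, 𝔼 n) (extChartAt (𝓡 n) q) x :=
  TangentBundle.continuousLinearMapAt_trivializationAt hx

lemma lift_injective {q x : M} (hx : x ∈ (chartAt (𝔼 n) q).source) :
    Function.Injective (lift (n := n) q x) := fun v w h => by
  rw [← coordL_lift hx v, h, coordL_lift hx]

lemma coordL_injective {q x : M} (hx : x ∈ (chartAt (𝔼 n) q).source) :
    Function.Injective (coordL (n := n) q x) := fun v w h => by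
  rw [← lift_coordL hx v, h, lift_coordL hx]

variable [RiemannianBundle (fun x : M => TangentSpace (𝓡 n) x)]

/-- The Riemannian metric in the coordinates of the chart around `q`. -/
def chartMetric (q : M) (y : 𝔼 n) : 𝔼 n →L[ℝ] 𝔼 n →L[ℝ] ℝ :=
  LinearMap.toContinuousLinearMap
    (LinearMap.toContinuousLinearMap.toLinearMap ∘ₗ
      (LinearMap.mk₂ ℝ (fun v w : 𝔼 n =>
        inner ℝ (lift q ((extChartAt (𝓡 n) q).symm y) v) (lift q ((extChartAt (𝓡 n) q).symm y) w))
      (fun u v w => by rw [map_add]; exact inner_add_left _ _ _)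
      (fun c v w => by rw [map_smul]; exact real_inner_smul_left _ _ _)
      (fun u v w => by rw [map_add]; exact inner_add_right _ _ _)
      (fun c v w => by rw [map_smul]; exact real_inner_smul_right _ _ _)))

lemma chartMetric_apply (q : M) (y v w : 𝔼 n) :
    chartMetric q y v w = inner ℝ (lift q ((extChartAt (𝓡 n) q).symm y) v)
      (lift q ((extChartAt (𝓡 n) q).symm y) w) := rfl

lemma chartMetric_extChartAt {q x : M} (hx : x ∈ (chartAt (𝔼 n) q).source)
    (v w : TangentSpace (𝓡 n) x) :
    chartMetric q (extChartAt (𝓡 n) q x) (coordL q x v) (coordL q x w) = inner ℝ v w := by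
  have := (extChartAt (𝓡 n) q).left_inv (x := x) (by simpa using hx)
  rw [chartMetric_apply, this, lift_coordL hx, lift_coordL hx]

lemma chartMetric_comm (q : M) (y v w : 𝔼 n) : chartMetric q y v w = chartMetric q y w v := by
  rw [chartMetric_apply, chartMetric_apply, real_inner_comm]

lemma chartMetric_pos {q : M} {y : 𝔼 n} (hy : y ∈ (extChartAt (𝓡 n) q).target)
    {v : 𝔼 n} (hv : v ≠ 0) : 0 < chartMetric q y v v := by
  have hx : (extChartAt (𝓡 n) q).symm y ∈ (chartAt (𝔼 n) q).source := by
    simpa using (extChartAt (𝓡 n) q).map_target hy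
  rw [chartMetric_apply]
  refine real_inner_self_pos.2 fun h => hv ?_
  apply lift_injective hx
  rw [map_zero]; exact h

lemma isOpen_target (q : M) : IsOpen (extChartAt (𝓡 n) q).target := isOpen_extChartAt_target q

variable [IsContMDiffRiemannianBundle (𝓡 n) 2 (𝔼 n) (fun x : M => TangentSpace (𝓡 n) x)]

/-- Constant coordinate vectors lift to C² local sections of the tangent bundle, and the metric
evaluated on C² sections is C². -/
lemma contDiffOn_chartMetric (q : M) :
    ContDiffOn ℝ 2 (chartMetric (n := n) q) (extChartAt (𝓡 n) q).target := by
  have : IsManifold (𝓡 n) (2 + 1) M := IsManifold.of_le (n := ∞) (by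
    norm_num
    exact WithTop.coe_le_coe.2 (le_top : (3 : ℕ∞) ≤ ⊤))
  have := TangentBundle.contMDiffVectorBundle (I := 𝓡 n) (M := M) (n := 2)
  have key : ∀ v : 𝔼 n, ContMDiffOn (𝓡 n) ((𝓡 n).prod 𝓘(ℝ, 𝔼 n)) 2
      (fun x => (⟨x, lift q x v⟩ : TangentBundle (𝓡 n) M)) (chartAt (𝔼 n) q).source := by
    intro v
    have h := (trivializationAt (𝔼 n) (TangentSpace (𝓡 n) : M → Type _) q).contMDiffOn_symm
      (IB := 𝓡 n) (n := 2)
    have h2 : ContMDiffOn (𝓡 n) ((𝓡 n).prod 𝓘(ℝ, 𝔼 n)) 2 (fun x : M => (x, v))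
      (chartAt (𝔼 n) q).source := contMDiffOn_id.prodMk contMDiffOn_const
    refine (h.comp h2 (fun x hx => by simpa [Trivialization.mem_target] using hx)).congr
      fun x hx => ?_
    have hb : x ∈ (trivializationAt (𝔼 n) (TangentSpace (𝓡 n) : M → Type _) q).baseSet := by
      simpa using hx
    rw [lift, Trivialization.symmL_apply _ hb]
    exact (Trivialization.mk_symm _ hb v)
  rw [contDiffOn_clm_apply]; intro v
  rw [contDiffOn_clm_apply]; intro w
  simp_rw [chartMetric_apply]
  rw [← contMDiffOn_iff_contDiffOn]
  have h1 : ContMDiffOn (𝓡 n) 𝓘(ℝ, ℝ) 2 (fun x => inner ℝ (lift q x v) (lift q x w))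
      (chartAt (𝔼 n) q).source :=
    ContMDiffOn.inner_bundle (E := fun x : M => TangentSpace (𝓡 n) x) (key v) (key w)
  have h2 := contMDiffOn_extChartAt_symm (I := 𝓡 n) (n := 2) q
  exact h1.comp h2 (fun y hy => by simpa using (extChartAt (𝓡 n) q).map_target hy)

lemma contDiffAt_chartMetric {q : M} {y : 𝔼 n} (hy : y ∈ (extChartAt (𝓡 n) q).target) :
    ContDiffAt ℝ 2 (chartMetric (n := n) q) y :=
  (contDiffOn_chartMetric q).contDiffAt ((isOpen_target q).mem_nhds hy)

lemma isInvertible_chartMetric {q : M} {y : 𝔼 n} (hy : y ∈ (extChartAt (𝓡 n) q).target) :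
    (chartMetric (n := n) q y).IsInvertible := by
  have hinj : Function.Injective (chartMetric (n := n) q y).toLinearMap := by
    rw [← LinearMap.ker_eq_bot, LinearMap.ker_eq_bot']
    intro v hv
    by_contra h
    have := chartMetric_pos hy h
    have h2 : chartMetric q y v = 0 := hv
    simp [h2] at this
  have hfin : Module.finrank ℝ (𝔼 n) = Module.finrank ℝ (𝔼 n →L[ℝ] ℝ) := by
    rw [← (LinearMap.toContinuousLinearMap (𝕜 := ℝ) (E := 𝔼 n) (F' := ℝ)).finrank_eq]
    exact (Subspace.dual_finrank_eq (K := ℝ) (V := 𝔼 n)).symm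
  refine ⟨(LinearEquiv.ofInjectiveOfFinrankEq _ hinj hfin).toContinuousLinearEquiv, ?_⟩
  ext v w
  rfl

/-- The covector `w ↦ ½ (D_w g)(v, v)`, in the coordinates of the chart around `q`. -/
def metricGrad (q : M) (y v : 𝔼 n) : 𝔼 n →L[ℝ] ℝ :=
  (1 / 2 : ℝ) • fderiv ℝ (fun z => chartMetric (n := n) q z v v) y

/-- Homogeneity of degree two is what accounts for changes of the speed of parametrization. -/
lemma metricGrad_smul {q : M} {y : 𝔼 n} (hy : y ∈ (extChartAt (𝓡 n) q).target) (v : 𝔼 n) (c : ℝ) :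
    metricGrad q y (c • v) = (c ^ 2) • metricGrad q y v := by
  have h1 : (fun z => chartMetric (n := n) q z (c • v) (c • v)) =
      fun z => (c ^ 2) * chartMetric (n := n) q z v v := by
    ext z; simp; ring
  have h2 : DifferentiableAt ℝ (fun z => chartMetric (n := n) q z v v) y :=
    (((contDiffAt_chartMetric hy).differentiableAt (by norm_num)).clm_apply
      (differentiableAt_const v)).clm_apply (differentiableAt_const v)
  rw [metricGrad, h1, fderiv_const_mul h2, metricGrad, smul_comm]

/-- The Hamiltonian vector field of the geodesic flow, in the chart around `q`. -/
def hamField (q : M) (z : 𝔼 n × (𝔼 n →L[ℝ] ℝ)) : 𝔼 n × (𝔼 n →L[ℝ] ℝ) :=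
  ((chartMetric q z.1).inverse z.2, metricGrad q z.1 ((chartMetric q z.1).inverse z.2))

lemma contDiffAt_metricGrad {q : M} {z : 𝔼 n × 𝔼 n} (hz : z.1 ∈ (extChartAt (𝓡 n) q).target) :
    ContDiffAt ℝ 1 (fun z : 𝔼 n × 𝔼 n => metricGrad q z.1 z.2) z := by
  refine ContDiffAt.const_smul (1 / 2 : ℝ) ?_
  refine ContDiffAt.fderiv (f := fun (z : 𝔼 n × 𝔼 n) y => chartMetric (n := n) q y z.2 z.2) (n := 2)
    ?_ contDiffAt_fst (by norm_num)
  have h1 : ContDiffAt ℝ 2 (fun p : (𝔼 n × 𝔼 n) × 𝔼 n => chartMetric (n := n) q p.2) (z, z.1) :=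
    ContDiffAt.comp (g := chartMetric (n := n) q) (f := fun p : (𝔼 n × 𝔼 n) × 𝔼 n => p.2) (z, z.1)
      (contDiffAt_chartMetric hz) contDiffAt_snd
  have h2 : ContDiffAt ℝ 2 (fun p : (𝔼 n × 𝔼 n) × 𝔼 n => p.1.2) (z, z.1) :=
    contDiffAt_snd.comp _ contDiffAt_fst
  exact (h1.clm_apply h2).clm_apply h2

lemma contDiffAt_inverse_chartMetric {q : M} {y : 𝔼 n} (hy : y ∈ (extChartAt (𝓡 n) q).target) :
    ContDiffAt ℝ 2 (fun y => (chartMetric (n := n) q y).inverse) y :=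
  ContDiffAt.comp y (isInvertible_chartMetric hy).contDiffAt_map_inverse
    (contDiffAt_chartMetric hy)

/-- One derivative of the C² metric is used, so the field is C¹. This gives the local Lipschitz
bound behind uniqueness, and the C² regularity of the trajectories. -/
lemma contDiffAt_hamField {q : M} {z : 𝔼 n × (𝔼 n →L[ℝ] ℝ)}
    (hz : z.1 ∈ (extChartAt (𝓡 n) q).target) : ContDiffAt ℝ 1 (hamField q) z := by
  have h1 : ContDiffAt ℝ 1 (fun z : 𝔼 n × (𝔼 n →L[ℝ] ℝ) => (chartMetric q z.1).inverse z.2) z :=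
    (ContDiffAt.comp z ((contDiffAt_inverse_chartMetric hz).of_le (by norm_num))
      contDiffAt_fst).clm_apply contDiffAt_snd
  exact h1.prodMk (ContDiffAt.comp z (f := fun z : 𝔼 n × (𝔼 n →L[ℝ] ℝ) =>
    (z.1, (chartMetric q z.1).inverse z.2)) (contDiffAt_metricGrad hz) (contDiffAt_fst.prodMk h1))

/-! ### Unit speed geodesics and their uniqueness -/

/-- The coordinates of the vector of a point of the tangent bundle. -/
def coord (q : M) (x : TangentBundle (𝓡 n) M) : 𝔼 n := coordL q x.proj x.snd

/-- The phase curve `γ` satisfies the unit speed geodesic equation at time `t`, with derivatives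
taken within `s`. -/
structure IsGeoAt (γ : ℝ → TangentBundle (𝓡 n) M) (s : Set ℝ) (t : ℝ) : Prop where
  cont : ContinuousWithinAt (fun τ => (γ τ).proj) s t
  unit : ‖(γ t).snd‖ = 1
  pos : ∀ q : M, (γ t).proj ∈ (chartAt (𝔼 n) q).source →
    HasDerivWithinAt (fun τ => extChartAt (𝓡 n) q (γ τ).proj) (coord q (γ t)) s t
  mom : ∀ q : M, (γ t).proj ∈ (chartAt (𝔼 n) q).source →
    HasDerivWithinAt (fun τ => chartMetric q (extChartAt (𝓡 n) q (γ τ).proj) (coord q (γ τ)))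
      (metricGrad q (extChartAt (𝓡 n) q (γ t).proj) (coord q (γ t))) s t

/-- The phase curve `γ` is a unit speed geodesic on `s`. -/
def IsGeoOn (γ : ℝ → TangentBundle (𝓡 n) M) (s : Set ℝ) : Prop := ∀ t ∈ s, IsGeoAt γ s t

/-- Position and momentum in the chart around `q`. -/
def phase (q : M) (x : TangentBundle (𝓡 n) M) : 𝔼 n × (𝔼 n →L[ℝ] ℝ) :=
  (extChartAt (𝓡 n) q x.proj, chartMetric q (extChartAt (𝓡 n) q x.proj) (coord q x))

lemma mem_target {q x : M} (hx : x ∈ (chartAt (𝔼 n) q).source) :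
    extChartAt (𝓡 n) q x ∈ (extChartAt (𝓡 n) q).target :=
  (extChartAt (𝓡 n) q).map_source (by simpa using hx)

lemma coord_eq_inverse {q : M} {x : TangentBundle (𝓡 n) M}
    (hx : x.proj ∈ (chartAt (𝔼 n) q).source) :
    coord q x = (chartMetric q (phase q x).1).inverse (phase q x).2 := by
  symm
  exact (isInvertible_chartMetric (mem_target hx)).inverse_apply_eq.2 rfl

lemma phase_injOn {q : M} {x y : TangentBundle (𝓡 n) M}
    (hx : x.proj ∈ (chartAt (𝔼 n) q).source) (hy : y.proj ∈ (chartAt (𝔼 n) q).source)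
    (h : phase q x = phase q y) : x = y := by
  have h1 := coord_eq_inverse hx
  rw [h, ← coord_eq_inverse hy] at h1
  have h2 : x.proj = y.proj :=
    (extChartAt (𝓡 n) q).injOn (by simpa using hx) (by simpa using hy) (congrArg Prod.fst h)
  obtain ⟨x, v⟩ := x
  obtain ⟨y, w⟩ := y
  obtain rfl : x = y := h2
  exact congrArg _ (coordL_injective hx h1)

/-- In position and momentum the geodesic equation becomes an autonomous first order system. -/
lemma IsGeoAt.hasDerivWithinAt_phase {γ : ℝ → TangentBundle (𝓡 n) M} {s : Set ℝ} {t : ℝ}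
    (h : IsGeoAt γ s t) {q : M} (hq : (γ t).proj ∈ (chartAt (𝔼 n) q).source) :
    HasDerivWithinAt (fun τ => phase q (γ τ)) (hamField q (phase q (γ t))) s t := by
  have := (h.pos q hq).prodMk (h.mom q hq)
  unfold hamField
  rw [← coord_eq_inverse hq]
  exact this

/-- Uniqueness for the Lipschitz field `hamField` in one chart, on a short interval to the right of
t. -/
lemma IsGeoOn.eventually_eq {γ₁ γ₂ : ℝ → TangentBundle (𝓡 n) M} {a b t : ℝ}
    (h₁ : IsGeoOn γ₁ (Icc a b)) (h₂ : IsGeoOn γ₂ (Icc a b)) (ht : t ∈ Ico a b)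
    (h : γ₁ t = γ₂ t) : ∀ᶠ s in 𝓝[>] t, γ₁ s = γ₂ s := by
  set q := (γ₁ t).proj with hq
  have hq1 : (γ₁ t).proj ∈ (chartAt (𝔼 n) q).source := mem_chart_source _ _
  have hq2 : (γ₂ t).proj ∈ (chartAt (𝔼 n) q).source := h ▸ hq1
  obtain ⟨K, U, hU, hK⟩ := (contDiffAt_hamField (z := phase q (γ₁ t))
    (mem_target hq1)).exists_lipschitzOnWith
  have hab : Icc a b ∈ 𝓝[≥] t := Icc_mem_nhdsGE_of_mem ht
  have ev : ∀ γ : ℝ → TangentBundle (𝓡 n) M, IsGeoOn γ (Icc a b) → γ t = γ₁ t →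
      ∀ᶠ s in 𝓝[≥] t, (γ s).proj ∈ (chartAt (𝔼 n) q).source ∧ phase q (γ s) ∈ U := by
    intro γ hγ hγt
    have hg := hγ t ⟨ht.1, ht.2.le⟩
    have hs : (γ t).proj ∈ (chartAt (𝔼 n) q).source := hγt ▸ hq1
    refine Filter.Eventually.and
      (hg.cont.mono_of_mem_nhdsWithin hab ((chartAt (𝔼 n) q).open_source.mem_nhds hs)) ?_
    refine ((hg.hasDerivWithinAt_phase hs).continuousWithinAt.mono_of_mem_nhdsWithin hab) ?_
    simpa [hγt] using hU
  obtain ⟨c, hc, hcs⟩ := mem_nhdsGE_iff_exists_Icc_subset.1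
    ((ev γ₁ h₁ rfl).and ((ev γ₂ h₂ h.symm).and hab))
  have sub : Icc t c ⊆ Icc a b := fun s hs => (hcs hs).2.2
  have key := ODE_solution_unique_of_mem_Icc_right (v := fun _ => hamField q) (s := fun _ => U)
    (K := K) (f := fun τ => phase q (γ₁ τ)) (g := fun τ => phase q (γ₂ τ)) (a := t) (b := c)
    (fun _ _ => hK)
    (fun s hs => (((h₁ s (sub hs)).hasDerivWithinAt_phase
      (hcs hs).1.1).continuousWithinAt).mono sub)
    (fun s hs => ((h₁ s (sub ⟨hs.1, hs.2.le⟩)).hasDerivWithinAt_phase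
      (hcs ⟨hs.1, hs.2.le⟩).1.1).mono_of_mem_nhdsWithin
        (mem_of_superset (Icc_mem_nhdsGE_of_mem hs) sub))
    (fun s hs => (hcs ⟨hs.1, hs.2.le⟩).1.2)
    (fun s hs => (((h₂ s (sub hs)).hasDerivWithinAt_phase
      (hcs hs).2.1.1).continuousWithinAt).mono sub)
    (fun s hs => ((h₂ s (sub ⟨hs.1, hs.2.le⟩)).hasDerivWithinAt_phase
      (hcs ⟨hs.1, hs.2.le⟩).2.1.1).mono_of_mem_nhdsWithin
        (mem_of_superset (Icc_mem_nhdsGE_of_mem hs) sub))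
    (fun s hs => (hcs ⟨hs.1, hs.2.le⟩).2.1.2)
    (by simp only [h])
  filter_upwards [Ioc_mem_nhdsGT hc] with s hs
  have hs' : s ∈ Icc t c := ⟨hs.1.le, hs.2⟩
  exact phase_injOn (hcs hs').1.1 (hcs hs').2.1.1 (key hs')

/-- The set of agreement propagates to the right by `eventually_eq`. It is closed: at a limit time
the positions agree since M is Hausdorff, and then so do the phases in a common chart. -/
lemma IsGeoOn.eqOn [T2Space M] {γ₁ γ₂ : ℝ → TangentBundle (𝓡 n) M} {a b : ℝ}
    (h₁ : IsGeoOn γ₁ (Icc a b)) (h₂ : IsGeoOn γ₂ (Icc a b)) (h : γ₁ a = γ₂ a) :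
    EqOn γ₁ γ₂ (Icc a b) := by
  refine IsClosed.Icc_subset_of_forall_mem_nhdsWithin (s := {t | γ₁ t = γ₂ t}) ?_ h
    (fun t ht => h₁.eventually_eq h₂ ht.2 ht.1)
  refine isClosed_of_closure_subset fun t ht => ?_
  have htI : t ∈ Icc a b := isClosed_Icc.closure_subset (closure_mono inter_subset_right ht)
  refine ⟨?_, htI⟩
  set S := {t | γ₁ t = γ₂ t} ∩ Icc a b
  have hne : (𝓝[S] t).NeBot := mem_closure_iff_nhdsWithin_neBot.1 ht
  have hS : ∀ᶠ τ in 𝓝[S] t, γ₂ τ = γ₁ τ :=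
    eventually_nhdsWithin_of_forall fun τ hτ => hτ.1.symm
  have hproj : (γ₁ t).proj = (γ₂ t).proj := by
    refine tendsto_nhds_unique (f := fun τ => (γ₁ τ).proj) (l := 𝓝[S] t)
      ((h₁ t htI).cont.mono inter_subset_right) ?_
    refine Tendsto.congr' ?_ ((h₂ t htI).cont.mono (inter_subset_right : S ⊆ _))
    filter_upwards [hS] with τ hτ using by rw [hτ]
  set q := (γ₁ t).proj with hq
  have hq1 : (γ₁ t).proj ∈ (chartAt (𝔼 n) q).source := mem_chart_source _ _
  have hq2 : (γ₂ t).proj ∈ (chartAt (𝔼 n) q).source := hproj ▸ hq1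
  refine phase_injOn hq1 hq2 ?_
  refine tendsto_nhds_unique (f := fun τ => phase q (γ₁ τ)) (l := 𝓝[S] t)
      (((h₁ t htI).hasDerivWithinAt_phase hq1).continuousWithinAt.mono inter_subset_right) ?_
  refine Tendsto.congr' ?_ (((h₂ t htI).hasDerivWithinAt_phase hq2).continuousWithinAt.mono
    (inter_subset_right : S ⊆ _))
  filter_upwards [hS] with τ hτ using by rw [hτ]

/-- The reversed tangent vector. -/
def revVec (x : TangentBundle (𝓡 n) M) : TangentBundle (𝓡 n) M := ⟨x.proj, -x.snd⟩

omit [IsManifold (𝓡 n) ∞ M] in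
lemma revVec_revVec (x : TangentBundle (𝓡 n) M) : revVec (revVec x) = x := by
  obtain ⟨x, v⟩ := x
  exact congrArg (fun w : TangentSpace (𝓡 n) x => (⟨x, w⟩ : TangentBundle (𝓡 n) M)) (neg_neg v)

lemma coord_revVec (q : M) (x : TangentBundle (𝓡 n) M) : coord q (revVec x) = -coord q x :=
  map_neg _ _

lemma metricGrad_neg (q : M) (y v : 𝔼 n) : metricGrad q y (-v) = metricGrad q y v := by
  simp [metricGrad]

lemma IsGeoAt.mono {γ : ℝ → TangentBundle (𝓡 n) M} {s s' : Set ℝ} {t : ℝ} (h : IsGeoAt γ s t)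
    (hs : s ∈ 𝓝[s'] t) : IsGeoAt γ s' t where
  cont := h.cont.mono_of_mem_nhdsWithin hs
  unit := h.unit
  pos q hq := (h.pos q hq).mono_of_mem_nhdsWithin hs
  mom q hq := (h.mom q hq).mono_of_mem_nhdsWithin hs

lemma IsGeoAt.union {γ : ℝ → TangentBundle (𝓡 n) M} {s s' : Set ℝ} {t : ℝ} (h : IsGeoAt γ s t)
    (h' : IsGeoAt γ s' t) : IsGeoAt γ (s ∪ s') t where
  cont := h.cont.union h'.cont
  unit := h.unit
  pos q hq := (h.pos q hq).union (h'.pos q hq)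
  mom q hq := (h.mom q hq).union (h'.mom q hq)

lemma IsGeoAt.congr {γ γ' : ℝ → TangentBundle (𝓡 n) M} {s : Set ℝ} {t : ℝ} (h : IsGeoAt γ s t)
    (hs : EqOn γ' γ s) (ht : t ∈ s) : IsGeoAt γ' s t where
  cont := h.cont.congr (fun τ hτ => by rw [hs hτ]) (by rw [hs ht])
  unit := by rw [hs ht]; exact h.unit
  pos q hq := by
    rw [hs ht] at hq ⊢
    exact (h.pos q hq).congr (fun τ hτ => by rw [hs hτ]) (by rw [hs ht])
  mom q hq := by
    rw [hs ht] at hq ⊢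
    exact (h.mom q hq).congr (fun τ hτ => by rw [hs hτ]) (by rw [hs ht])

lemma IsGeoAt.comp_add {γ : ℝ → TangentBundle (𝓡 n) M} {s s' : Set ℝ} {t c : ℝ}
    (h : IsGeoAt γ s (t + c)) (hs : MapsTo (· + c) s' s) : IsGeoAt (fun τ => γ (τ + c)) s' t where
  cont := h.cont.comp (f := (· + c)) (by fun_prop) hs
  unit := h.unit
  pos q hq := by
    simpa using! (h.pos q hq).scomp t ((hasDerivWithinAt_id t s').add_const c) hs
  mom q hq := by
    simpa using! (h.mom q hq).scomp t ((hasDerivWithinAt_id t s').add_const c) hs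

lemma norm_revVec (x : TangentBundle (𝓡 n) M) : ‖(revVec x).snd‖ = ‖x.snd‖ :=
  norm_neg (E := TangentSpace (𝓡 n) x.proj) x.snd

/-- Reversal changes the sign of time and of momentum, hence preserves the derivative of the
momentum, while `metricGrad` is even in the velocity. -/
lemma IsGeoAt.rev {γ : ℝ → TangentBundle (𝓡 n) M} {s s' : Set ℝ} {t c : ℝ}
    (h : IsGeoAt γ s (c - t)) (hs : MapsTo (c - ·) s' s) :
    IsGeoAt (fun τ => revVec (γ (c - τ))) s' t where
  cont := h.cont.comp (f := (c - ·)) (by fun_prop) hs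
  unit := by rw [norm_revVec]; exact h.unit
  pos q hq := by
    rw [coord_revVec]
    simpa using! (h.pos q hq).scomp t ((hasDerivWithinAt_id t s').const_sub c) hs
  mom q hq := by
    simp_rw [coord_revVec, metricGrad_neg, map_neg]
    have := ((h.mom q hq).scomp t ((hasDerivWithinAt_id t s').const_sub c) hs).neg
    rw [neg_smul, one_smul, neg_neg] at this
    exact this

lemma IsGeoOn.mono {γ : ℝ → TangentBundle (𝓡 n) M} {s s' : Set ℝ} (h : IsGeoOn γ s)
    (hs : s' ⊆ s) : IsGeoOn γ s' :=
  fun t ht => (h t (hs ht)).mono (mem_of_superset self_mem_nhdsWithin hs)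

/-- At a common point the one-sided derivatives agree because the equation prescribes them.
Closedness isolates the other points from the other set. -/
lemma IsGeoOn.union {γ : ℝ → TangentBundle (𝓡 n) M} {s s' : Set ℝ} (h : IsGeoOn γ s)
    (h' : IsGeoOn γ s') (hs : IsClosed s) (hs' : IsClosed s') : IsGeoOn γ (s ∪ s') := by
  have key : ∀ {s s' : Set ℝ} {t : ℝ}, t ∉ s' → IsClosed s' → s ∈ 𝓝[s ∪ s'] t := by
    intro s s' t ht hs'
    filter_upwards [self_mem_nhdsWithin, nhdsWithin_le_nhds (hs'.isOpen_compl.mem_nhds ht)]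
      with τ h1 h2 using h1.resolve_right h2
  intro t ht
  by_cases h1 : t ∈ s
  · by_cases h2 : t ∈ s'
    · exact (h t h1).union (h' t h2)
    · exact (h t h1).mono (key h2 hs')
  · refine (h' t (ht.resolve_left h1)).mono ?_
    rw [union_comm]
    exact key h1 hs

/-! ### The geodesic flow as a partial flow -/

/-- The unit speed geodesic issued from the vector `x` is at the vector `y` after time `ℓ`. -/
def GeoRel (x : TangentBundle (𝓡 n) M) (ℓ : ℝ) (y : TangentBundle (𝓡 n) M) : Prop :=
  0 ≤ ℓ ∧ ∃ γ : ℝ → TangentBundle (𝓡 n) M, IsGeoOn γ (Icc 0 ℓ) ∧ γ 0 = x ∧ γ ℓ = y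

lemma IsGeoOn.geoRel {γ : ℝ → TangentBundle (𝓡 n) M} {a b s t : ℝ} (h : IsGeoOn γ (Icc a b))
    (has : a ≤ s) (hst : s ≤ t) (htb : t ≤ b) : GeoRel (γ s) (t - s) (γ t) := by
  refine ⟨by linarith, fun τ => γ (τ + s), fun τ hτ => ?_, by simp, by simp⟩
  have hmaps : MapsTo (· + s) (Icc 0 (t - s)) (Icc a b) :=
    fun r hr => ⟨by linarith [hr.1], by linarith [hr.2]⟩
  exact (h _ (hmaps hτ)).comp_add hmaps

lemma GeoRel.split {x z : TangentBundle (𝓡 n) M} {s t : ℝ} (h : GeoRel x t z) (hs : 0 ≤ s)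
    (hst : s ≤ t) : ∃ y, GeoRel x s y ∧ GeoRel y (t - s) z := by
  obtain ⟨ht, γ, hγ, rfl, rfl⟩ := h
  exact ⟨γ s, by simpa using hγ.geoRel le_rfl hs hst, hγ.geoRel hs hst le_rfl⟩

lemma GeoRel.concat {x y z : TangentBundle (𝓡 n) M} {s t : ℝ} (h : GeoRel x s y)
    (h' : GeoRel y t z) : GeoRel x (s + t) z := by
  obtain ⟨hs, γ₁, h₁, rfl, rfl⟩ := h
  obtain ⟨ht, γ₂, h₂, h0, rfl⟩ := h'
  classical
  set γ : ℝ → TangentBundle (𝓡 n) M := fun τ => if τ ≤ s then γ₁ τ else γ₂ (τ - s) with hγ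
  have e1 : EqOn γ γ₁ (Icc 0 s) := fun τ hτ => if_pos hτ.2
  have e2 : EqOn γ (fun τ => γ₂ (τ + -s)) (Icc s (s + t)) := by
    intro τ hτ
    rcases hτ.1.eq_or_lt with rfl | h
    · simp [hγ, h0]
    · simp [hγ, not_le.2 h, sub_eq_add_neg]
  have g1 : IsGeoOn γ (Icc 0 s) := fun τ hτ => (h₁ τ hτ).congr e1 hτ
  have g2 : IsGeoOn γ (Icc s (s + t)) := by
    intro τ hτ
    have hmaps : MapsTo (· + -s) (Icc s (s + t)) (Icc 0 t) :=
      fun r hr => ⟨by simp [hr.1], by simp; linarith [hr.2]⟩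
    exact ((h₂ _ (hmaps hτ)).comp_add hmaps).congr e2 hτ
  have := g1.union g2 isClosed_Icc isClosed_Icc
  rw [Icc_union_Icc_eq_Icc hs (by linarith)] at this
  refine ⟨by positivity, γ, this, e1 ⟨le_rfl, hs⟩, ?_⟩
  simpa using e2 (x := s + t) ⟨by linarith, le_rfl⟩

lemma GeoRel.rev {x y : TangentBundle (𝓡 n) M} {t : ℝ} (h : GeoRel x t y) :
    GeoRel (revVec y) t (revVec x) := by
  obtain ⟨ht, γ, hγ, rfl, rfl⟩ := h
  refine ⟨ht, fun τ => revVec (γ (t - τ)), fun τ hτ => ?_, by simp, by simp⟩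
  have hmaps : MapsTo (t - ·) (Icc 0 t) (Icc 0 t) :=
    fun r hr => ⟨by simp [hr.2], by simp [hr.1]⟩
  exact (hγ _ (hmaps hτ)).rev hmaps

lemma GeoRel.unit {x y : TangentBundle (𝓡 n) M} {t : ℝ} (h : GeoRel x t y) : ‖x.snd‖ = 1 := by
  obtain ⟨ht, γ, hγ, rfl, rfl⟩ := h
  exact (hγ 0 ⟨le_rfl, ht⟩).unit

lemma chartMetric_coord_self {q : M} {x : TangentBundle (𝓡 n) M}
    (hx : x.proj ∈ (chartAt (𝔼 n) q).source) :
    chartMetric q (extChartAt (𝓡 n) q x.proj) (coord q x) (coord q x) = ‖x.snd‖ ^ 2 := by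
  rw [← real_inner_self_eq_norm_sq]
  exact chartMetric_extChartAt hx _ _

lemma revVec_ne {x : TangentBundle (𝓡 n) M} (h : ‖x.snd‖ = 1) : revVec x ≠ x := by
  intro h'
  have h2 : coord x.proj x = 0 := by
    have h3 := coord_revVec x.proj x
    rw [h'] at h3
    have h4 : (2 : ℝ) • coord x.proj x = 0 := by rw [two_smul]; exact eq_neg_iff_add_eq_zero.1 h3
    exact (smul_eq_zero.1 h4).resolve_left two_ne_zero
  have h3 := chartMetric_coord_self (mem_chart_source (𝔼 n) x.proj)
  simp [h2, h] at h3

lemma GeoRel.eq_of_zero {x y : TangentBundle (𝓡 n) M} (h : GeoRel x 0 y) : x = y := by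
  obtain ⟨-, γ, -, rfl, rfl⟩ := h
  rfl

lemma GeoRel.eq_apply [T2Space M] {γ : ℝ → TangentBundle (𝓡 n) M} {ℓ t : ℝ}
    {z : TangentBundle (𝓡 n) M} (hγ : IsGeoOn γ (Icc 0 ℓ)) (ht : t ≤ ℓ)
    (h : GeoRel (γ 0) t z) : z = γ t := by
  obtain ⟨h0, γ', hγ', h2, rfl⟩ := h
  exact hγ'.eqOn (hγ.mono (Icc_subset_Icc_right ht)) h2 ⟨h0, le_rfl⟩

lemma GeoRel.functional [T2Space M] {x y z : TangentBundle (𝓡 n) M} {t : ℝ} (h : GeoRel x t y)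
    (h' : GeoRel x t z) : y = z := by
  obtain ⟨-, γ, hγ, rfl, rfl⟩ := h
  exact (GeoRel.eq_apply hγ le_rfl h').symm

/-- Velocity is recovered from the phase, which is continuous, by inverting the metric. -/
lemma IsGeoAt.continuousWithinAt_coord {γ : ℝ → TangentBundle (𝓡 n) M} {s : Set ℝ} {t : ℝ}
    (h : IsGeoAt γ s t) {q : M} (hq : (γ t).proj ∈ (chartAt (𝔼 n) q).source) :
    ContinuousWithinAt (fun τ => coord q (γ τ)) s t := by
  have h1 := (h.hasDerivWithinAt_phase hq).continuousWithinAt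
  have h2 : ContinuousAt (fun z : 𝔼 n × (𝔼 n →L[ℝ] ℝ) => (chartMetric q z.1).inverse z.2)
      (phase q (γ t)) :=
    (continuous_fst.continuousAt.comp (contDiffAt_hamField
      (z := phase q (γ t)) (mem_target hq)).continuousAt)
  refine (ContinuousAt.comp_continuousWithinAt (f := fun τ => phase q (γ τ)) h2
    h1).congr_of_eventuallyEq ?_ (coord_eq_inverse hq)
  filter_upwards [h.cont ((chartAt (𝔼 n) q).open_source.mem_nhds hq)] with τ hτ
  exact coord_eq_inverse hτ

lemma exists_pos_forall_lt_of_hasDerivWithinAt {f : ℝ → ℝ} {f' a : ℝ}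
    (h : HasDerivWithinAt f f' (Icc 0 a) 0) (hf' : 0 < f') :
    ∃ ε > 0, ∀ s, 0 < s → s ≤ ε → s ≤ a → f 0 < f s := by
  rw [hasDerivWithinAt_iff_tendsto_slope] at h
  have h2 := h (Ioi_mem_nhds hf')
  rw [mem_map, mem_nhdsWithin_iff_exists_mem_nhds_inter] at h2
  obtain ⟨u, hu, hus⟩ := h2
  obtain ⟨ε, hε, hεu⟩ := Metric.mem_nhds_iff.1 hu
  refine ⟨ε / 2, by positivity, fun s hs hsε hsa => ?_⟩
  have := hus ⟨hεu (by simp [abs_of_pos hs]; linarith), ⟨hs.le, hsa⟩, hs.ne'⟩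
  have h3 : 0 < slope f 0 s := this
  rw [slope_def_field, sub_zero, div_pos_iff_of_pos_right hs] at h3
  linarith

/-- The covector dual to the initial velocity is positive on nearby velocities, so it increases
strictly along the projected geodesic in a chart. If no trajectory of positive length starts at x,
all times are zero. -/
lemma GeoRel.exists_injective [T2Space M] (x : TangentBundle (𝓡 n) M) :
    ∃ ε > 0, ∀ s t z z', s ≤ ε → t ≤ ε → GeoRel x s z → GeoRel x t z' → z.proj = z'.proj →
      s = t := by
  by_cases hx : ∃ a y, 0 < a ∧ GeoRel x a y
  swap
  · push Not at hx
    exact ⟨1, one_pos, fun s t z z' _ _ h h' _ => by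
      rw [le_antisymm (not_lt.1 fun h0 => hx s z h0 h) h.1,
        le_antisymm (not_lt.1 fun h0 => hx t z' h0 h') h'.1]⟩
  obtain ⟨a, y, ha, -, γ, hγ, rfl, rfl⟩ := hx
  set q := (γ 0).proj
  have hq : (γ 0).proj ∈ (chartAt (𝔼 n) q).source := mem_chart_source _ _
  have h0 := hγ 0 ⟨le_rfl, ha.le⟩
  set ξ := chartMetric q (extChartAt (𝓡 n) q (γ 0).proj) (coord q (γ 0)) with hξ
  have hpos : 0 < ξ (coord q (γ 0)) := by
    rw [hξ, chartMetric_coord_self hq, h0.unit]; norm_num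
  have ev : ∀ᶠ τ in 𝓝[≥] (0 : ℝ), (γ τ).proj ∈ (chartAt (𝔼 n) q).source ∧
      0 < ξ (coord q (γ τ)) ∧ τ ∈ Icc 0 a := by
    have hle : 𝓝[≥] (0 : ℝ) ≤ 𝓝[Icc 0 a] 0 := by rw [nhdsWithin_Icc_eq_nhdsGE ha]
    refine Filter.Eventually.and (hle (h0.cont ((chartAt (𝔼 n) q).open_source.mem_nhds hq))) ?_
    refine Filter.Eventually.and (hle ?_) (hle self_mem_nhdsWithin)
    exact (ξ.continuous.continuousAt.comp_continuousWithinAt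
      (h0.continuousWithinAt_coord hq)) (Ioi_mem_nhds hpos)
  obtain ⟨ε, hε, hεs⟩ := mem_nhdsGE_iff_exists_Icc_subset.1 ev
  have hε : 0 < ε := hε
  have hder : ∀ τ ∈ Icc 0 ε, HasDerivWithinAt (fun τ => ξ (extChartAt (𝓡 n) q (γ τ).proj))
      (ξ (coord q (γ τ))) (Icc 0 ε) τ := by
    intro τ hτ
    exact ξ.hasFDerivAt.comp_hasDerivWithinAt τ
      (((hγ τ (hεs hτ).2.2).pos q (hεs hτ).1).mono (fun r hr => (hεs hr).2.2))
  have hmono : StrictMonoOn (fun τ => ξ (extChartAt (𝓡 n) q (γ τ).proj)) (Icc 0 ε) := by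
    refine strictMonoOn_of_deriv_pos (convex_Icc _ _)
      (fun τ hτ => (hder τ hτ).continuousWithinAt) fun τ hτ => ?_
    rw [interior_Icc] at hτ
    rw [((hder τ (Ioo_subset_Icc_self hτ)).hasDerivAt (Icc_mem_nhds hτ.1 hτ.2)).deriv]
    exact (hεs (Ioo_subset_Icc_self hτ)).2.1
  refine ⟨ε, hε, fun s t z z' hs ht h h' hz => ?_⟩
  have hs' : s ∈ Icc 0 ε := ⟨h.1, hs⟩
  have ht' : t ∈ Icc 0 ε := ⟨h'.1, ht⟩
  rw [GeoRel.eq_apply hγ (hεs hs').2.2.2 h, GeoRel.eq_apply hγ (hεs ht').2.2.2 h'] at hz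
  exact hmono.injOn hs' ht' (by simp only [hz])

/-- For distinct unit vectors u and v, the covector g(u − v, ·) is positive on u and negative on v,
since g(u, v) < 1. It therefore increases along one geodesic and decreases along the other. If one
of the trajectories is trivial, injectivity of the other is enough. -/
lemma GeoRel.exists_separated [T2Space M] {x y : TangentBundle (𝓡 n) M} (hxy : x ≠ y)
    (hp : x.proj = y.proj) : ∃ ε > 0, ∀ s t z z', s ≤ ε → t ≤ ε → GeoRel x s z → GeoRel y t z' →
      z.proj = z'.proj → s = 0 ∧ t = 0 := by
  have triv : ∀ x : TangentBundle (𝓡 n) M, (¬ ∃ a z, 0 < a ∧ GeoRel x a z) →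
      ∀ s z, GeoRel x s z → s = 0 ∧ z = x := by
    intro x hx s z h
    push Not at hx
    have := le_antisymm (not_lt.1 fun h0 => hx s z h0 h) h.1
    subst this
    exact ⟨rfl, h.eq_of_zero.symm⟩
  have self : ∀ {x t z}, GeoRel (n := n) (M := M) x t z → GeoRel x 0 x := by
    intro x t z h
    obtain ⟨y, hy, -⟩ := h.split le_rfl h.1
    rwa [← hy.eq_of_zero] at hy
  by_cases hx : ∃ a z, 0 < a ∧ GeoRel x a z
  swap
  · obtain ⟨ε, hε, H⟩ := GeoRel.exists_injective y
    refine ⟨ε, hε, fun s t z z' hs ht h h' hz => ?_⟩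
    obtain ⟨rfl, rfl⟩ := triv x hx s z h
    exact ⟨rfl, H t 0 z' y ht hε.le h' (self h') (by rw [← hz, hp])⟩
  by_cases hy : ∃ a z, 0 < a ∧ GeoRel y a z
  swap
  · obtain ⟨ε, hε, H⟩ := GeoRel.exists_injective x
    refine ⟨ε, hε, fun s t z z' hs ht h h' hz => ?_⟩
    obtain ⟨rfl, rfl⟩ := triv y hy t z' h'
    exact ⟨H s 0 z x hs hε.le h (self h) (by rw [hz, hp]), rfl⟩
  obtain ⟨a, -, ha, -, γ, hγ, rfl, -⟩ := hx
  obtain ⟨b, -, hb, -, δ, hδ, rfl, -⟩ := hy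
  obtain ⟨q, hqdef⟩ : ∃ q, q = (γ 0).proj := ⟨_, rfl⟩
  have hq : (γ 0).proj ∈ (chartAt (𝔼 n) q).source := hqdef ▸ mem_chart_source _ _
  have hq' : (δ 0).proj ∈ (chartAt (𝔼 n) q).source := hp ▸ hq
  have h0 := hγ 0 ⟨le_rfl, ha.le⟩
  have h0' := hδ 0 ⟨le_rfl, hb.le⟩
  set G := chartMetric q (extChartAt (𝓡 n) q (γ 0).proj) with hG
  have hG' : chartMetric q (extChartAt (𝓡 n) q (δ 0).proj) = G := by rw [hG, hp]
  set u := coord q (γ 0)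
  set v := coord q (δ 0)
  have huu : G u u = 1 := (chartMetric_coord_self hq).trans (by rw [h0.unit]; norm_num)
  have hvv : G v v = 1 := by
    rw [← hG']
    exact (chartMetric_coord_self hq').trans (by rw [h0'.unit]; norm_num)
  have huv : G u v < 1 := by
    have hne : u - v ≠ 0 := by
      intro h
      apply hxy
      refine phase_injOn hq hq' ?_
      rw [phase, phase, hG', ← hG, hp, show coord q (γ 0) = coord q (δ 0) from sub_eq_zero.1 h]
    have h1 := chartMetric_pos (mem_target hq) hne
    rw [← hG] at h1
    have h2 : G v u = G u v := chartMetric_comm _ _ _ _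
    simp only [map_sub, sub_apply, huu, hvv, h2] at h1
    linarith
  have hvu : G v u = G u v := chartMetric_comm _ _ _ _
  set ξ := G (u - v) with hξ
  have hξu : 0 < ξ u := by
    simp only [hξ, map_sub, sub_apply, huu, hvu]; linarith
  have hξv : 0 < (-ξ) v := by
    simp only [hξ, map_sub, sub_apply, hvv, neg_apply]
    linarith
  have d1 : HasDerivWithinAt (fun τ => ξ (extChartAt (𝓡 n) q (γ τ).proj)) (ξ u) (Icc 0 a) 0 :=
    ξ.hasFDerivAt.comp_hasDerivWithinAt 0 (h0.pos q hq)
  have d2 : HasDerivWithinAt (fun τ => (-ξ) (extChartAt (𝓡 n) q (δ τ).proj)) ((-ξ) v)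
      (Icc 0 b) 0 := (-ξ).hasFDerivAt.comp_hasDerivWithinAt 0 (h0'.pos q hq')
  obtain ⟨ε₁, hε₁, H₁⟩ := exists_pos_forall_lt_of_hasDerivWithinAt d1 hξu
  obtain ⟨ε₂, hε₂, H₂⟩ := exists_pos_forall_lt_of_hasDerivWithinAt d2 hξv
  refine ⟨min (min ε₁ ε₂) (min a b), by positivity, fun s t z z' hs ht h h' hz => ?_⟩
  simp only [le_min_iff] at hs ht
  rw [GeoRel.eq_apply hγ hs.2.1 h, GeoRel.eq_apply hδ ht.2.2 h'] at hz
  have K1 := fun hs0 => H₁ s hs0 hs.1.1 hs.2.1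
  have K2 := fun ht0 => H₂ t ht0 ht.1.2 ht.2.2
  simp only [neg_apply, neg_lt_neg_iff, hz, ← hp] at K1 K2
  rcases h.1.eq_or_lt with rfl | hs0
  · refine ⟨rfl, ?_⟩
    rcases h'.1.eq_or_lt with rfl | ht0
    · rfl
    · have := K2 ht0
      rw [← hz] at this
      exact absurd this (lt_irrefl _)
  · rcases h'.1.eq_or_lt with rfl | ht0
    · have := K1 hs0
      rw [← hp] at this
      exact absurd this (lt_irrefl _)
    · exact absurd (K1 hs0) (not_lt.2 (K2 ht0).le)

/-- The geodesic flow of `M`, as a partially defined reversible flow. -/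
def geodesicFlow [T2Space M] : PartialFlow (TangentBundle (𝓡 n) M) M where
  R := GeoRel
  proj x := x.proj
  rev := revVec
  nonneg h := h.1
  zero_eq h := h.eq_of_zero
  functional h h' := h.functional h'
  split h hs hst := h.split hs hst
  concat h h' := h.concat h'
  rev_rel h := h.rev
  rev_rev := revVec_revVec
  proj_rev _ := rfl
  rev_ne h := revVec_ne h.unit
  injective := GeoRel.exists_injective
  separated _ _ hxy hp := GeoRel.exists_separated hxy hp
  continuous := by
    rintro x t y ⟨-, γ, hγ, rfl, rfl⟩
    exact ⟨fun τ => (γ τ).proj, fun τ hτ => (hγ τ hτ).cont, fun s z hs h => by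
      rw [GeoRel.eq_apply hγ hs h]⟩

/-! ### Velocity, speed and length of curves -/

/-- The velocity of a curve parametrized by `[0, 1]`. -/
def velocity (c : ℝ → M) (t : ℝ) : TangentBundle (𝓡 n) M :=
  ⟨c t, mfderivWithin 𝓘(ℝ, ℝ) (𝓡 n) c (Icc 0 1) t (1 : ℝ)⟩

/-- The speed of a curve parametrized by `[0, 1]`. -/
def speed (c : ℝ → M) (t : ℝ) : ℝ := ‖(velocity (n := n) c t).snd‖

lemma hasDerivWithinAt_extChartAt {c : ℝ → M} {s : Set ℝ} {t : ℝ} {q : M}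
    (hc : MDifferentiableWithinAt 𝓘(ℝ, ℝ) (𝓡 n) c s t) (hq : c t ∈ (chartAt (𝔼 n) q).source) :
    HasDerivWithinAt (fun τ => extChartAt (𝓡 n) q (c τ))
      (coordL q (c t) (mfderivWithin 𝓘(ℝ, ℝ) (𝓡 n) c s t (1 : ℝ))) s t := by
  have h1 : HasMFDerivAt (𝓡 n) 𝓘(ℝ, 𝔼 n) (extChartAt (𝓡 n) q) (c t) (coordL q (c t)) := by
    rw [coordL_eq_mfderiv hq]
    exact (mdifferentiableAt_extChartAt hq).hasMFDerivAt
  have h2 := (h1.comp_hasMFDerivWithinAt t hc.hasMFDerivWithinAt)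
  obtain ⟨D, hD⟩ : ∃ D : ℝ →L[ℝ] 𝔼 n, D = (coordL q (c t)).comp
    (mfderivWithin 𝓘(ℝ, ℝ) (𝓡 n) c s t) := ⟨_, rfl⟩
  have h3 : HasFDerivWithinAt (fun τ => extChartAt (𝓡 n) q (c τ)) D s t := by
    rw [hD]
    exact h2.hasFDerivWithinAt
  have h4 : D 1 = coordL q (c t) (mfderivWithin 𝓘(ℝ, ℝ) (𝓡 n) c s t (1 : ℝ)) := by rw [hD]; rfl
  rw [← h4]
  exact h3.hasDerivWithinAt

lemma hasDerivWithinAt_velocity {c : ℝ → M} {t : ℝ} {q : M}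
    (hc : MDifferentiableWithinAt 𝓘(ℝ, ℝ) (𝓡 n) c (Icc 0 1) t)
    (hq : c t ∈ (chartAt (𝔼 n) q).source) :
    HasDerivWithinAt (fun τ => extChartAt (𝓡 n) q (c τ)) (coord q (velocity c t)) (Icc 0 1) t :=
  hasDerivWithinAt_extChartAt hc hq

lemma speed_sq {c : ℝ → M} {t : ℝ} {q : M} (hq : c t ∈ (chartAt (𝔼 n) q).source) :
    speed (n := n) c t ^ 2 = chartMetric q (extChartAt (𝓡 n) q (c t)) (coord q (velocity c t))
      (coord q (velocity c t)) :=
  (chartMetric_coord_self (x := velocity c t) hq).symm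

lemma speed_ne_zero_iff {c : ℝ → M} {t : ℝ} :
    speed (n := n) c t ≠ 0 ↔
      Function.Injective (mfderivWithin 𝓘(ℝ, ℝ) (𝓡 n) c (Icc 0 1) t) := by
  set L := mfderivWithin 𝓘(ℝ, ℝ) (𝓡 n) c (Icc 0 1) t with hL
  have h1 : speed (n := n) c t ≠ 0 ↔ L (1 : ℝ) ≠ 0 :=
    norm_ne_zero_iff (E := TangentSpace (𝓡 n) (c t)) (a := L (1 : ℝ))
  rw [h1]
  constructor
  · intro h (a : ℝ) (b : ℝ) hab
    have hab' : (a - b) • L (1 : ℝ) = 0 := by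
      rw [← L.map_smul (a - b) (1 : ℝ)]
      have h2 : ((a - b) • (1 : ℝ) : ℝ) = a - b := by simp
      have h3 : L ((a - b : ℝ)) = 0 := by
        rw [← sub_eq_zero] at hab
        rw [← hab]; exact L.map_sub a b
      exact (congrArg L h2).trans h3
    exact sub_eq_zero.1 ((smul_eq_zero.1 hab').resolve_right h)
  · intro h h0
    have : (1 : ℝ) = 0 := h (h0.trans (map_zero L).symm)
    exact one_ne_zero this

/-- The length of a `C¹` curve is the integral of its speed. -/
lemma toReal_pathELength {c : ℝ → M} (hc : ContinuousOn (speed (n := n) c) (Icc 0 1)) :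
    (pathELength (𝓡 n) c 0 1).toReal = ∫ t in (0 : ℝ)..1, speed (n := n) c t := by
  rw [pathELength_eq_lintegral_mfderivWithin_Icc, intervalIntegral.integral_of_le zero_le_one,
    MeasureTheory.integral_Icc_eq_integral_Ioc.symm,
    MeasureTheory.integral_eq_lintegral_of_nonneg_ae (f := speed (n := n) c)
      (Eventually.of_forall fun t => norm_nonneg _)
      (hc.aestronglyMeasurable measurableSet_Icc)]
  congr 1
  refine MeasureTheory.lintegral_congr fun t => ?_
  exact (ofReal_norm _).symm

/-! ### Differentiation of the length of a family of curves -/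

section

/-- The domain of a one-parameter family of curves parametrized by `[0, 1]`. -/
def strip (δ : ℝ) : Set (ℝ × ℝ) := Ioo (-δ) δ ×ˢ Icc 0 1

lemma uniqueDiffOn_strip (δ : ℝ) : UniqueDiffOn ℝ (strip δ) :=
  isOpen_Ioo.uniqueDiffOn.prod uniqueDiffOn_Icc_zero_one

/-- A family of curves in the chart around `q`. -/
def inChart (n : ℕ) {M : Type*} [TopologicalSpace M] [ChartedSpace (EuclideanSpace ℝ (Fin n)) M]
    (q : M) (F : ℝ → ℝ → M) (z : ℝ × ℝ) : 𝔼 n := extChartAt (𝓡 n) q (F z.1 z.2)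

variable {F : ℝ → ℝ → M} {δ : ℝ} {z : ℝ × ℝ} {q : M}

lemma contDiffWithinAt_inChart
    (hF : ContMDiffOn 𝓘(ℝ, ℝ × ℝ) (𝓡 n) 2 (fun z : ℝ × ℝ => F z.1 z.2) (strip δ))
    (hz : z ∈ strip δ) (hq : F z.1 z.2 ∈ (chartAt (𝔼 n) q).source) :
    ContDiffWithinAt ℝ 2 (inChart n q F) (strip δ) z := by
  rw [← contMDiffWithinAt_iff_contDiffWithinAt]
  have h1 : ContMDiffAt (𝓡 n) 𝓘(ℝ, 𝔼 n) 2 (extChartAt (𝓡 n) q) (F z.1 z.2) :=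
    (contMDiffAt_extChartAt' (n := ∞) hq).of_le 
      (WithTop.coe_le_coe.2 (le_top : (2 : ℕ∞) ≤ ⊤))
  exact h1.comp_contMDiffWithinAt z (hF z hz)

lemma eventually_mem_source
    (hF : ContMDiffOn 𝓘(ℝ, ℝ × ℝ) (𝓡 n) 2 (fun z : ℝ × ℝ => F z.1 z.2) (strip δ))
    (hz : z ∈ strip δ) (hq : F z.1 z.2 ∈ (chartAt (𝔼 n) q).source) :
    ∀ᶠ w in 𝓝[strip δ] z, w ∈ strip δ ∧ F w.1 w.2 ∈ (chartAt (𝔼 n) q).source :=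
  Filter.Eventually.and self_mem_nhdsWithin
    ((hF z hz).continuousWithinAt ((chartAt (𝔼 n) q).open_source.mem_nhds hq))

lemma mdifferentiableWithinAt_slice
    (hF : ContMDiffOn 𝓘(ℝ, ℝ × ℝ) (𝓡 n) 2 (fun z : ℝ × ℝ => F z.1 z.2) (strip δ))
    (hz : z ∈ strip δ) :
    MDifferentiableWithinAt 𝓘(ℝ, ℝ) (𝓡 n) (F z.1) (Icc 0 1) z.2 := by
  have h1 : MDifferentiableWithinAt 𝓘(ℝ, ℝ) 𝓘(ℝ, ℝ × ℝ) (fun t : ℝ => (z.1, t)) (Icc 0 1) z.2 :=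
    DifferentiableWithinAt.mdifferentiableWithinAt (by fun_prop)
  exact MDifferentiableWithinAt.comp (I' := 𝓘(ℝ, ℝ × ℝ)) (u := strip δ)
    (g := fun z : ℝ × ℝ => F z.1 z.2) z.2
    ((hF z hz).mdifferentiableWithinAt (by norm_num)) h1 fun t ht => ⟨hz.1, ht⟩

lemma mdifferentiableAt_slice
    (hF : ContMDiffOn 𝓘(ℝ, ℝ × ℝ) (𝓡 n) 2 (fun z : ℝ × ℝ => F z.1 z.2) (strip δ))
    (hz : z ∈ strip δ) : MDifferentiableAt 𝓘(ℝ, ℝ) (𝓡 n) (fun s => F s z.2) z.1 := by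
  have h1 : MDifferentiableWithinAt 𝓘(ℝ, ℝ) 𝓘(ℝ, ℝ × ℝ) (fun s : ℝ => (s, z.2))
      (Ioo (-δ) δ) z.1 := DifferentiableWithinAt.mdifferentiableWithinAt (by fun_prop)
  exact (MDifferentiableWithinAt.comp (I' := 𝓘(ℝ, ℝ × ℝ)) (u := strip δ)
    (g := fun z : ℝ × ℝ => F z.1 z.2) z.1
    ((hF z hz).mdifferentiableWithinAt (by norm_num)) h1
    fun t ht => ⟨ht, hz.2⟩).mdifferentiableAt (isOpen_Ioo.mem_nhds hz.1)

lemma coord_velocity_slice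
    (hF : ContMDiffOn 𝓘(ℝ, ℝ × ℝ) (𝓡 n) 2 (fun z : ℝ × ℝ => F z.1 z.2) (strip δ))
    (hz : z ∈ strip δ) (hq : F z.1 z.2 ∈ (chartAt (𝔼 n) q).source) :
    coord q (velocity (F z.1) z.2) = fderivWithin ℝ (inChart n q F) (strip δ) z (0, 1) := by
  have h1 := hasDerivWithinAt_velocity (mdifferentiableWithinAt_slice hF hz) hq
  have h2 := ((contDiffWithinAt_inChart hF hz hq).differentiableWithinAt
    (by norm_num)).hasFDerivWithinAt
  have h3 : HasDerivWithinAt (fun t : ℝ => (z.1, t)) ((0 : ℝ), (1 : ℝ)) (Icc 0 1) z.2 :=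
    (hasDerivWithinAt_const _ _ _).prodMk (hasDerivWithinAt_id _ _)
  have h4 := HasFDerivWithinAt.comp_hasDerivWithinAt (t := strip δ) z.2 h2 h3
    fun t ht => ⟨hz.1, ht⟩
  exact (uniqueDiffOn_Icc_zero_one z.2 hz.2).eq_deriv _ h1 h4

/-- The variation field of a family of curves. -/
def variationField (F : ℝ → ℝ → M) (t : ℝ) : TangentBundle (𝓡 n) M :=
  ⟨F 0 t, mfderiv 𝓘(ℝ, ℝ) (𝓡 n) (fun s => F s t) 0 (1 : ℝ)⟩

lemma zero_mem_strip (hδ : 0 < δ) {t : ℝ} (ht : t ∈ Icc (0 : ℝ) 1) : ((0 : ℝ), t) ∈ strip δ :=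
  ⟨⟨by linarith, hδ⟩, ht⟩

lemma coord_variationField (hδ : 0 < δ)
    (hF : ContMDiffOn 𝓘(ℝ, ℝ × ℝ) (𝓡 n) 2 (fun z : ℝ × ℝ => F z.1 z.2) (strip δ))
    {t : ℝ} (ht : t ∈ Icc (0 : ℝ) 1) (hq : F 0 t ∈ (chartAt (𝔼 n) q).source) :
    coord q (variationField F t) =
      fderivWithin ℝ (inChart n q F) (strip δ) (0, t) (1, 0) := by
  have hz : ((0 : ℝ), t) ∈ strip δ := zero_mem_strip hδ ht
  have h1 : HasDerivWithinAt (fun s => extChartAt (𝓡 n) q (F s t)) (coord q (variationField F t))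
      univ 0 := by
    have := hasDerivWithinAt_extChartAt (q := q)
      (mdifferentiableAt_slice hF hz).mdifferentiableWithinAt (s := univ) hq
    rwa [mfderivWithin_univ] at this
  have h2 := ((contDiffWithinAt_inChart hF hz hq).differentiableWithinAt
    (by norm_num)).hasFDerivWithinAt
  have h3 : HasDerivWithinAt (fun s : ℝ => (s, t)) ((1 : ℝ), (0 : ℝ)) (Ioo (-δ) δ) 0 :=
    (hasDerivWithinAt_id _ _).prodMk (hasDerivWithinAt_const _ _ _)
  have h4 := HasFDerivWithinAt.comp_hasDerivWithinAt (t := strip δ) 0 h2 h3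
    fun s hs => ⟨hs, ht⟩
  exact (isOpen_Ioo.uniqueDiffOn 0 hz.1).eq_deriv _ (h1.mono (subset_univ _)) h4

/-- The squared speed is continuously differentiable. -/
lemma contDiffOn_speed_sq
    (hF : ContMDiffOn 𝓘(ℝ, ℝ × ℝ) (𝓡 n) 2 (fun z : ℝ × ℝ => F z.1 z.2) (strip δ)) :
    ContDiffOn ℝ 1 (fun z => speed (n := n) (F z.1) z.2 ^ 2) (strip δ) := by
  intro z hz
  obtain ⟨q, hqz⟩ : ∃ q, q = F z.1 z.2 := ⟨_, rfl⟩
  have hq : F z.1 z.2 ∈ (chartAt (𝔼 n) q).source := hqz ▸ mem_chart_source _ _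
  have hX := contDiffWithinAt_inChart hF hz hq
  have hG : ContDiffWithinAt ℝ 1 (fun w => chartMetric (n := n) q (inChart n q F w)) (strip δ) z :=
    ((contDiffAt_chartMetric (mem_target hq)).comp_contDiffWithinAt z hX).of_le (by norm_num)
  have hT : ContDiffWithinAt ℝ 1
      (fun w => fderivWithin ℝ (inChart n q F) (strip δ) w (0, 1)) (strip δ) z :=
    (hX.fderivWithin_right (uniqueDiffOn_strip δ) (by norm_num) hz).clm_apply
      contDiffWithinAt_const
  refine ((hG.clm_apply hT).clm_apply hT).congr_of_eventuallyEq ?_ ?_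
  · filter_upwards [eventually_mem_source hF hz hq] with w hw
    rw [speed_sq hw.2, coord_velocity_slice hF hw.1 hw.2]
    rfl
  · rw [speed_sq hq, coord_velocity_slice hF hz hq]
    rfl

lemma contDiffOn_speed
    (hF : ContMDiffOn 𝓘(ℝ, ℝ × ℝ) (𝓡 n) 2 (fun z : ℝ × ℝ => F z.1 z.2) (strip δ))
    (hi : ∀ z ∈ strip δ, speed (n := n) (F z.1) z.2 ≠ 0) :
    ContDiffOn ℝ 1 (fun z => speed (n := n) (F z.1) z.2) (strip δ) :=
  ((contDiffOn_speed_sq hF).sqrt fun z hz => pow_ne_zero 2 (hi z hz)).congr fun _ _ =>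
    (Real.sqrt_sq (norm_nonneg _)).symm

/-- The derivative of the length of a family of curves. -/
lemma hasDerivAt_length (hδ : 0 < δ)
    (hF : ContMDiffOn 𝓘(ℝ, ℝ × ℝ) (𝓡 n) 2 (fun z : ℝ × ℝ => F z.1 z.2) (strip δ))
    (hi : ∀ z ∈ strip δ, speed (n := n) (F z.1) z.2 ≠ 0) :
    IntervalIntegrable (fun t => deriv (fun s => speed (n := n) (F s) t) 0)
      MeasureTheory.volume 0 1 ∧
    HasDerivAt (fun s => (pathELength (𝓡 n) (F s) 0 1).toReal)
      (∫ t in (0 : ℝ)..1, deriv (fun s => speed (n := n) (F s) t) 0) 0 := by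
  have hC := contDiffOn_speed hF hi
  set N : ℝ × ℝ → ℝ := fun z => speed (n := n) (F z.1) z.2 with hN
  have hder : ∀ z ∈ strip δ, HasDerivAt (fun s => N (s, z.2))
      (fderivWithin ℝ N (strip δ) z (1, 0)) z.1 := by
    intro z hz
    have h2 := ((hC z hz).differentiableWithinAt (by norm_num)).hasFDerivWithinAt
    have h3 : HasDerivWithinAt (fun s : ℝ => (s, z.2)) ((1 : ℝ), (0 : ℝ)) (Ioo (-δ) δ) z.1 :=
      (hasDerivWithinAt_id _ _).prodMk (hasDerivWithinAt_const _ _ _)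
    exact (HasFDerivWithinAt.comp_hasDerivWithinAt (t := strip δ) z.1 h2 h3
      fun s hs => ⟨hs, hz.2⟩).hasDerivAt (isOpen_Ioo.mem_nhds hz.1)
  have hcont : ContinuousOn (fun z => fderivWithin ℝ N (strip δ) z (1, 0)) (strip δ) :=
    (hC.continuousOn_fderivWithin (uniqueDiffOn_strip δ) (by norm_num)).clm_apply
      continuousOn_const
  have hslice : ∀ s ∈ Ioo (-δ) δ, ∀ {f : ℝ × ℝ → ℝ}, ContinuousOn f (strip δ) →
      ContinuousOn (fun t => f (s, t)) (Icc 0 1) := fun s hs f hf =>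
    hf.comp (by fun_prop) fun t ht => ⟨hs, ht⟩
  -- The derivative of the speed is bounded on compact sets only, so the strip is halved to dominate
  -- the integrand.
  have hK : Icc (-(δ / 2)) (δ / 2) ×ˢ Icc (0 : ℝ) 1 ⊆ strip δ :=
    prod_mono (fun s hs => ⟨by linarith [hs.1], by linarith [hs.2]⟩) subset_rfl
  obtain ⟨C, hCb⟩ := ((isCompact_Icc.prod isCompact_Icc).exists_bound_of_continuousOn
    (hcont.mono hK))
  have h0 : (0 : ℝ) ∈ Ioo (-δ) δ := ⟨by linarith, hδ⟩
  have hnb : Ioo (-δ) δ ∈ 𝓝 (0 : ℝ) := isOpen_Ioo.mem_nhds h0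
  have hu : uIoc (0 : ℝ) 1 ⊆ Icc 0 1 := by rw [uIoc_of_le zero_le_one]; exact Ioc_subset_Icc_self
  have key := intervalIntegral.hasDerivAt_integral_of_dominated_loc_of_deriv_le
    (μ := MeasureTheory.volume) (a := 0) (b := 1) (F := fun s t => N (s, t))
    (F' := fun s t => fderivWithin ℝ N (strip δ) (s, t) (1, 0)) (x₀ := 0) (bound := fun _ => C)
    (s := Icc (-(δ / 2)) (δ / 2))
    (Icc_mem_nhds (by linarith) (by linarith))
    (by
      filter_upwards [hnb] with s hs
      exact ((hslice s hs hC.continuousOn).mono hu).aestronglyMeasurable measurableSet_uIoc)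
    (by
      refine ContinuousOn.intervalIntegrable ?_
      rw [uIcc_of_le zero_le_one]
      exact hslice 0 h0 hC.continuousOn)
    (((hslice 0 h0 hcont).mono hu).aestronglyMeasurable measurableSet_uIoc)
    (Eventually.of_forall fun t ht s hs => hCb (s, t) ⟨hs, hu ht⟩)
    intervalIntegrable_const
    (Eventually.of_forall fun t ht s hs => hder (s, t) (hK ⟨hs, hu ht⟩))
  have hE : ∀ t ∈ Icc (0 : ℝ) 1, deriv (fun s => speed (n := n) (F s) t) 0 =
      fderivWithin ℝ N (strip δ) (0, t) (1, 0) := fun t ht =>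
    (hder (0, t) (zero_mem_strip hδ ht)).deriv
  have hI : ∫ t in (0 : ℝ)..1, deriv (fun s => speed (n := n) (F s) t) 0 =
      ∫ t in (0 : ℝ)..1, fderivWithin ℝ N (strip δ) (0, t) (1, 0) := by
    refine intervalIntegral.integral_congr fun t ht => hE t ?_
    rwa [uIcc_of_le zero_le_one] at ht
  refine ⟨key.1.congr ?_, ?_⟩
  · intro t ht
    exact (hE t (hu ht)).symm
  rw [hI]
  refine key.2.congr_of_eventuallyEq ?_
  filter_upwards [hnb] with s hs
  exact toReal_pathELength (hslice s hs hC.continuousOn)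

end

/-! ### The first variation formula -/

section

/-- By symmetry of the second derivative, the same W is the derivative of either partial in the
other direction. -/
lemma _root_.ContDiffAt.exists_mixed_partial {E : Type*} [NormedAddCommGroup E] [NormedSpace ℝ E]
    {X : ℝ × ℝ → E} {s t : ℝ} (hX : ContDiffAt ℝ 2 X (s, t)) :
    ∃ W, HasDerivAt (fun r => fderiv ℝ X (s, r) (1, 0)) W t ∧
      HasDerivAt (fun r => fderiv ℝ X (r, t) (0, 1)) W s := by
  obtain ⟨B, hB⟩ : ∃ B : ℝ × ℝ →L[ℝ] (ℝ × ℝ →L[ℝ] E), HasFDerivAt (fderiv ℝ X) B (s, t) :=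
    (hX.fderiv_right (m := 1) (by norm_num)).differentiableAt (by norm_num)
  have hev : ∀ᶠ y in 𝓝 (s, t), HasFDerivAt X (fderiv ℝ X y) y := by
    filter_upwards [hX.eventually (by simp)] with y hy
    exact (hy.differentiableAt (by norm_num)).hasFDerivAt
  have hs : HasDerivAt (fun r : ℝ => (r, t)) ((1 : ℝ), (0 : ℝ)) s :=
    (hasDerivAt_id _).prodMk (hasDerivAt_const _ _)
  have ht : HasDerivAt (fun r : ℝ => (s, r)) ((0 : ℝ), (1 : ℝ)) t :=
    (hasDerivAt_const _ _).prodMk (hasDerivAt_id _)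
  have h1 : HasDerivAt (fun r => fderiv ℝ X (s, r)) (B (0, 1)) t := hB.comp_hasDerivAt t ht
  have h2 : HasDerivAt (fun r => fderiv ℝ X (r, t)) (B (1, 0)) s := hB.comp_hasDerivAt s hs
  refine ⟨B (1, 0) (0, 1), ?_, ?_⟩
  · rw [second_derivative_symmetric_of_eventually_of_real hev hB (1, 0) (0, 1)]
    simpa using h1.clm_apply (hasDerivAt_const t ((1 : ℝ), (0 : ℝ)))
  · simpa using h2.clm_apply (hasDerivAt_const s ((0 : ℝ), (1 : ℝ)))

/-- The normed group of bilinear forms. -/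
instance bilinNormed (n : ℕ) : NormedAddCommGroup (𝔼 n →L[ℝ] 𝔼 n →L[ℝ] ℝ) :=
  ContinuousLinearMap.toNormedAddCommGroup

lemma hasDerivAt_chartMetric_comp {q : M} {x : ℝ → 𝔼 n} {x' : 𝔼 n} {s : ℝ}
    (hx : HasDerivAt x x' s) (hs : x s ∈ (extChartAt (𝓡 n) q).target) :
    ∃ A : 𝔼 n →L[ℝ] 𝔼 n →L[ℝ] ℝ, HasDerivAt (fun r => chartMetric (n := n) q (x r)) A s ∧
      ∀ v, A v v = 2 * metricGrad q (x s) v x' := by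
  have hG := (contDiffAt_chartMetric (n := n) hs).differentiableAt (by norm_num)
  have hA := (DifferentiableAt.comp s hG hx.differentiableAt).hasDerivAt
  refine ⟨_, hA, fun v => ?_⟩
  have h1 : DifferentiableAt ℝ (fun z => chartMetric (n := n) q z v v) (x s) :=
    (hG.clm_apply (differentiableAt_const v)).clm_apply (differentiableAt_const v)
  have h2 := h1.hasFDerivAt.comp_hasDerivAt s hx
  have h3 := (hA.clm_apply (hasDerivAt_const s v)).clm_apply (hasDerivAt_const s v)
  have h4 := h3.unique h2
  simp only [map_zero, add_zero, metricGrad, smul_apply, smul_eq_mul] at h4 ⊢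
  rw [h4]
  ring

/-- The first variation of the speed in a chart. -/
lemma hasDerivAt_pairing_chart {q : M} {X : ℝ × ℝ → 𝔼 n} {N : ℝ × ℝ → ℝ} {s t : ℝ}
    (hX : ContDiffAt ℝ 2 X (s, t)) (hq : X (s, t) ∈ (extChartAt (𝓡 n) q).target)
    (hN : ∀ᶠ z in 𝓝 (s, t), N z ^ 2 =
      chartMetric q (X z) (fderiv ℝ X z (0, 1)) (fderiv ℝ X z (0, 1)))
    (hN0 : N (s, t) ≠ 0) {D : ℝ} (hD : HasDerivAt (fun r => N (r, t)) D s)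
    {ξ : 𝔼 n →L[ℝ] ℝ} (hξ : HasDerivAt (fun r => (N (s, r))⁻¹ •
      chartMetric q (X (s, r)) (fderiv ℝ X (s, r) (0, 1))) ξ t) :
    HasDerivAt (fun r => (N (s, r))⁻¹ *
      chartMetric q (X (s, r)) (fderiv ℝ X (s, r) (0, 1)) (fderiv ℝ X (s, r) (1, 0)))
      (D - ((N (s, t))⁻¹ • metricGrad q (X (s, t)) (fderiv ℝ X (s, t) (0, 1)) - ξ)
        (fderiv ℝ X (s, t) (1, 0))) t := by
  obtain ⟨W, hu, hv⟩ := hX.exists_mixed_partial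
  have hs : HasDerivAt (fun r : ℝ => (r, t)) ((1 : ℝ), (0 : ℝ)) s :=
    (hasDerivAt_id _).prodMk (hasDerivAt_const _ _)
  have hx : HasDerivAt (fun r => X (r, t)) (fderiv ℝ X (s, t) (1, 0)) s :=
    (hX.differentiableAt (by norm_num)).hasFDerivAt.comp_hasDerivAt s hs
  obtain ⟨A, hA, hA'⟩ := hasDerivAt_chartMetric_comp hx hq
  have hsq := (hA.clm_apply hv).clm_apply hv
  have hsq2 : HasDerivAt (fun r => N (r, t) ^ 2) _ s := hD.pow 2
  have hev : (fun r => N (r, t) ^ 2) =ᶠ[𝓝 s] fun r =>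
      chartMetric q (X (r, t)) (fderiv ℝ X (r, t) (0, 1)) (fderiv ℝ X (r, t) (0, 1)) :=
    hs.continuousAt.eventually hN
  -- Two expressions for the s-derivative of the squared speed. They determine the metric product of
  -- velocity and mixed partial, which is the unknown term in the t-derivative of the pairing.
  have heq := hsq2.unique (hsq.congr_of_eventuallyEq hev)
  refine ((hξ.clm_apply hu).congr_deriv ?_).congr_of_eventuallyEq ?_
  · simp only [add_apply, hA', sub_apply, smul_apply, smul_eq_mul] at heq ⊢
    rw [chartMetric_comm q _ W] at heq
    have h2 : D = (N (s, t))⁻¹ * (N (s, t) * D) := by field_simp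
    have h3 : N (s, t) * D = metricGrad q (X (s, t)) (fderiv ℝ X (s, t) (0, 1))
        (fderiv ℝ X (s, t) (1, 0)) + chartMetric q (X (s, t)) (fderiv ℝ X (s, t) (0, 1))
        W := by
      norm_num at heq
      linarith
    rw [h2, h3]
    ring
  · exact Eventually.of_forall fun r => by simp

/-- The momentum of a curve in the chart around `q`, with respect to the length functional. -/
def momentum (c : ℝ → M) (q : M) (t : ℝ) : 𝔼 n →L[ℝ] ℝ :=
  (speed (n := n) c t)⁻¹ • chartMetric q (extChartAt (𝓡 n) q (c t)) (coord q (velocity c t))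

/-- The force acting on a curve in the chart around `q`. -/
def force (c : ℝ → M) (q : M) (t : ℝ) : 𝔼 n →L[ℝ] ℝ :=
  (speed (n := n) c t)⁻¹ • metricGrad q (extChartAt (𝓡 n) q (c t)) (coord q (velocity c t))

/-- The curve `c` satisfies the geodesic equation at time `t`. -/
def IsGeodesicAt (n : ℕ) {M : Type*} [TopologicalSpace M]
    [ChartedSpace (EuclideanSpace ℝ (Fin n)) M] [IsManifold (𝓡 n) ∞ M]
    [RiemannianBundle (fun x : M => TangentSpace (𝓡 n) x)] (c : ℝ → M) (t : ℝ) : Prop :=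
  ∀ q : M, c t ∈ (chartAt (𝔼 n) q).source →
    HasDerivWithinAt (momentum (n := n) c q) (force c q t) (Icc 0 1) t

/-- The inner product of the unit tangent vector and the variation field. -/
def pairing (n : ℕ) {M : Type*} [TopologicalSpace M]
    [ChartedSpace (EuclideanSpace ℝ (Fin n)) M] [IsManifold (𝓡 n) ∞ M]
    [RiemannianBundle (fun x : M => TangentSpace (𝓡 n) x)] (F : ℝ → ℝ → M) (t : ℝ) : ℝ :=
  (speed (n := n) (F 0) t)⁻¹ * inner ℝ (E := TangentSpace (𝓡 n) (F 0 t))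
    (velocity (n := n) (F 0) t).snd (variationField (n := n) F t).snd

variable {F : ℝ → ℝ → M} {δ : ℝ} {z : ℝ × ℝ} {q : M}

lemma pairing_eq {t : ℝ} (hq : F 0 t ∈ (chartAt (𝔼 n) q).source) :
    pairing n F t = momentum (n := n) (F 0) q t (coord q (variationField F t)) := by
  rw [pairing, momentum, smul_apply, smul_eq_mul]
  congr 1
  exact (chartMetric_extChartAt hq _ _).symm

lemma continuousOn_pairing (hδ : 0 < δ)
    (hF : ContMDiffOn 𝓘(ℝ, ℝ × ℝ) (𝓡 n) 2 (fun z : ℝ × ℝ => F z.1 z.2) (strip δ))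
    (hi : ∀ z ∈ strip δ, speed (n := n) (F z.1) z.2 ≠ 0) :
    ContinuousOn (pairing n F) (Icc 0 1) := by
  intro t ht
  have hz := zero_mem_strip hδ ht
  obtain ⟨q, hqz⟩ : ∃ q, q = F 0 t := ⟨_, rfl⟩
  have hq : F 0 t ∈ (chartAt (𝔼 n) q).source := hqz ▸ mem_chart_source _ _
  have hX := contDiffWithinAt_inChart hF hz hq
  have hG : ContinuousWithinAt (fun w => chartMetric (n := n) q (inChart n q F w)) (strip δ) (0, t) :=
    ContinuousAt.comp_continuousWithinAt (g := chartMetric (n := n) q)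
      (contDiffAt_chartMetric (mem_target hq)).continuousAt hX.continuousWithinAt
  have hT : ∀ e, ContinuousWithinAt
      (fun w => fderivWithin ℝ (inChart n q F) (strip δ) w e) (strip δ) (0, t) := fun e =>
    ((hX.fderivWithin_right (uniqueDiffOn_strip δ) (m := 1) (by norm_num) hz).clm_apply
      contDiffWithinAt_const).continuousWithinAt
  have hN := (contDiffOn_speed hF hi).continuousOn (0, t) hz
  have hprod := (hN.inv₀ (hi _ hz)).mul (((hG.clm_apply (hT (0, 1))).clm_apply (hT (1, 0))))
  have hin : ContinuousWithinAt (fun τ : ℝ => ((0 : ℝ), τ)) (Icc 0 1) t := by fun_prop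
  have hmaps : MapsTo (fun τ : ℝ => ((0 : ℝ), τ)) (Icc 0 1) (strip δ) :=
    fun τ hτ => zero_mem_strip hδ hτ
  refine (hprod.comp hin hmaps).congr_of_eventuallyEq ?_ ?_
  · filter_upwards [(hin.tendsto_nhdsWithin hmaps).eventually (eventually_mem_source hF hz hq),
      self_mem_nhdsWithin] with τ hτ hτ'
    rw [pairing_eq hτ.2, coord_variationField hδ hF hτ' hτ.2, momentum,
      coord_velocity_slice (z := (0, τ)) hF hτ.1 hτ.2]
    rfl
  · rw [pairing_eq hq, coord_variationField hδ hF ht hq, momentum,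
      coord_velocity_slice (z := (0, t)) hF hz hq]
    rfl

lemma hasDerivAt_pairing (hδ : 0 < δ)
    (hF : ContMDiffOn 𝓘(ℝ, ℝ × ℝ) (𝓡 n) 2 (fun z : ℝ × ℝ => F z.1 z.2) (strip δ))
    (hi : ∀ z ∈ strip δ, speed (n := n) (F z.1) z.2 ≠ 0) {t : ℝ} (ht : t ∈ Ioo (0 : ℝ) 1)
    (hq : F 0 t ∈ (chartAt (𝔼 n) q).source) {ξ : 𝔼 n →L[ℝ] ℝ}
    (hξ : HasDerivWithinAt (momentum (n := n) (F 0) q) ξ (Icc 0 1) t) :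
    HasDerivAt (pairing n F) (deriv (fun s => speed (n := n) (F s) t) 0 -
      (force (n := n) (F 0) q t - ξ) (coord q (variationField F t))) t := by
  have ht' := Ioo_subset_Icc_self ht
  have hz := zero_mem_strip hδ ht'
  have hnb : strip δ ∈ 𝓝 ((0 : ℝ), t) :=
    prod_mem_nhds (Ioo_mem_nhds (by linarith) hδ) (Icc_mem_nhds ht.1 ht.2)
  have hX := (contDiffWithinAt_inChart hF hz hq).contDiffAt hnb
  have hmem : ∀ᶠ w in 𝓝 ((0 : ℝ), t), w ∈ strip δ ∧ F w.1 w.2 ∈ (chartAt (𝔼 n) q).source ∧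
      fderivWithin ℝ (inChart n q F) (strip δ) w = fderiv ℝ (inChart n q F) w := by
    have h1 := eventually_mem_source hF hz hq
    rw [nhdsWithin_eq_nhds.2 hnb] at h1
    filter_upwards [h1, eventually_mem_nhds_iff.2 hnb] with w hw hw'
    exact ⟨hw.1, hw.2, fderivWithin_of_mem_nhds hw'⟩
  have hin : Tendsto (fun τ : ℝ => ((0 : ℝ), τ)) (𝓝 t) (𝓝 (0, t)) :=
    (Continuous.prodMk_right (0 : ℝ)).tendsto t
  have hN := ((contDiffOn_speed hF hi).contDiffAt hnb).differentiableAt (by norm_num)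
  have hs : HasDerivAt (fun r : ℝ => (r, t)) ((1 : ℝ), (0 : ℝ)) 0 :=
    (hasDerivAt_id _).prodMk (hasDerivAt_const _ _)
  have hD := (hN.hasFDerivAt.comp_hasDerivAt (0 : ℝ) hs).differentiableAt.hasDerivAt
  have hmom : ∀ τ, (0, τ) ∈ strip δ → F 0 τ ∈ (chartAt (𝔼 n) q).source →
      fderivWithin ℝ (inChart n q F) (strip δ) (0, τ) = fderiv ℝ (inChart n q F) (0, τ) →
      coord q (velocity (F 0) τ) = fderiv ℝ (inChart n q F) (0, τ) (0, 1) ∧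
      coord q (variationField F τ) = fderiv ℝ (inChart n q F) (0, τ) (1, 0) := by
    intro τ h1 h2 h3
    rw [← h3]
    exact ⟨coord_velocity_slice (z := (0, τ)) hF h1 h2, coord_variationField hδ hF h1.2 h2⟩
  have hξ' : HasDerivAt (fun r => (speed (n := n) (F 0) r)⁻¹ •
      chartMetric q (inChart n q F (0, r)) (fderiv ℝ (inChart n q F) (0, r) (0, 1))) ξ t := by
    refine (hξ.hasDerivAt (Icc_mem_nhds ht.1 ht.2)).congr_of_eventuallyEq ?_
    filter_upwards [hin.eventually hmem] with τ hτ
    rw [momentum, (hmom τ hτ.1 hτ.2.1 hτ.2.2).1]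
    rfl
  have key := hasDerivAt_pairing_chart (q := q) (X := inChart n q F)
    (N := fun z => speed (n := n) (F z.1) z.2) hX (mem_target hq) (by
      filter_upwards [hmem] with w hw
      rw [speed_sq hw.2.1, coord_velocity_slice hF hw.1 hw.2.1, hw.2.2]
      rfl) (hi _ hz) hD hξ'
  have h0 := hmom t hmem.self_of_nhds.1 hq hmem.self_of_nhds.2.2
  rw [force, h0.1, h0.2]
  refine key.congr_of_eventuallyEq ?_
  filter_upwards [hin.eventually hmem] with τ hτ
  have h1 := hmom τ hτ.1 hτ.2.1 hτ.2.2
  rw [pairing_eq hτ.2.1, momentum, h1.1, h1.2]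
  rfl

/-- The first variation formula. -/
theorem hasDerivAt_length_eq (hδ : 0 < δ)
    (hF : ContMDiffOn 𝓘(ℝ, ℝ × ℝ) (𝓡 n) 2 (fun z : ℝ × ℝ => F z.1 z.2) (strip δ))
    (hi : ∀ z ∈ strip δ, speed (n := n) (F z.1) z.2 ≠ 0) {d : ℝ → ℝ}
    (hd : IntervalIntegrable d MeasureTheory.volume 0 1)
    (h : ∀ t ∈ Ioo (0 : ℝ) 1, ∃ (q : M) (ξ : 𝔼 n →L[ℝ] ℝ), F 0 t ∈ (chartAt (𝔼 n) q).source ∧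
      HasDerivWithinAt (momentum (n := n) (F 0) q) ξ (Icc 0 1) t ∧
      d t = (force (n := n) (F 0) q t - ξ) (coord q (variationField F t))) :
    HasDerivAt (fun s => (pathELength (𝓡 n) (F s) 0 1).toReal)
      (pairing n F 1 - pairing n F 0 + ∫ t in (0 : ℝ)..1, d t) 0 := by
  obtain ⟨hI, hL⟩ := hasDerivAt_length hδ hF hi
  -- The s-derivative of the speed minus d is the t-derivative of the pairing. The chart may vary
  -- with t, because neither the pairing nor d refers to one.
  have hftc := intervalIntegral.integral_eq_sub_of_hasDerivAt_of_le zero_le_one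
    (continuousOn_pairing hδ hF hi) (f' := fun t => deriv (fun s => speed (n := n) (F s) t) 0 - d t)
    (fun t ht => by
      obtain ⟨q, ξ, hq, hξ, hdt⟩ := h t ht
      rw [hdt]
      exact hasDerivAt_pairing hδ hF hi ht hq hξ) (hI.sub hd)
  rw [intervalIntegral.integral_sub hI hd] at hftc
  rw [← hftc]
  simpa using hL

end

/-! ### Variations supported in a chart -/

section

open WeightedMultigraph

variable {G : WeightedMultigraph} {f : G.Realization → M} {δ : ℝ}

open Classical in
/-- The variation of `f` with the variation field `η`, in the chart around `q`. -/
def push (f : G.Realization → M) (q : M) (η : G.Realization → 𝔼 n) (s : ℝ)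
    (z : G.Realization) : M :=
  if η z = 0 then f z else (extChartAt (𝓡 n) q).symm (extChartAt (𝓡 n) q (f z) + s • η z)

variable {q : M} {η : G.Realization → 𝔼 n} {s : ℝ} {z : G.Realization}

lemma push_of_eq_zero (h : η z = 0) : push f q η s z = f z := if_pos h

lemma push_of_mem (h : f z ∈ (chartAt (𝔼 n) q).source) :
    push f q η s z = (extChartAt (𝓡 n) q).symm (extChartAt (𝓡 n) q (f z) + s • η z) := by
  by_cases h0 : η z = 0
  · rw [push_of_eq_zero h0, h0, smul_zero, add_zero,
      (extChartAt (𝓡 n) q).left_inv (by simpa using h)]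
  · exact if_neg h0

lemma push_zero (hη : tsupport η ⊆ f ⁻¹' (chartAt (𝔼 n) q).source) : push f q η 0 = f := by
  ext z
  by_cases h0 : η z = 0
  · exact push_of_eq_zero h0
  · have h : f z ∈ (chartAt (𝔼 n) q).source := hη (subset_tsupport η h0)
    rw [push_of_mem h, zero_smul, add_zero, (extChartAt (𝓡 n) q).left_inv (by simpa using h)]

/-- Compactness of the support gives one bound on s for all points; points off the support do not
move. -/
lemma eventually_push_mem_target (hf : Continuous f) (hη : Continuous η)
    (hs : tsupport η ⊆ f ⁻¹' (chartAt (𝔼 n) q).source) :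
    ∀ᶠ s in 𝓝 (0 : ℝ), ∀ z, f z ∈ (chartAt (𝔼 n) q).source →
      extChartAt (𝓡 n) q (f z) + s • η z ∈ (extChartAt (𝓡 n) q).target := by
  have hK : IsCompact (tsupport η) := (isClosed_tsupport η).isCompact
  have key : ∀ᶠ s in 𝓝 (0 : ℝ), ∀ z ∈ tsupport η,
      extChartAt (𝓡 n) q (f z) + s • η z ∈ (extChartAt (𝓡 n) q).target := by
    refine hK.eventually_forall_of_forall_eventually fun z hz => ?_
    have h1 : ContinuousAt (fun w : ℝ × G.Realization => extChartAt (𝓡 n) q (f w.2) + w.1 • η w.2)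
        (0, z) := by
      have h2 : ContinuousAt (extChartAt (𝓡 n) q) (f z) :=
        continuousAt_extChartAt' (by simpa using hs hz)
      have h3 : ContinuousAt (fun w : ℝ × G.Realization => extChartAt (𝓡 n) q (f w.2)) (0, z) :=
        ContinuousAt.comp (g := extChartAt (𝓡 n) q) (f := fun w : ℝ × G.Realization => f w.2) h2
          (hf.comp continuous_snd).continuousAt
      exact h3.add (by fun_prop)
    refine h1.eventually_mem ((isOpen_target q).mem_nhds ?_)
    simpa using mem_target (hs hz)
  filter_upwards [key] with s hs z hz
  by_cases h0 : η z = 0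
  · simpa [h0] using mem_target hz
  · exact hs z (subset_tsupport η h0)

/-- Near a point sent into the chart domain the formula in coordinates is valid everywhere; any
other point is off the closed support, where the map stays equal to f. -/
lemma continuousAt_push (hf : Continuous f) (hη : Continuous η)
    (hs : tsupport η ⊆ f ⁻¹' (chartAt (𝔼 n) q).source)
    (ht : f z ∈ (chartAt (𝔼 n) q).source →
      extChartAt (𝓡 n) q (f z) + s • η z ∈ (extChartAt (𝓡 n) q).target) :
    ContinuousAt (fun w : ℝ × G.Realization => push f q η w.1 w.2) (s, z) := by
  by_cases hz : f z ∈ (chartAt (𝔼 n) q).source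
  · have h2 : ContinuousAt (extChartAt (𝓡 n) q) (f z) :=
      continuousAt_extChartAt' (by simpa using hz)
    have h3 : ContinuousAt (fun w : ℝ × G.Realization => extChartAt (𝓡 n) q (f w.2)) (s, z) :=
      ContinuousAt.comp (g := extChartAt (𝓡 n) q) (f := fun w : ℝ × G.Realization => f w.2) h2
        (hf.comp continuous_snd).continuousAt
    have h4 : ContinuousAt (fun w : ℝ × G.Realization =>
        extChartAt (𝓡 n) q (f w.2) + w.1 • η w.2) (s, z) := h3.add (by fun_prop)
    have h5 : ContinuousAt (fun w : ℝ × G.Realization => (extChartAt (𝓡 n) q).symm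
        (extChartAt (𝓡 n) q (f w.2) + w.1 • η w.2)) (s, z) :=
      ContinuousAt.comp (g := (extChartAt (𝓡 n) q).symm)
        (continuousAt_extChartAt_symm'' (ht hz)) h4
    refine h5.congr ?_
    have hopen : IsOpen ((fun w : ℝ × G.Realization => f w.2) ⁻¹' (chartAt (𝔼 n) q).source) :=
      (chartAt (𝔼 n) q).open_source.preimage (hf.comp continuous_snd)
    filter_upwards [hopen.mem_nhds hz] with w hw
    exact (push_of_mem hw).symm
  · have hz' : z ∈ (tsupport η)ᶜ := fun h => hz (hs h)
    refine (hf.comp continuous_snd).continuousAt.congr ?_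
    filter_upwards [(((isClosed_tsupport η).isOpen_compl).preimage continuous_snd).mem_nhds hz']
      with w hw
    exact (push_of_eq_zero (by_contra fun h => hw (subset_tsupport η h))).symm

lemma contMDiffWithinAt_push (hf : IsNet (n := n) f)
    (hη : ∀ e, ContDiffOn ℝ 2 (edgePath η e) (Icc 0 1))
    (hs : tsupport η ⊆ f ⁻¹' (chartAt (𝔼 n) q).source) (e : G.E) {w : ℝ × ℝ} (hw : w ∈ strip δ)
    (ht : edgePath f e w.2 ∈ (chartAt (𝔼 n) q).source →
      extChartAt (𝓡 n) q (edgePath f e w.2) + w.1 • edgePath η e w.2 ∈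
        (extChartAt (𝓡 n) q).target) :
    ContMDiffWithinAt 𝓘(ℝ, ℝ × ℝ) (𝓡 n) 2 (fun w : ℝ × ℝ => edgePath (push f q η w.1) e w.2)
      (strip δ) w := by
  have hmaps : MapsTo (Prod.snd : ℝ × ℝ → ℝ) (strip δ) (Icc 0 1) := fun w hw => hw.2
  have hfst : ContMDiffWithinAt 𝓘(ℝ, ℝ × ℝ) 𝓘(ℝ, ℝ) 2 (Prod.fst : ℝ × ℝ → ℝ) (strip δ) w :=
    contMDiffWithinAt_iff_contDiffWithinAt.2 contDiffWithinAt_fst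
  have hsnd : ContMDiffWithinAt 𝓘(ℝ, ℝ × ℝ) 𝓘(ℝ, ℝ) 2 (Prod.snd : ℝ × ℝ → ℝ) (strip δ) w :=
    contMDiffWithinAt_iff_contDiffWithinAt.2 contDiffWithinAt_snd
  have hc : ContMDiffWithinAt 𝓘(ℝ, ℝ × ℝ) (𝓡 n) 2 (fun w : ℝ × ℝ => edgePath f e w.2) (strip δ) w :=
    ContMDiffWithinAt.comp (g := edgePath f e) w (hf.contMDiffOn e w.2 hw.2) hsnd hmaps
  have hcont : Continuous (fun w : ℝ × ℝ => edgePath f e w.2) :=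
    (continuous_edgePath hf.continuous e).comp continuous_snd
  have hpt : Continuous (fun w : ℝ × ℝ => G.edgePt e (projIcc 0 1 zero_le_one w.2)) :=
    (continuous_edgePt e).comp (continuous_projIcc.comp continuous_snd)
  by_cases hz : edgePath f e w.2 ∈ (chartAt (𝔼 n) q).source
  · have h1 : ContMDiffAt (𝓡 n) 𝓘(ℝ, 𝔼 n) 2 (extChartAt (𝓡 n) q) (edgePath f e w.2) :=
      (contMDiffAt_extChartAt' (n := ∞) hz).of_le (WithTop.coe_le_coe.2 (le_top : (2 : ℕ∞) ≤ ⊤))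
    have h2 : ContDiffWithinAt ℝ 2 (fun w : ℝ × ℝ => extChartAt (𝓡 n) q (edgePath f e w.2))
        (strip δ) w := contMDiffWithinAt_iff_contDiffWithinAt.1 (h1.comp_contMDiffWithinAt w hc)
    have h3 : ContDiffWithinAt ℝ 2 (fun w : ℝ × ℝ => edgePath η e w.2) (strip δ) w :=
      ContDiffWithinAt.comp (g := edgePath η e) w (hη e w.2 hw.2) contDiffWithinAt_snd hmaps
    have h4 := h2.add (contDiffWithinAt_fst.smul h3)
    have h5 : ContMDiffAt 𝓘(ℝ, 𝔼 n) (𝓡 n) 2 (extChartAt (𝓡 n) q).symm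
        (extChartAt (𝓡 n) q (edgePath f e w.2) + w.1 • edgePath η e w.2) :=
      ((contMDiffOn_extChartAt_symm (n := ∞) q).contMDiffAt
        ((isOpen_target q).mem_nhds (ht hz))).of_le (WithTop.coe_le_coe.2 (le_top : (2 : ℕ∞) ≤ ⊤))
    have h6 := ContMDiffAt.comp_contMDiffWithinAt w (f := fun w : ℝ × ℝ =>
      extChartAt (𝓡 n) q (edgePath f e w.2) + w.1 • edgePath η e w.2) h5
        (contMDiffWithinAt_iff_contDiffWithinAt.2 h4)
    refine h6.congr_of_eventuallyEq ?_ (push_of_mem hz)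
    filter_upwards [mem_nhdsWithin_of_mem_nhds
      (((chartAt (𝔼 n) q).open_source.preimage hcont).mem_nhds hz)] with w hw
    exact push_of_mem hw
  · have hz' : G.edgePt e (projIcc 0 1 zero_le_one w.2) ∈ (tsupport η)ᶜ := fun h => hz (hs h)
    have hnot : ∀ {z}, z ∈ (tsupport η)ᶜ → η z = 0 := fun hz =>
      by_contra fun h => hz (subset_tsupport η h)
    refine hc.congr_of_eventuallyEq ?_ (push_of_eq_zero (hnot hz'))
    filter_upwards [mem_nhdsWithin_of_mem_nhds
      (((isClosed_tsupport η).isOpen_compl.preimage hpt).mem_nhds hz')] with w hw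
    exact push_of_eq_zero (hnot hw)

lemma strip_mono {δ δ' : ℝ} (h : δ ≤ δ') : strip δ ⊆ strip δ' :=
  prod_mono (Ioo_subset_Ioo (neg_le_neg h) h) subset_rfl

/-- A variation field supported in a chart gives rise to a one-parameter family of nets. -/
theorem exists_isNetFamily_push (hf : IsNet (n := n) f) (hηc : Continuous η)
    (hη : ∀ e, ContDiffOn ℝ 2 (edgePath η e) (Icc 0 1))
    (hs : tsupport η ⊆ f ⁻¹' (chartAt (𝔼 n) q).source) :
    ∃ δ > 0, IsNetFamily (n := n) f δ (push f q η) ∧ ∀ s ∈ Ioo (-δ) δ, ∀ z,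
      f z ∈ (chartAt (𝔼 n) q).source →
      extChartAt (𝓡 n) q (f z) + s • η z ∈ (extChartAt (𝓡 n) q).target := by
  obtain ⟨δ₀, hδ₀, H₀⟩ := Metric.eventually_nhds_iff_ball.1
    (eventually_push_mem_target hf.continuous hηc hs)
  rw [Real.ball_zero_eq_Ioo] at H₀
  have hsm : ∀ e, ContMDiffOn 𝓘(ℝ, ℝ × ℝ) (𝓡 n) 2
      (fun w : ℝ × ℝ => edgePath (push f q η w.1) e w.2) (strip δ₀) := fun e w hw =>
    contMDiffWithinAt_push hf hη hs e hw fun hz => H₀ w.1 hw.1 _ hz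
  have hev : ∀ e, ∀ᶠ s in 𝓝 (0 : ℝ), ∀ t ∈ Icc (0 : ℝ) 1, (s, t) ∈ strip δ₀ →
      speed (n := n) (edgePath (push f q η s) e) t ≠ 0 := by
    intro e
    refine isCompact_Icc.eventually_forall_of_forall_eventually fun t ht => ?_
    -- The squared speed is continuous without knowing that the moved edges are immersed, and it is
    -- nonzero for s = 0.
    have hc := (contDiffOn_speed_sq (F := fun s => edgePath (push f q η s) e)
      (hsm e)).continuousOn (0, t) (zero_mem_strip hδ₀ ht)
    have h0 : speed (n := n) (edgePath (push f q η 0) e) t ^ 2 ≠ 0 := by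
      rw [push_zero hs]
      exact pow_ne_zero 2 (speed_ne_zero_iff.2 (hf.immersion e t ht))
    have h1 := eventually_nhdsWithin_iff.1 (hc.eventually_ne h0)
    filter_upwards [h1] with w hw hws h
    exact hw hws (by rw [h]; norm_num)
  obtain ⟨δ₁, hδ₁, H₁⟩ := Metric.eventually_nhds_iff_ball.1 (eventually_all.2 hev)
  rw [Real.ball_zero_eq_Ioo] at H₁
  refine ⟨min δ₀ δ₁, lt_min hδ₀ hδ₁, ⟨push_zero hs, ?_, ?_, ?_⟩, ?_⟩
  · rintro ⟨s, z⟩ ⟨hs', -⟩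
    exact (continuousAt_push hf.continuous hηc hs fun hz => H₀ s
      (Ioo_subset_Ioo (neg_le_neg (min_le_left _ _)) (min_le_left _ _) hs') z hz).continuousWithinAt
  · intro s hs'
    have hs₀ := Ioo_subset_Ioo (neg_le_neg (min_le_left _ _)) (min_le_left _ _) hs'
    have hs₁ := Ioo_subset_Ioo (neg_le_neg (min_le_right _ _)) (min_le_right _ _) hs'
    refine ⟨?_, fun e => ?_, fun e t ht => ?_⟩
    · refine continuous_iff_continuousAt.2 fun z => ?_
      exact ContinuousAt.comp (g := fun w : ℝ × G.Realization => push f q η w.1 w.2)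
        (f := fun z => (s, z)) (continuousAt_push hf.continuous hηc hs fun hz => H₀ s hs₀ z hz)
        (by fun_prop)
    · have h1 : ContMDiffOn 𝓘(ℝ, ℝ) 𝓘(ℝ, ℝ × ℝ) 2 (fun t : ℝ => (s, t)) (Icc 0 1) :=
        contMDiffOn_iff_contDiffOn.2 (by fun_prop)
      exact ContMDiffOn.comp (I' := 𝓘(ℝ, ℝ × ℝ)) (t := strip δ₀)
        (g := fun w : ℝ × ℝ => edgePath (push f q η w.1) e w.2) (hsm e) h1 fun t ht => ⟨hs₀, ht⟩
    · exact speed_ne_zero_iff.1 (H₁ s hs₁ e t ht ⟨hs₀, ht⟩)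
  · exact fun e => (hsm e).mono (strip_mono (min_le_left _ _))
  · exact fun s hs' z hz => H₀ s
      (Ioo_subset_Ioo (neg_le_neg (min_le_left _ _)) (min_le_left _ _) hs') z hz

end

/-! ### Regularity along edges and the defect of the geodesic equation -/

section

section Curve

variable {c : ℝ → M} {q : M} {t : ℝ}

lemma contDiffWithinAt_extChartAt_comp (hc : ContMDiffOn 𝓘(ℝ, ℝ) (𝓡 n) 2 c (Icc 0 1))
    (ht : t ∈ Icc (0 : ℝ) 1) (hq : c t ∈ (chartAt (𝔼 n) q).source) :
    ContDiffWithinAt ℝ 2 (fun τ => extChartAt (𝓡 n) q (c τ)) (Icc 0 1) t := by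
  rw [← contMDiffWithinAt_iff_contDiffWithinAt]
  have h1 : ContMDiffAt (𝓡 n) 𝓘(ℝ, 𝔼 n) 2 (extChartAt (𝓡 n) q) (c t) :=
    (contMDiffAt_extChartAt' (n := ∞) hq).of_le (WithTop.coe_le_coe.2 (le_top : (2 : ℕ∞) ≤ ⊤))
  exact h1.comp_contMDiffWithinAt t (hc t ht)

lemma contDiffWithinAt_coord_velocity (hc : ContMDiffOn 𝓘(ℝ, ℝ) (𝓡 n) 2 c (Icc 0 1))
    (ht : t ∈ Icc (0 : ℝ) 1) (hq : c t ∈ (chartAt (𝔼 n) q).source) :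
    ContDiffWithinAt ℝ 1 (fun τ => coord (n := n) q (velocity c τ)) (Icc 0 1) t := by
  have hX := contDiffWithinAt_extChartAt_comp hc ht hq
  have hT : ContDiffWithinAt ℝ 1 (fun τ => fderivWithin ℝ
      (fun τ => extChartAt (𝓡 n) q (c τ)) (Icc 0 1) τ 1) (Icc 0 1) t :=
    (hX.fderivWithin_right uniqueDiffOn_Icc_zero_one (by norm_num) ht).clm_apply
      contDiffWithinAt_const
  have key : ∀ τ ∈ Icc (0 : ℝ) 1, c τ ∈ (chartAt (𝔼 n) q).source → coord q (velocity c τ) =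
      fderivWithin ℝ (fun τ => extChartAt (𝓡 n) q (c τ)) (Icc 0 1) τ 1 := fun τ hτ hτq =>
    ((hasDerivWithinAt_velocity ((hc τ hτ).mdifferentiableWithinAt (by norm_num))
      hτq).derivWithin (uniqueDiffOn_Icc_zero_one τ hτ)).symm
  refine hT.congr_of_eventuallyEq ?_ (key t ht hq)
  filter_upwards [self_mem_nhdsWithin, (hc t ht).continuousWithinAt
    ((chartAt (𝔼 n) q).open_source.mem_nhds hq)] with τ h1 h2 using key τ h1 h2

lemma contDiffOn_speed_curve (hc : ContMDiffOn 𝓘(ℝ, ℝ) (𝓡 n) 2 c (Icc 0 1))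
    (hi : ∀ t ∈ Icc (0 : ℝ) 1, speed (n := n) c t ≠ 0) :
    ContDiffOn ℝ 1 (speed (n := n) c) (Icc 0 1) := by
  -- The curve is regarded as a constant family, to which the regularity of the speed of families
  -- applies.
  have hF : ContMDiffOn 𝓘(ℝ, ℝ × ℝ) (𝓡 n) 2 (fun z : ℝ × ℝ => c z.2) (strip 1) :=
    ContMDiffOn.comp (g := c) hc (contMDiffOn_iff_contDiffOn.2 contDiffOn_snd) fun z hz => hz.2
  have h := contDiffOn_speed (F := fun _ => c) hF fun z hz => hi z.2 hz.2
  exact h.comp (f := fun t : ℝ => ((0 : ℝ), t)) (by fun_prop)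
    fun t ht => zero_mem_strip one_pos ht

lemma contDiffWithinAt_momentum (hc : ContMDiffOn 𝓘(ℝ, ℝ) (𝓡 n) 2 c (Icc 0 1))
    (hi : ∀ t ∈ Icc (0 : ℝ) 1, speed (n := n) c t ≠ 0) (ht : t ∈ Icc (0 : ℝ) 1)
    (hq : c t ∈ (chartAt (𝔼 n) q).source) :
    ContDiffWithinAt ℝ 1 (momentum (n := n) c q) (Icc 0 1) t := by
  have hG : ContDiffWithinAt ℝ 1 (fun τ => chartMetric (n := n) q (extChartAt (𝓡 n) q (c τ)))
      (Icc 0 1) t :=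
    ((contDiffAt_chartMetric (mem_target hq)).comp_contDiffWithinAt t
      (contDiffWithinAt_extChartAt_comp hc ht hq)).of_le (by norm_num)
  exact ((contDiffOn_speed_curve hc hi t ht).inv (hi t ht)).smul
    (hG.clm_apply (contDiffWithinAt_coord_velocity hc ht hq))

lemma continuousWithinAt_force (hc : ContMDiffOn 𝓘(ℝ, ℝ) (𝓡 n) 2 c (Icc 0 1))
    (hi : ∀ t ∈ Icc (0 : ℝ) 1, speed (n := n) c t ≠ 0) (ht : t ∈ Icc (0 : ℝ) 1)
    (hq : c t ∈ (chartAt (𝔼 n) q).source) :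
    ContinuousWithinAt (force (n := n) c q) (Icc 0 1) t := by
  have h1 : ContinuousWithinAt
      (fun τ => (extChartAt (𝓡 n) q (c τ), coord (n := n) q (velocity c τ)))
      (Icc 0 1) t := (contDiffWithinAt_extChartAt_comp hc ht hq).continuousWithinAt.prodMk
    (contDiffWithinAt_coord_velocity hc ht hq).continuousWithinAt
  have h2 : ContinuousAt (fun z : 𝔼 n × 𝔼 n => metricGrad q z.1 z.2)
      (extChartAt (𝓡 n) q (c t), coord q (velocity c t)) :=
    (contDiffAt_metricGrad (z := (extChartAt (𝓡 n) q (c t), coord q (velocity c t)))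
      (mem_target hq)).continuousAt
  exact ((contDiffOn_speed_curve hc hi).continuousOn t ht |>.inv₀ (hi t ht)).smul
    (h2.comp_continuousWithinAt (f := fun τ => (extChartAt (𝓡 n) q (c τ), coord q (velocity c τ)))
      h1)

/-- The difference of the force and the derivative of the momentum. -/
def defect (c : ℝ → M) (q : M) (t : ℝ) : 𝔼 n →L[ℝ] ℝ :=
  force (n := n) c q t - derivWithin (momentum (n := n) c q) (Icc 0 1) t

lemma hasDerivWithinAt_momentum (hc : ContMDiffOn 𝓘(ℝ, ℝ) (𝓡 n) 2 c (Icc 0 1))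
    (hi : ∀ t ∈ Icc (0 : ℝ) 1, speed (n := n) c t ≠ 0) (ht : t ∈ Icc (0 : ℝ) 1)
    (hq : c t ∈ (chartAt (𝔼 n) q).source) :
    HasDerivWithinAt (momentum (n := n) c q) (derivWithin (momentum (n := n) c q) (Icc 0 1) t)
      (Icc 0 1) t :=
  ((contDiffWithinAt_momentum hc hi ht hq).differentiableWithinAt
    (by norm_num)).hasDerivWithinAt

lemma continuousWithinAt_defect (hc : ContMDiffOn 𝓘(ℝ, ℝ) (𝓡 n) 2 c (Icc 0 1))
    (hi : ∀ t ∈ Icc (0 : ℝ) 1, speed (n := n) c t ≠ 0) (ht : t ∈ Icc (0 : ℝ) 1)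
    (hq : c t ∈ (chartAt (𝔼 n) q).source) :
    ContinuousWithinAt (defect (n := n) c q) (Icc 0 1) t := by
  refine (continuousWithinAt_force hc hi ht hq).sub ?_
  have h := ((contDiffWithinAt_momentum hc hi ht hq).fderivWithin_right (m := 0)
    uniqueDiffOn_Icc_zero_one (by norm_num) ht).continuousWithinAt
  exact h.clm_apply continuousWithinAt_const

/-- The defect is continuous up to the ends of the edge, so its vanishing inside extends to them. -/
lemma isGeodesicAt_of_defect (hc : ContMDiffOn 𝓘(ℝ, ℝ) (𝓡 n) 2 c (Icc 0 1))
    (hi : ∀ t ∈ Icc (0 : ℝ) 1, speed (n := n) c t ≠ 0) (ht : t ∈ Icc (0 : ℝ) 1)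
    (h : ∀ τ ∈ Ioo (0 : ℝ) 1, ∀ q, c τ ∈ (chartAt (𝔼 n) q).source → defect (n := n) c q τ = 0) :
    IsGeodesicAt n c t := by
  intro q hq
  have h0 : defect (n := n) c q t = 0 := by
    have hcl : t ∈ closure (Ioo (0 : ℝ) 1) := by rwa [closure_Ioo zero_ne_one]
    have hne : (𝓝[Ioo (0 : ℝ) 1] t).NeBot := mem_closure_iff_nhdsWithin_neBot.1 hcl
    have h1 := (continuousWithinAt_defect hc hi ht hq).mono Ioo_subset_Icc_self
    refine tendsto_nhds_unique h1 (tendsto_const_nhds.congr' ?_)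
    filter_upwards [self_mem_nhdsWithin, nhdsWithin_mono t Ioo_subset_Icc_self
      ((hc t ht).continuousWithinAt ((chartAt (𝔼 n) q).open_source.mem_nhds hq))] with τ h1 h2
    exact (h τ h1 q h2).symm
  rw [sub_eq_zero.1 h0]
  exact hasDerivWithinAt_momentum hc hi ht hq

end Curve

open WeightedMultigraph

variable {G : WeightedMultigraph} {f : G.Realization → M} {δ : ℝ} {F : ℝ → G.Realization → M}
  {q : M} {η : G.Realization → 𝔼 n}

/-- The family of curves which a family of nets induces on an edge. -/
def edgeFamily (F : ℝ → G.Realization → M) (e : G.E) (s t : ℝ) : M := edgePath (F s) e t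

lemma _root_.WeightedMultigraph.IsNetFamily.contMDiffOn_edge (h : IsNetFamily (n := n) f δ F)
    (e : G.E) :
    ContMDiffOn 𝓘(ℝ, ℝ × ℝ) (𝓡 n) 2 (fun z : ℝ × ℝ => edgeFamily F e z.1 z.2) (strip δ) :=
  h.contMDiffOn e

lemma _root_.WeightedMultigraph.IsNetFamily.speed_ne_zero (h : IsNetFamily (n := n) f δ F)
    (e : G.E) :
    ∀ z ∈ strip δ, speed (n := n) (edgeFamily F e z.1) z.2 ≠ 0 := fun z hz =>
  speed_ne_zero_iff.2 ((h.isNet z.1 hz.1).immersion e z.2 hz.2)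

lemma _root_.WeightedMultigraph.IsNetFamily.edgeFamily_zero (h : IsNetFamily (n := n) f δ F)
    (e : G.E) :
    edgeFamily F e 0 = edgePath f e := by
  ext t; rw [edgeFamily, h.zero]

lemma hasDerivAt_net_length {L : G.E → ℝ} (h : ∀ e, HasDerivAt (fun s =>
    (pathELength (𝓡 n) (edgeFamily F e s) 0 1).toReal) (L e) 0) :
    HasDerivAt (fun s => length n (F s)) (∑ e, (G.mult e : ℝ) * L e) 0 :=
  HasDerivAt.fun_sum fun e _ => (h e).const_mul _

lemma coord_variationField_of_const {c : ℝ → ℝ → M} {t : ℝ} {p : M} (h : ∀ s, c s t = p) :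
    coord q (variationField (n := n) c t) = 0 := by
  have key : ∀ g : ℝ → M, g = (fun _ => p) →
      coordL q (g 0) (mfderiv 𝓘(ℝ, ℝ) (𝓡 n) g 0 (1 : ℝ)) = 0 := by
    rintro g rfl
    rw [mfderiv_const]
    exact map_zero _
  exact key (fun s => c s t) (funext h)

lemma coord_variationField_push_of_eq_zero {e : G.E} {t : ℝ} {q' : M}
    (h : edgePath η e t = 0) :
    coord q' (variationField (n := n) (edgeFamily (push f q η) e) t) = 0 :=
  coord_variationField_of_const (p := edgePath f e t) fun _ => push_of_eq_zero h

/-- In the chart the variation is affine in s with direction η. -/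
lemma coord_variationField_push (hδ : 0 < δ) (h : IsNetFamily (n := n) f δ (push f q η))
    (htar : ∀ s ∈ Ioo (-δ) δ, ∀ z, f z ∈ (chartAt (𝔼 n) q).source →
      extChartAt (𝓡 n) q (f z) + s • η z ∈ (extChartAt (𝓡 n) q).target)
    {e : G.E} {t : ℝ} (ht : t ∈ Icc (0 : ℝ) 1)
    (hq : edgePath f e t ∈ (chartAt (𝔼 n) q).source) :
    coord q (variationField (n := n) (edgeFamily (push f q η) e) t) = edgePath η e t := by
  have h0 : edgeFamily (push f q η) e 0 t = edgePath f e t := by rw [h.edgeFamily_zero]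
  have h1 : HasDerivWithinAt (fun s => extChartAt (𝓡 n) q (edgeFamily (push f q η) e s t))
      (coord q (variationField (edgeFamily (push f q η) e) t)) univ 0 := by
    have := hasDerivWithinAt_extChartAt (q := q) (s := univ) (mdifferentiableAt_slice
      (h.contMDiffOn_edge e) (zero_mem_strip hδ ht)).mdifferentiableWithinAt (h0 ▸ hq)
    rwa [mfderivWithin_univ] at this
  have h2 : HasDerivAt (fun s : ℝ => extChartAt (𝓡 n) q (edgePath f e t) + s • edgePath η e t)
      (edgePath η e t) 0 := by
    simpa using ((hasDerivAt_id (0 : ℝ)).smul_const (edgePath η e t)).const_add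
      (extChartAt (𝓡 n) q (edgePath f e t))
  rw [hasDerivWithinAt_univ] at h1
  refine h1.unique (h2.congr_of_eventuallyEq ?_)
  filter_upwards [Ioo_mem_nhds (show -δ < 0 by linarith) hδ] with s hs
  have h3 : edgeFamily (push f q η) e s t = (extChartAt (𝓡 n) q).symm
      (extChartAt (𝓡 n) q (edgePath f e t) + s • edgePath η e t) := push_of_mem hq
  rw [h3]
  exact (extChartAt (𝓡 n) q).right_inv (htar s hs _ hq)

lemma pairing_of_coord_eq_zero {c : ℝ → ℝ → M} {t : ℝ}
    (h : ∀ q, coord q (variationField (n := n) c t) = 0) : pairing n c t = 0 := by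
  rw [pairing_eq (mem_chart_source _ _), h, map_zero]

lemma speed_edgePath_ne_zero (hf : IsNet (n := n) f) (e : G.E) :
    ∀ t ∈ Icc (0 : ℝ) 1, speed (n := n) (edgePath f e) t ≠ 0 := fun t ht =>
  speed_ne_zero_iff.2 (hf.immersion e t ht)

end

/-! ### Edges of stationary nets are geodesics -/

section

open WeightedMultigraph

variable {G : WeightedMultigraph} {f : G.Realization → M}

/-- The first variation formula for a variation field supported in a chart. -/
lemma hasDerivAt_length_push {q : M} {η : G.Realization → 𝔼 n} {δ : ℝ} (hf : IsNet (n := n) f)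
    (hδ : 0 < δ) (h : IsNetFamily (n := n) f δ (push f q η))
    (hs : tsupport η ⊆ f ⁻¹' (chartAt (𝔼 n) q).source)
    (htar : ∀ s ∈ Ioo (-δ) δ, ∀ z, f z ∈ (chartAt (𝔼 n) q).source →
      extChartAt (𝓡 n) q (f z) + s • η z ∈ (extChartAt (𝓡 n) q).target) (e : G.E)
    (hd : IntervalIntegrable (fun t => defect (n := n) (edgePath f e) q t (edgePath η e t))
      MeasureTheory.volume 0 1) :
    HasDerivAt (fun s => (pathELength (𝓡 n) (edgeFamily (push f q η) e s) 0 1).toReal)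
      (momentum (edgePath f e) q 1 (edgePath η e 1) - momentum (edgePath f e) q 0 (edgePath η e 0) +
        ∫ t in (0 : ℝ)..1, defect (n := n) (edgePath f e) q t (edgePath η e t)) 0 := by
  have h0 := h.edgeFamily_zero e
  have hsrc : ∀ t, edgePath η e t ≠ 0 → edgePath f e t ∈ (chartAt (𝔼 n) q).source :=
    fun t ht => hs (subset_tsupport η ht)
  have hpair : ∀ t ∈ Icc (0 : ℝ) 1, pairing n (edgeFamily (push f q η) e) t =
      momentum (edgePath f e) q t (edgePath η e t) := by
    intro t ht
    by_cases hηt : edgePath η e t = 0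
    · rw [hηt, map_zero]
      exact pairing_of_coord_eq_zero fun q' => coord_variationField_push_of_eq_zero hηt
    · have hq := hsrc t hηt
      rw [pairing_eq (q := q) (by rw [h0]; exact hq), coord_variationField_push hδ h htar ht hq, h0]
  rw [← hpair 0 (by simp), ← hpair 1 (by simp)]
  refine hasDerivAt_length_eq hδ (h.contMDiffOn_edge e) (h.speed_ne_zero e) hd fun t ht => ?_
  have ht' := Ioo_subset_Icc_self ht
  rw [h0]
  by_cases hηt : edgePath η e t = 0
  -- Where η vanishes the point may lie outside the chart around q; the chart around the point
  -- itself is used instead.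
  · refine ⟨edgePath f e t, _, mem_chart_source _ _, hasDerivWithinAt_momentum (hf.contMDiffOn e)
      (speed_edgePath_ne_zero hf e) ht' (mem_chart_source _ _), ?_⟩
    rw [coord_variationField_push_of_eq_zero hηt, hηt, map_zero, map_zero]
  · have hq := hsrc t hηt
    refine ⟨q, _, hq, hasDerivWithinAt_momentum (hf.contMDiffOn e)
      (speed_edgePath_ne_zero hf e) ht' hq, ?_⟩
    rw [coord_variationField_push hδ h htar ht' hq, defect]

open Classical in
/-- The function on the underlying space given by `g` on the edge `e₀` and zero elsewhere. -/
def extendEdge {Y : Type*} [Zero Y] (e₀ : G.E) (g : ℝ → Y) (h0 : g 0 = 0) (h1 : g 1 = 0) :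
    G.Realization → Y :=
  glueMap (fun _ => 0) (fun e t => if e = e₀ then g t else 0) (fun e => by simp [h0])
    (fun e => by simp [h1])

open Classical in
lemma extendEdge_cases {Y : Type*} [Zero Y] {e₀ : G.E} {g : ℝ → Y} {h0 : g 0 = 0} {h1 : g 1 = 0}
    {z : G.Realization} (hz : extendEdge e₀ g h0 h1 z ≠ 0) :
    ∃ t : unitInterval, z = G.edgePt e₀ t ∧ g t ≠ 0 ∧ extendEdge e₀ g h0 h1 z = g t := by
  rcases exists_vertexPt_or_edgePt z with ⟨v, rfl⟩ | ⟨e, t, rfl⟩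
  · exact absurd rfl hz
  · have h2 : extendEdge e₀ g h0 h1 (G.edgePt e t) = if e = e₀ then g t else 0 := rfl
    by_cases he : e = e₀
    · subst he
      rw [if_pos rfl] at h2
      exact ⟨t, rfl, h2 ▸ hz, h2⟩
    · rw [if_neg he] at h2
      exact absurd h2 hz

lemma extendEdge_edgePt {Y : Type*} [Zero Y] {e₀ : G.E} {g : ℝ → Y} {h0 : g 0 = 0} {h1 : g 1 = 0}
    (t : unitInterval) : extendEdge e₀ g h0 h1 (G.edgePt e₀ t) = g t :=
  if_pos rfl

open Classical in
lemma edgePath_extendEdge {Y : Type*} [Zero Y] {e₀ e : G.E} {g : ℝ → Y} {h0 : g 0 = 0}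
    {h1 : g 1 = 0} {t : ℝ} (ht : t ∈ Icc (0 : ℝ) 1) :
    edgePath (extendEdge e₀ g h0 h1) e t = if e = e₀ then g t else 0 := by
  rw [extendEdge, edgePath_glueMap ht]

/-- The edges of a stationary geodesic net are geodesics. -/
theorem isGeodesicAt_of_isStationary (hf : IsStationary (n := n) f) (e₀ : G.E) {t : ℝ}
    (ht : t ∈ Icc (0 : ℝ) 1) : IsGeodesicAt n (edgePath f e₀) t := by
  classical
  have hc := hf.isNet.contMDiffOn e₀
  have hi := speed_edgePath_ne_zero hf.isNet e₀
  refine isGeodesicAt_of_defect hc hi ht fun t₀ ht₀ q hq => ?_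
  by_contra hne
  obtain ⟨w, hw⟩ : ∃ w, 0 < defect (n := n) (edgePath f e₀) q t₀ w := by
    obtain ⟨w, hw⟩ := DFunLike.ne_iff.1 hne
    rcases lt_or_gt_of_ne hw with h | h
    · exact ⟨-w, by rw [map_neg]; exact neg_pos.2 h⟩
    · exact ⟨w, h⟩
  have hIcc : Icc (0 : ℝ) 1 ∈ 𝓝 t₀ := Icc_mem_nhds ht₀.1 ht₀.2
  have hev : ∀ᶠ τ in 𝓝 t₀, τ ∈ Ioo (0 : ℝ) 1 ∧ edgePath f e₀ τ ∈ (chartAt (𝔼 n) q).source ∧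
      0 < defect (n := n) (edgePath f e₀) q τ w := by
    refine Filter.Eventually.and (Ioo_mem_nhds ht₀.1 ht₀.2) (Filter.Eventually.and ?_ ?_)
    · exact (continuous_edgePath hf.isNet.continuous e₀).continuousAt
        ((chartAt (𝔼 n) q).open_source.mem_nhds hq)
    · have h1 := ((continuousWithinAt_defect hc hi (Ioo_subset_Icc_self ht₀) hq).clm_apply
        (continuousWithinAt_const (b := w))).continuousAt hIcc
      exact h1 (Ioi_mem_nhds hw)
  obtain ⟨ρ, hρ, hball⟩ := Metric.eventually_nhds_iff_ball.1 hev
  -- The bump b localizes the variation to an interval where the defect is positive on w. The bump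
  -- b' equals 1 on the support of b, so the closed support of η lies where β = 1 and hence over the
  -- chart domain.
  let b : ContDiffBump t₀ := ⟨ρ / 4, ρ / 2, by positivity, by linarith⟩
  let b' : ContDiffBump t₀ := ⟨ρ / 2, ρ, by positivity, by linarith⟩
  have hb : ∀ τ, b τ ≠ 0 → dist τ t₀ < ρ / 2 := fun τ h => by
    have : τ ∈ Function.support b := h
    rwa [b.support_eq] at this
  have hb' : ∀ τ, b' τ ≠ 0 → dist τ t₀ < ρ := fun τ h => by
    have : τ ∈ Function.support b' := h
    rwa [b'.support_eq] at this
  have hend : ∀ τ : ℝ, τ ∉ Ioo (0 : ℝ) 1 → b τ = 0 ∧ b' τ = 0 := fun τ hτ =>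
    ⟨by_contra fun h => hτ (hball τ ((hb τ h).trans (by linarith))).1,
      by_contra fun h => hτ (hball τ (hb' τ h)).1⟩
  have e0 := hend 0 (by simp)
  have e1 := hend 1 (by simp)
  set η : G.Realization → 𝔼 n := extendEdge e₀ (fun τ => b τ • w) (by simp [e0.1])
    (by simp [e1.1]) with hη
  set β : G.Realization → ℝ := extendEdge e₀ (fun τ => b' τ) e0.2 e1.2 with hβ
  have hηe : ∀ e, ∀ τ ∈ Icc (0 : ℝ) 1, edgePath η e τ = if e = e₀ then b τ • w else 0 :=
    fun e τ hτ => edgePath_extendEdge hτ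
  have hsm : ∀ e, ContDiffOn ℝ 2 (edgePath η e) (Icc 0 1) := by
    intro e
    refine ContDiffOn.congr ?_ (hηe e)
    by_cases he : e = e₀
    · simp only [he, if_true]
      exact (b.contDiff.smul contDiff_const).contDiffOn
    · simp only [he, if_false]
      exact contDiffOn_const
  have hηc : Continuous η := continuous_of_edges fun e => by
    have := (hsm e).continuousOn.comp_continuous continuous_subtype_val fun t : unitInterval => t.2
    exact this.congr fun t => edgePath_coe η e t
  have hβc : Continuous β := continuous_of_edges fun e => by
    by_cases he : e = e₀
    · subst he
      exact (b'.continuous.comp continuous_subtype_val).congr fun t => (extendEdge_edgePt t).symm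
    · have : (fun t : unitInterval => β (G.edgePt e t)) = fun _ => 0 := by
        ext t; exact if_neg he
      rw [this]; exact continuous_const
  have hsup : tsupport η ⊆ f ⁻¹' (chartAt (𝔼 n) q).source := by
    have h1 : tsupport η ⊆ {z | β z = 1} := by
      refine closure_minimal (fun z hz => ?_) (isClosed_eq hβc continuous_const)
      obtain ⟨τ, rfl, hτ, -⟩ := extendEdge_cases hz
      have h2 : b (τ : ℝ) ≠ 0 := fun h => hτ (by rw [h, zero_smul])
      show β _ = 1
      rw [hβ, extendEdge_edgePt]
      exact b'.one_of_mem_closedBall (hb _ h2).le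
    refine h1.trans fun z hz => ?_
    have hz : β z = 1 := hz
    obtain ⟨τ, rfl, hτ, -⟩ := extendEdge_cases (z := z) (hz.symm ▸ one_ne_zero : β z ≠ 0)
    have := (hball τ (hb' τ hτ)).2.1
    rwa [edgePath_coe] at this
  obtain ⟨δ, hδ, hfam, htar⟩ := exists_isNetFamily_push hf.isNet hηc hsm hsup
  have hdc : ∀ e, ContinuousOn (fun t => defect (n := n) (edgePath f e) q t (edgePath η e t))
      (Icc 0 1) := by
    intro e
    by_cases he : e = e₀
    · subst he
      intro τ hτ
      have hcg : ∀ r ∈ Icc (0 : ℝ) 1, defect (n := n) (edgePath f e) q r (edgePath η e r) =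
          b r * defect (n := n) (edgePath f e) q r w := fun r hr => by
        rw [hηe e r hr, if_pos rfl, map_smul, smul_eq_mul]
      refine ContinuousWithinAt.congr ?_ hcg (hcg τ hτ)
      by_cases hτq : edgePath f e τ ∈ (chartAt (𝔼 n) q).source
      · exact b.continuous.continuousWithinAt.mul
          ((continuousWithinAt_defect hc hi hτ hτq).clm_apply continuousWithinAt_const)
      -- Outside the chart domain nothing is known about the defect, but b vanishes near such times.
      · have hτb : τ ∈ (Metric.closedBall t₀ (ρ / 2))ᶜ := fun h =>
          hτq (hball τ (lt_of_le_of_lt (b := ρ / 2) h (by linarith))).2.1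
        have hz : ∀ r ∈ (Metric.closedBall t₀ (ρ / 2))ᶜ,
            b r * defect (n := n) (edgePath f e) q r w = 0 := fun r hr => by
          rw [by_contra fun h => hr (hb r h).le, zero_mul]
        refine (continuousWithinAt_const (b := (0 : ℝ))).congr_of_eventuallyEq ?_ (hz τ hτb)
        filter_upwards [mem_nhdsWithin_of_mem_nhds
          (Metric.isClosed_closedBall.isOpen_compl.mem_nhds hτb)] with r hr using hz r hr
    · refine (continuousOn_const (c := (0 : ℝ))).congr fun τ hτ => ?_
      simp only [hηe e τ hτ, if_neg he, map_zero]
  have hder := hasDerivAt_net_length (n := n) (F := push f q η) fun e =>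
    hasDerivAt_length_push hf.isNet hδ hfam hsup htar e
      (ContinuousOn.intervalIntegrable (by rw [uIcc_of_le zero_le_one]; exact hdc e))
  have h0 := (hf.critical δ hδ _ hfam).unique hder
  have hend' : ∀ e, ∀ τ ∈ Icc (0 : ℝ) 1, τ ∉ Ioo (0 : ℝ) 1 → edgePath η e τ = 0 := by
    intro e τ hτ hτ'
    rw [hηe e τ hτ, (hend τ hτ').1, zero_smul, ite_self]
  simp only [hend' _ 1 (by simp) (by simp), hend' _ 0 (by simp) (by simp), map_zero, sub_zero,
    zero_add] at h0
  -- The boundary terms vanish and only e₀ moves, so the derivative of the length is a positive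
  -- integral, against stationarity.
  rw [Finset.sum_eq_single e₀] at h0
  · have hpos : 0 < ∫ t in (0 : ℝ)..1,
        defect (n := n) (edgePath f e₀) q t (edgePath η e₀ t) := by
      refine intervalIntegral.integral_pos zero_lt_one (hdc e₀) (fun τ hτ => ?_)
        ⟨t₀, Ioo_subset_Icc_self ht₀, ?_⟩
      · rw [hηe e₀ τ (Ioc_subset_Icc_self hτ), if_pos rfl, map_smul, smul_eq_mul]
        by_cases hbτ : b τ = 0
        · rw [hbτ, zero_mul]
        · exact mul_nonneg b.nonneg (hball τ ((hb τ hbτ).trans (by linarith))).2.2.le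
      · have : b t₀ = 1 := b.one_of_mem_closedBall (by simp [b]; positivity)
        rw [hηe e₀ t₀ (Ioo_subset_Icc_self ht₀), if_pos rfl, this, one_smul]
        exact hw
    have hm : (0 : ℝ) < G.mult e₀ := by exact_mod_cast G.mult_pos e₀
    exact absurd h0 (mul_pos hm hpos).ne
  · intro e _ he
    rw [intervalIntegral.integral_congr (g := fun _ => (0 : ℝ))]
    · simp
    · intro τ hτ
      rw [uIcc_of_le zero_le_one] at hτ
      simp only [hηe e τ hτ, if_neg he, map_zero]
  · simp

end

/-! ### Balance of the tangent vectors at each point -/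

section

/-- The unit tangent vector of a curve. -/
def unitVelocity (n : ℕ) {M : Type*} [TopologicalSpace M]
    [ChartedSpace (EuclideanSpace ℝ (Fin n)) M] [IsManifold (𝓡 n) ∞ M]
    [RiemannianBundle (fun x : M => TangentSpace (𝓡 n) x)] (c : ℝ → M) (t : ℝ) :
    TangentBundle (𝓡 n) M :=
  ⟨c t, (speed (n := n) c t)⁻¹ • (velocity (n := n) c t).snd⟩

open Classical in
/-- The product with a fixed vector, of the tangent vectors at `p`. -/
def weight (p : M) (w : 𝔼 n) (x : TangentBundle (𝓡 n) M) : ℝ :=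
  if x.proj = p then chartMetric p (extChartAt (𝓡 n) p p) (coord p x) w else 0

lemma weight_revVec (p : M) (w : 𝔼 n) (x : TangentBundle (𝓡 n) M) :
    weight p w (revVec x) = -weight p w x := by
  have h : (revVec x).proj = x.proj := rfl
  unfold weight
  rw [h, coord_revVec]
  split_ifs <;> simp

lemma weight_of_ne {p : M} {w : 𝔼 n} {x : TangentBundle (𝓡 n) M} (h : x.proj ≠ p) :
    weight p w x = 0 := if_neg h

lemma coord_unitVelocity (q : M) (c : ℝ → M) (t : ℝ) :
    coord q (unitVelocity n c t) = (speed (n := n) c t)⁻¹ • coord q (velocity c t) :=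
  map_smul (coordL q (c t)) _ _

lemma momentum_eq (c : ℝ → M) (q : M) (t : ℝ) :
    momentum (n := n) c q t = chartMetric q (extChartAt (𝓡 n) q (c t))
      (coord q (unitVelocity n c t)) := by
  rw [coord_unitVelocity, map_smul, momentum]

lemma weight_unitVelocity {p : M} {c : ℝ → M} {t : ℝ} (h : c t = p) (w : 𝔼 n) :
    weight p w (unitVelocity n c t) = momentum c p t w := by
  rw [momentum_eq, h]
  exact if_pos h

lemma norm_unitVelocity {c : ℝ → M} {t : ℝ} (h : speed (n := n) c t ≠ 0) :
    ‖(unitVelocity n c t).snd‖ = 1 := by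
  have hq : c t ∈ (chartAt (𝔼 n) (c t)).source := mem_chart_source _ _
  have h1 : ‖(unitVelocity n c t).snd‖ ^ 2 = 1 := by
    rw [← chartMetric_coord_self (x := unitVelocity n c t) hq, coord_unitVelocity, map_smul,
      map_smul, smul_apply, smul_eq_mul, smul_eq_mul]
    have h2 := speed_sq (n := n) hq
    have h3 : (unitVelocity n c t).proj = c t := rfl
    rw [h3, ← h2]
    field_simp
  exact (pow_eq_one_iff_of_nonneg (norm_nonneg _) two_ne_zero).1 h1

open WeightedMultigraph

variable {G : WeightedMultigraph} {f : G.Realization → M}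

/-- The unit tangent vectors at the ends of the edges of a stationary geodesic net are balanced. -/
theorem sum_weight_eq_zero [T2Space M] (hf : IsStationary (n := n) f) (p : M) (w : 𝔼 n) :
    ∑ e, (G.mult e : ℝ) * (weight p w (unitVelocity n (edgePath f e) 1) -
      weight p w (unitVelocity n (edgePath f e) 0)) = 0 := by
  -- The positions of edge ends other than p. The bump function ψ around p avoids them, so an edge
  -- end moves, with velocity w, exactly when it lies over p; edge interiors contribute nothing
  -- because the edges are geodesics.
  set T : Set M := {x | (∃ e, edgePath f e 0 = x) ∨ ∃ e, edgePath f e 1 = x} \ {p} with hT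
  have hTfin : T.Finite := Set.Finite.sdiff ((finite_range fun e => edgePath f e 0).union
    (finite_range fun e => edgePath f e 1))
  have hTn : Tᶜ ∈ 𝓝 p := hTfin.isClosed.isOpen_compl.mem_nhds fun h => h.2 rfl
  obtain ⟨ψ, -, hψ⟩ := (SmoothBumpFunction.nhds_basis_tsupport (I := 𝓡 n) p).mem_iff.1 hTn
  set η : G.Realization → 𝔼 n := fun z => ψ (f z) • w with hη
  have hsup : tsupport η ⊆ f ⁻¹' (chartAt (𝔼 n) p).source := by
    have h1 : tsupport η ⊆ f ⁻¹' tsupport ψ := by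
      refine closure_minimal (fun z hz => ?_)
        ((isClosed_tsupport ψ).preimage hf.isNet.continuous)
      refine subset_tsupport ψ fun h => hz ?_
      show ψ (f z) • w = 0
      rw [h, zero_smul]
    exact h1.trans (preimage_mono ψ.tsupport_subset_chartAt_source)
  have hψs : ContMDiff (𝓡 n) 𝓘(ℝ, ℝ) 2 ψ :=
    ψ.contMDiff.of_le (WithTop.coe_le_coe.2 (le_top : (2 : ℕ∞) ≤ ⊤))
  have hsm : ∀ e, ContDiffOn ℝ 2 (edgePath η e) (Icc 0 1) := fun e =>
    (contMDiffOn_iff_contDiffOn.1 (hψs.comp_contMDiffOn (hf.isNet.contMDiffOn e))).smul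
      contDiffOn_const
  have hηc : Continuous η := (ψ.continuous.comp hf.isNet.continuous).smul continuous_const
  obtain ⟨δ, hδ, hfam, htar⟩ := exists_isNetFamily_push hf.isNet hηc hsm hsup
  have hdz : ∀ e, ∀ t ∈ Icc (0 : ℝ) 1,
      defect (n := n) (edgePath f e) p t (edgePath η e t) = 0 := by
    intro e t ht
    by_cases h0 : edgePath η e t = 0
    · rw [h0, map_zero]
    · have hq : edgePath f e t ∈ (chartAt (𝔼 n) p).source := hsup (subset_tsupport η h0)
      rw [defect, ((isGeodesicAt_of_isStationary hf e ht) p hq).derivWithin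
        (uniqueDiffOn_Icc_zero_one t ht), sub_self]
      rfl
  have hint : ∀ e, ∫ t in (0 : ℝ)..1,
      defect (n := n) (edgePath f e) p t (edgePath η e t) = 0 := fun e => by
    rw [intervalIntegral.integral_congr (g := fun _ => (0 : ℝ))]
    · simp
    · intro t ht
      rw [uIcc_of_le zero_le_one] at ht
      exact hdz e t ht
  have hder := hasDerivAt_net_length (n := n) (F := push f p η) fun e =>
    hasDerivAt_length_push hf.isNet hδ hfam hsup htar e
      (ContinuousOn.intervalIntegrable (by
        rw [uIcc_of_le zero_le_one]
        exact (continuousOn_const (c := (0 : ℝ))).congr (hdz e)))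
  have h0 := (hf.critical δ hδ _ hfam).unique hder
  refine Eq.trans ?_ h0.symm
  have key : ∀ e t, (∃ e', edgePath f e' 0 = edgePath f e t) ∨
      (∃ e', edgePath f e' 1 = edgePath f e t) →
      weight p w (unitVelocity n (edgePath f e) t) =
        momentum (edgePath f e) p t (edgePath η e t) := by
    intro e t het
    by_cases h : edgePath f e t = p
    · have h1 : edgePath η e t = w := by
        have : edgePath η e t = ψ (edgePath f e t) • w := rfl
        rw [this, h, ψ.eq_one, one_smul]
      rw [weight_unitVelocity h, h1]
    · have h1 : edgePath η e t = 0 := by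
        have h2 : ψ (edgePath f e t) = 0 := by
          by_contra h3
          exact hψ (subset_tsupport ψ h3) ⟨het, h⟩
        have : edgePath η e t = ψ (edgePath f e t) • w := rfl
        rw [this, h2, zero_smul]
      rw [weight_of_ne h, h1, map_zero]
  refine Finset.sum_congr rfl fun e _ => ?_
  rw [key e 1 (Or.inr ⟨e, rfl⟩), key e 0 (Or.inl ⟨e, rfl⟩), hint, add_zero]

end

/-! ### Parametrization by arclength -/

section Arclength

variable {c : ℝ → M}

lemma exists_arclength (hc : ContMDiffOn 𝓘(ℝ, ℝ) (𝓡 n) 2 c (Icc 0 1))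
    (hi : ∀ t ∈ Icc (0 : ℝ) 1, speed (n := n) c t ≠ 0) :
    ∃ σ : ℝ ≃o ℝ, σ 0 = 0 ∧ σ 1 = (pathELength (𝓡 n) c 0 1).toReal ∧
      ∀ t ∈ Icc (0 : ℝ) 1, HasDerivAt σ.symm (speed (n := n) c t)⁻¹ (σ t) := by
  -- Extending the speed by constants outside [0, 1] makes its primitive an order isomorphism of the
  -- whole line.
  set N : ℝ → ℝ := fun t => speed (n := n) c (projIcc 0 1 zero_le_one t) with hN
  have hpos : ∀ t ∈ Icc (0 : ℝ) 1, 0 < speed (n := n) c t := fun t ht =>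
    (norm_nonneg _).lt_of_ne' (hi t ht)
  have hcs := (contDiffOn_speed_curve hc hi).continuousOn
  have hNc : Continuous N :=
    hcs.comp_continuous (continuous_subtype_val.comp continuous_projIcc) fun t => (projIcc _ _ _ t).2
  obtain ⟨t₀, ht₀, hmin⟩ := isCompact_Icc.exists_isMinOn (nonempty_Icc.2 zero_le_one) hcs
  set m := speed (n := n) c t₀ with hm
  have hm0 : 0 < m := hpos t₀ ht₀
  have hNm : ∀ t, m ≤ N t := fun t => hmin (projIcc 0 1 zero_le_one t).2
  set S : ℝ → ℝ := fun t => ∫ r in (0 : ℝ)..t, N r with hS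
  have hS' : ∀ t, HasDerivAt S (N t) t := fun t => (hNc.integral_hasStrictDerivAt 0 t).hasDerivAt
  have hS0 : S 0 = 0 := intervalIntegral.integral_same
  have hmono : StrictMono S := strictMono_of_deriv_pos fun t => by
    rw [(hS' t).deriv]; exact hm0.trans_le (hNm t)
  -- The minimum m of the speed bounds the primitive by linear functions, which gives surjectivity.
  have hmono' : Monotone fun t => S t - m * t := by
    refine monotone_of_deriv_nonneg (fun t => ?_) fun t => ?_
    · exact ((hS' t).sub ((hasDerivAt_id t).const_mul m)).differentiableAt
    · show 0 ≤ deriv (fun i => S i - m * id i) t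
      rw [((hS' t).fun_sub ((hasDerivAt_id t).const_mul m)).deriv]
      linarith [hNm t]
  have hScont : Continuous S := continuous_iff_continuousAt.2 fun t => (hS' t).continuousAt
  have hsurj : Function.Surjective S := by
    refine hScont.surjective ?_ ?_
    · refine tendsto_atTop_mono' _ ?_ (tendsto_id.const_mul_atTop hm0)
      filter_upwards [eventually_ge_atTop 0] with t ht
      have := hmono' ht
      simp only [hS0] at this
      simp only [id]
      linarith
    · refine tendsto_atBot_mono' _ ?_ (tendsto_id.const_mul_atBot hm0)
      filter_upwards [eventually_le_atBot 0] with t ht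
      have := hmono' ht
      simp only [hS0] at this
      simp only [id]
      linarith
  set σ : ℝ ≃o ℝ := hmono.orderIsoOfSurjective S hsurj with hσ
  have hσS : ∀ t, σ t = S t := fun t => rfl
  refine ⟨σ, by rw [hσS, hS0], ?_, fun t ht => ?_⟩
  · rw [toReal_pathELength hcs, hσS]
    refine intervalIntegral.integral_congr fun r hr => ?_
    rw [uIcc_of_le zero_le_one] at hr
    simp only [hN, projIcc_of_mem _ hr]
  · have hNt : N t = speed (n := n) c t := by simp only [hN, projIcc_of_mem _ ht]
    refine HasDerivAt.of_local_left_inverse (f := S) σ.symm.continuous.continuousAt ?_ (hi t ht)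
      (Eventually.of_forall fun r => σ.apply_symm_apply r)
    rw [σ.symm_apply_apply, ← hNt]
    exact hS' t

/-- A geodesic parametrized by arclength is a trajectory of the geodesic flow. -/
lemma isGeoOn_unitVelocity_comp (hc : ContMDiffOn 𝓘(ℝ, ℝ) (𝓡 n) 2 c (Icc 0 1))
    (hi : ∀ t ∈ Icc (0 : ℝ) 1, speed (n := n) c t ≠ 0)
    (hg : ∀ t ∈ Icc (0 : ℝ) 1, IsGeodesicAt n c t) {σ : ℝ ≃o ℝ} (h0 : σ 0 = 0)
    (hσ : ∀ t ∈ Icc (0 : ℝ) 1, HasDerivAt σ.symm (speed (n := n) c t)⁻¹ (σ t)) :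
    IsGeoOn (fun r => unitVelocity n c (σ.symm r)) (Icc 0 (σ 1)) := by
  have hmaps : MapsTo σ.symm (Icc 0 (σ 1)) (Icc 0 1) := fun r hr =>
    ⟨by rw [← σ.symm_apply_apply 0, h0]; exact σ.symm.monotone hr.1,
      by rw [← σ.symm_apply_apply 1]; exact σ.symm.monotone hr.2⟩
  intro r hr
  obtain ⟨t, rfl⟩ := σ.surjective r
  have ht : t ∈ Icc (0 : ℝ) 1 := by simpa using hmaps hr
  have hd := (hσ t ht).hasDerivWithinAt (s := Icc 0 (σ 1))
  have hst : σ.symm (σ t) = t := σ.symm_apply_apply t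
  refine ⟨?_, ?_, fun q hq => ?_, fun q hq => ?_⟩
  · exact ContinuousWithinAt.comp (g := c) (t := Icc 0 1)
      (by rw [hst]; exact (hc t ht).continuousWithinAt) hd.continuousWithinAt hmaps
  · exact norm_unitVelocity (by rw [hst]; exact hi t ht)
  · simp only [hst] at hq ⊢
    rw [coord_unitVelocity]
    have h1 := hasDerivWithinAt_velocity ((hc t ht).mdifferentiableWithinAt (by norm_num)) hq
    rw [← hst] at h1
    have := HasDerivWithinAt.scomp (σ t) h1 hd hmaps
    rwa [hst] at this
  · simp only [hst] at hq ⊢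
    have h1 := hg t ht q hq
    rw [← hst] at h1
    have h2 := HasDerivWithinAt.scomp (σ t) h1 hd hmaps
    rw [hst] at h2
    have h3 : (momentum (n := n) c q ∘ σ.symm) = fun τ => chartMetric q
        (extChartAt (𝓡 n) q (unitVelocity n c (σ.symm τ)).proj)
        (coord q (unitVelocity n c (σ.symm τ))) := funext fun τ => momentum_eq c q _
    rw [h3] at h2
    refine h2.congr_deriv ?_
    rw [coord_unitVelocity, force, smul_smul]
    have hq' : c t ∈ (chartAt (𝔼 n) q).source := hq
    have h4 : (unitVelocity n c t).proj = c t := rfl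
    -- One factor of the inverse speed comes from the force and one from the reparametrization;
    -- together they normalize the velocity in the quadratic `metricGrad`.
    rw [h4, metricGrad_smul (mem_target hq'), sq]

end Arclength

/-! ### Trajectories as C² curves on the unit interval -/

section Trajectory

variable {γ : ℝ → TangentBundle (𝓡 n) M} {ℓ t : ℝ}

/-- The projection of a trajectory of the geodesic flow, parametrized by `[0, 1]`. -/
def base (γ : ℝ → TangentBundle (𝓡 n) M) (ℓ t : ℝ) : M := (γ (ℓ * t)).proj

lemma mapsTo_mul (hℓ : 0 < ℓ) : MapsTo (ℓ * ·) (Icc (0 : ℝ) 1) (Icc 0 ℓ) := fun t ht =>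
  ⟨mul_nonneg hℓ.le ht.1, by have := mul_le_mul_of_nonneg_left ht.2 hℓ.le; simpa using this⟩

lemma hasDerivWithinAt_phase_base (hγ : IsGeoOn γ (Icc 0 ℓ)) (hℓ : 0 < ℓ)
    (ht : t ∈ Icc (0 : ℝ) 1) {q : M} (hq : base γ ℓ t ∈ (chartAt (𝔼 n) q).source) :
    HasDerivWithinAt (fun τ => phase q (γ (ℓ * τ))) (ℓ • hamField q (phase q (γ (ℓ * t))))
      (Icc 0 1) t := by
  have h1 := (hγ _ (mapsTo_mul hℓ ht)).hasDerivWithinAt_phase hq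
  have h2 : HasDerivWithinAt (ℓ * ·) ℓ (Icc (0 : ℝ) 1) t := by
    simpa using ((hasDerivAt_id t).const_mul ℓ).hasDerivWithinAt
  exact HasDerivWithinAt.scomp t h1 h2 (mapsTo_mul hℓ)

lemma continuousWithinAt_base (hγ : IsGeoOn γ (Icc 0 ℓ)) (hℓ : 0 < ℓ) (ht : t ∈ Icc (0 : ℝ) 1) :
    ContinuousWithinAt (base γ ℓ) (Icc 0 1) t :=
  ContinuousWithinAt.comp (g := fun τ => (γ τ).proj) (hγ _ (mapsTo_mul hℓ ht)).cont
    (by fun_prop) (mapsTo_mul hℓ)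

/-- Bootstrap: the phase curve solves an equation with a C¹ right-hand side, so it is C¹, then its
derivative is C¹, so it is C². -/
lemma contMDiffOn_base (hγ : IsGeoOn γ (Icc 0 ℓ)) (hℓ : 0 < ℓ) :
    ContMDiffOn 𝓘(ℝ, ℝ) (𝓡 n) 2 (base γ ℓ) (Icc 0 1) := by
  intro t ht
  obtain ⟨q, hqt⟩ : ∃ q, q = base γ ℓ t := ⟨_, rfl⟩
  have hq : base γ ℓ t ∈ (chartAt (𝔼 n) q).source := hqt ▸ mem_chart_source _ _
  rw [contMDiffWithinAt_iff_target, ← hqt]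
  refine ⟨continuousWithinAt_base hγ hℓ ht, ?_⟩
  rw [contMDiffWithinAt_iff_contDiffWithinAt]
  have hev : ∀ᶠ τ in 𝓝[Icc 0 1] t, base γ ℓ τ ∈ (chartAt (𝔼 n) q).source :=
    continuousWithinAt_base hγ hℓ ht ((chartAt (𝔼 n) q).open_source.mem_nhds hq)
  obtain ⟨ε, hε, hball⟩ := Metric.mem_nhdsWithin_iff.1 hev
  set K := Metric.ball t ε ∩ Icc (0 : ℝ) 1 with hK
  have hKn : K ∈ 𝓝[Icc 0 1] t :=
    inter_mem (mem_nhdsWithin_of_mem_nhds (Metric.ball_mem_nhds t hε)) self_mem_nhdsWithin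
  have hKu : UniqueDiffOn ℝ K := by
    rw [hK, inter_comm]
    exact uniqueDiffOn_Icc_zero_one.inter Metric.isOpen_ball
  have hder : ∀ τ ∈ K, HasDerivWithinAt (fun τ => phase q (γ (ℓ * τ)))
      (ℓ • hamField q (phase q (γ (ℓ * τ)))) K τ := fun τ hτ =>
    (hasDerivWithinAt_phase_base hγ hℓ hτ.2 (hball hτ)).mono inter_subset_right
  have hham : ∀ τ ∈ K, ContDiffAt ℝ 1 (hamField q) (phase q (γ (ℓ * τ))) := fun τ hτ =>
    contDiffAt_hamField (mem_target (hball hτ))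
  have hd : EqOn (derivWithin (fun τ => phase q (γ (ℓ * τ))) K)
      (fun τ => ℓ • hamField q (phase q (γ (ℓ * τ)))) K := fun τ hτ =>
    (hder τ hτ).derivWithin (hKu τ hτ)
  have hC1 : ContDiffOn ℝ 1 (fun τ => phase q (γ (ℓ * τ))) K := by
    rw [contDiffOn_one_iff_derivWithin hKu]
    refine ⟨fun τ hτ => (hder τ hτ).differentiableWithinAt, ContinuousOn.congr ?_ hd⟩
    refine ContinuousOn.const_smul (fun τ hτ => ?_) ℓ
    exact ContinuousAt.comp_continuousWithinAt (g := hamField q)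
        (f := fun τ => phase q (γ (ℓ * τ))) (hham τ hτ).continuousAt
        (hder τ hτ).continuousWithinAt
  have hC2 : ContDiffOn ℝ (1 + 1) (fun τ => phase q (γ (ℓ * τ))) K := by
    rw [contDiffOn_succ_iff_derivWithin hKu]
    refine ⟨fun τ hτ => (hder τ hτ).differentiableWithinAt, by simp, ContDiffOn.congr ?_ hd⟩
    exact ContDiffOn.const_smul ℓ fun τ hτ =>
      ContDiffAt.comp_contDiffWithinAt (g := hamField q)
        (f := fun τ => phase q (γ (ℓ * τ))) τ (hham τ hτ) (hC1 τ hτ)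
  have htK : t ∈ K := ⟨Metric.mem_ball_self hε, ht⟩
  exact ((contDiff_fst.comp_contDiffOn hC2).contDiffWithinAt htK).mono_of_mem_nhdsWithin hKn

lemma coord_velocity_base (hγ : IsGeoOn γ (Icc 0 ℓ)) (hℓ : 0 < ℓ) (ht : t ∈ Icc (0 : ℝ) 1) {q : M}
    (hq : base γ ℓ t ∈ (chartAt (𝔼 n) q).source) :
    coord q (velocity (base γ ℓ) t) = ℓ • coord q (γ (ℓ * t)) := by
  have h1 := hasDerivWithinAt_velocity
    ((contMDiffOn_base hγ hℓ t ht).mdifferentiableWithinAt (by norm_num)) hq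
  have h2 : HasDerivWithinAt (ℓ * ·) ℓ (Icc (0 : ℝ) 1) t := by
    simpa using ((hasDerivAt_id t).const_mul ℓ).hasDerivWithinAt
  exact (uniqueDiffOn_Icc_zero_one t ht).eq_deriv _ h1
    (HasDerivWithinAt.scomp t ((hγ _ (mapsTo_mul hℓ ht)).pos q hq) h2 (mapsTo_mul hℓ))

lemma speed_base (hγ : IsGeoOn γ (Icc 0 ℓ)) (hℓ : 0 < ℓ) (ht : t ∈ Icc (0 : ℝ) 1) :
    speed (n := n) (base γ ℓ) t = ℓ := by
  have hq := mem_chart_source (𝔼 n) (base γ ℓ t)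
  have h1 := speed_sq (n := n) hq
  have h2 := chartMetric_coord_self (x := γ (ℓ * t)) hq
  rw [(hγ _ (mapsTo_mul hℓ ht)).unit] at h2
  rw [coord_velocity_base hγ hℓ ht hq, map_smul, map_smul, smul_apply, smul_eq_mul,
    smul_eq_mul, show extChartAt (𝓡 n) (base γ ℓ t) (base γ ℓ t) =
      extChartAt (𝓡 n) (base γ ℓ t) (γ (ℓ * t)).proj from rfl, h2] at h1
  refine (pow_left_inj₀ (norm_nonneg _) hℓ.le two_ne_zero).1 (h1.trans (by ring))

lemma unitVelocity_base (hγ : IsGeoOn γ (Icc 0 ℓ)) (hℓ : 0 < ℓ) (ht : t ∈ Icc (0 : ℝ) 1) :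
    unitVelocity n (base γ ℓ) t = γ (ℓ * t) := by
  have hq := mem_chart_source (𝔼 n) (base γ ℓ t)
  refine phase_injOn (q := base γ ℓ t) hq hq ?_
  have h1 : coord (base γ ℓ t) (unitVelocity n (base γ ℓ) t) =
      coord (base γ ℓ t) (γ (ℓ * t)) := by
    rw [coord_unitVelocity, coord_velocity_base hγ hℓ ht hq, speed_base hγ hℓ ht, smul_smul,
      inv_mul_cancel₀ hℓ.ne', one_smul]
  have h2 : (unitVelocity n (base γ ℓ) t).proj = (γ (ℓ * t)).proj := rfl
  rw [phase, phase, h1, h2]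

lemma isGeodesicAt_base (hγ : IsGeoOn γ (Icc 0 ℓ)) (hℓ : 0 < ℓ) (ht : t ∈ Icc (0 : ℝ) 1) :
    IsGeodesicAt n (base γ ℓ) t := by
  intro q hq
  have h2 : HasDerivWithinAt (ℓ * ·) ℓ (Icc (0 : ℝ) 1) t := by
    simpa using ((hasDerivAt_id t).const_mul ℓ).hasDerivWithinAt
  have h3 := HasDerivWithinAt.scomp t ((hγ _ (mapsTo_mul hℓ ht)).mom q hq) h2 (mapsTo_mul hℓ)
  have h4 : ∀ τ ∈ Icc (0 : ℝ) 1, momentum (n := n) (base γ ℓ) q τ =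
      chartMetric q (extChartAt (𝓡 n) q (γ (ℓ * τ)).proj) (coord q (γ (ℓ * τ))) := fun τ hτ => by
    rw [momentum_eq, unitVelocity_base hγ hℓ hτ]; rfl
  refine (h3.congr h4 (h4 t ht)).congr_deriv ?_
  rw [force, speed_base hγ hℓ ht, coord_velocity_base hγ hℓ ht hq, metricGrad_smul (mem_target hq),
    smul_smul, sq, inv_mul_cancel_left₀ hℓ.ne']
  rfl

lemma toReal_pathELength_base (hγ : IsGeoOn γ (Icc 0 ℓ)) (hℓ : 0 < ℓ) :
    (pathELength (𝓡 n) (base γ ℓ) 0 1).toReal = ℓ := by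
  have h : ∀ t ∈ Icc (0 : ℝ) 1, speed (n := n) (base γ ℓ) t = ℓ := fun t ht => speed_base hγ hℓ ht
  rw [toReal_pathELength (continuousOn_const.congr h),
    intervalIntegral.integral_congr (g := fun _ => ℓ)]
  · simp
  · intro t ht
    rw [uIcc_of_le zero_le_one] at ht
    exact h t ht

end Trajectory

/-! ### The arcs of a stationary net -/

section

open WeightedMultigraph

variable {G : WeightedMultigraph} {f : G.Realization → M}

section ArcsOfNet

lemma pathELength_pos (hf : IsNet (n := n) f) (e : G.E) :
    0 < (pathELength (𝓡 n) (edgePath f e) 0 1).toReal := by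
  obtain ⟨σ, h0, h1, -⟩ := exists_arclength (hf.contMDiffOn e) (speed_edgePath_ne_zero hf e)
  rw [← h1, ← h0]
  exact σ.strictMono zero_lt_one

/-- The unit tangent vector at an end of an edge, pointing into the edge. -/
def endVector (f : G.Realization → M) (a : G.E × Bool) : TangentBundle (𝓡 n) M :=
  bif a.2 then revVec (unitVelocity n (edgePath f a.1) 1) else unitVelocity n (edgePath f a.1) 0

variable [T2Space M]

lemma geoRel_edge (hf : IsStationary (n := n) f) (e : G.E) :
    GeoRel (n := n) (unitVelocity n (edgePath f e) 0)
      (pathELength (𝓡 n) (edgePath f e) 0 1).toReal (unitVelocity n (edgePath f e) 1) := by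
  obtain ⟨σ, h0, h1, hσ⟩ := exists_arclength (hf.isNet.contMDiffOn e)
    (speed_edgePath_ne_zero hf.isNet e)
  have h := isGeoOn_unitVelocity_comp (hf.isNet.contMDiffOn e) (speed_edgePath_ne_zero hf.isNet e)
    (fun t ht => isGeodesicAt_of_isStationary hf e ht) h0 hσ
  have h2 := h.geoRel le_rfl (by rw [← h0]; exact (σ.strictMono zero_lt_one).le) le_rfl
  have e0 : σ.symm 0 = 0 := by conv_lhs => rw [← h0, σ.symm_apply_apply]
  rw [h1] at h2
  simpa only [← h1, σ.symm_apply_apply, e0, sub_zero] using h2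

/-- The arcs given by the edges of a stationary geodesic net. -/
def arcsOfNet (hf : IsStationary (n := n) f) : ArcSystem (geodesicFlow (n := n) (M := M)) where
  A := G.E × Bool
  start := endVector f
  len a := (pathELength (𝓡 n) (edgePath f a.1) 0 1).toReal
  mult a := G.mult a.1
  rev a := (a.1, !a.2)
  len_pos a := pathELength_pos hf.isNet a.1
  mult_pos a := G.mult_pos a.1
  rev_rev a := by simp
  len_rev _ := rfl
  mult_rev _ := rfl
  rel := by
    rintro ⟨e, i⟩
    have h := geoRel_edge hf e
    cases i with
    | false =>
      have h1 : revVec (endVector (n := n) f (e, true)) = unitVelocity n (edgePath f e) 1 :=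
        revVec_revVec _
      show GeoRel _ _ (revVec (endVector f (e, true)))
      rw [h1]
      exact h
    | true => exact h.rev

lemma exists_represents_arcsOfNet (hf : IsStationary (n := n) f) :
    ∃ R : Represents (arcsOfNet hf) f, ∀ a, R.equiv a = a := by
  choose σ h0 h1 hσ using fun e => exists_arclength (hf.isNet.contMDiffOn e)
    (speed_edgePath_ne_zero hf.isNet e)
  refine ⟨⟨Equiv.refl _, fun _ _ => rfl, fun _ _ => rfl, σ, h0, h1, fun e t ht => ?_⟩, fun _ => rfl⟩
  have h := isGeoOn_unitVelocity_comp (hf.isNet.contMDiffOn e) (speed_edgePath_ne_zero hf.isNet e)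
    (fun t ht => isGeodesicAt_of_isStationary hf e ht) (h0 e) (hσ e)
  have hp : 0 ≤ σ e t := by
    have := (σ e).monotone ht.1
    rwa [h0] at this
  have h2 := h.geoRel le_rfl hp ((σ e).monotone ht.2)
  have e0 : (σ e).symm 0 = 0 := by conv_lhs => rw [← h0 e, (σ e).symm_apply_apply]
  simp only [(σ e).symm_apply_apply, e0, sub_zero] at h2
  have h3 := (arcsOfNet hf).point_eq (a := (e, false)) h2
  exact congrArg (fun x : TangentBundle (𝓡 n) M => x.proj) h3

/-- The balance of the net in terms of arcs: the arc starting at parameter 1 points inward, which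
gives the minus sign. -/
lemma sum_mult_weight (hf : IsStationary (n := n) f) (p : M) (w : 𝔼 n) :
    ∑ a, ((arcsOfNet hf).mult a : ℝ) * weight p w ((arcsOfNet hf).start a) = 0 := by
  obtain ⟨R, hR⟩ := exists_represents_arcsOfNet hf
  rw [R.sum_eq, ← neg_zero, ← sum_weight_eq_zero hf p w, ← Finset.sum_neg_distrib]
  refine Finset.sum_congr rfl fun e _ => ?_
  rw [hR, hR]
  have h1 : (arcsOfNet hf).start (e, false) = unitVelocity n (edgePath f e) 0 := rfl
  have h2 : (arcsOfNet hf).start (e, true) = revVec (unitVelocity n (edgePath f e) 1) := rfl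
  rw [h1, h2, weight_revVec]
  show (G.mult e : ℝ) * _ + (G.mult e : ℝ) * _ = _
  ring

end ArcsOfNet

/-! ### Vanishing weighted sums imply balance -/

section Balanced

variable [T2Space M]

lemma unit_of_count_pos {S : ArcSystem (geodesicFlow (n := n) (M := M))}
    {x : TangentBundle (𝓡 n) M} (hx : 0 < S.count x) : ‖x.snd‖ = 1 := by
  obtain ⟨a, t, ht, h⟩ := S.count_pos.1 hx
  have := GeoRel.unit (n := n) (geodesicFlow.rev_rel h)
  rwa [show (geodesicFlow (n := n) (M := M)).rev x = revVec x from rfl, norm_revVec] at this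

lemma weight_apply {p : M} {w : 𝔼 n} {x : TangentBundle (𝓡 n) M} (h : x.proj = p) :
    weight p w x = chartMetric p (extChartAt (𝓡 n) p p) (coord p x) w := if_pos h

/-- The vectors at a point are balanced if their weighted sum vanishes. -/
theorem balanced_of_sum_eq_zero {S : ArcSystem (geodesicFlow (n := n) (M := M))}
    (h : ∀ p w, ∑ a, (S.mult a : ℝ) * weight p w (S.start a) = 0) : S.Balanced := by
  classical
  intro x y hx hxy
  obtain ⟨p, hp⟩ : ∃ p, p = x.proj := ⟨_, rfl⟩
  have hsrc : p ∈ (chartAt (𝔼 n) p).source := mem_chart_source _ _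
  have hsum : ∀ w, ∑ z ∈ (S.finite_darts (finite_singleton p)).toFinset,
      (S.count z : ℝ) * weight p w z = 0 := fun w => by
    rw [← S.sum_mult_start p (weight_revVec p w) (fun z hz => weight_of_ne hz), h]
  have hmem : ∀ z, z ∈ (S.finite_darts (finite_singleton p)).toFinset ↔
      0 < S.count z ∧ z.proj = p := fun z => by
    rw [Set.Finite.mem_toFinset]; rfl
  have hself : ∀ z : TangentBundle (𝓡 n) M, 0 < S.count z → z.proj = p →
      chartMetric p (extChartAt (𝓡 n) p p) (coord p z) (coord p z) = 1 := by
    intro z hz hzp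
    have h1 := chartMetric_coord_self (q := p) (x := z) (by rw [hzp]; exact hsrc)
    rwa [unit_of_count_pos hz, hzp, one_pow] at h1
  by_cases hy : 0 < S.count y ∧ y.proj = p ∧ y ≠ x
  · obtain ⟨hy, hyp, hyx⟩ := hy
    have hset : (S.finite_darts (finite_singleton p)).toFinset = {x, y} := by
      ext z
      rw [hmem, Finset.mem_insert, Finset.mem_singleton]
      constructor
      · rintro ⟨h1, h2⟩
        exact hxy z (h2.trans hp) h1
      · rintro (rfl | rfl)
        · exact ⟨hx, hp.symm⟩
        · exact ⟨hy, hyp⟩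
    set a : ℝ := (S.count x : ℝ)
    set b : ℝ := (S.count y : ℝ)
    have ha : 0 < a := by simp only [a]; exact_mod_cast hx
    have hb : 0 < b := by simp only [b]; exact_mod_cast hy
    set w : 𝔼 n := a • coord p x + b • coord p y with hw
    -- Testing the vanishing sum against itself gives it metric norm zero.
    have hw0 : w = 0 := by
      by_contra hne
      have h1 := chartMetric_pos (mem_target hsrc) hne
      have h2 := hsum w
      rw [hset, Finset.sum_pair hyx.symm, weight_apply hp.symm, weight_apply hyp] at h2
      have h3 : chartMetric p (extChartAt (𝓡 n) p p) w w =
          a * chartMetric p (extChartAt (𝓡 n) p p) (coord p x) w +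
          b * chartMetric p (extChartAt (𝓡 n) p p) (coord p y) w := by
        conv_lhs => rw [hw]
        simp only [map_add, map_smul, add_apply, smul_apply, smul_eq_mul]
        rw [hw]
        simp only [map_add, map_smul, smul_eq_mul]
        rw [chartMetric_comm p _ (coord p y) (coord p x)]
      rw [h3] at h1
      exact h1.ne' h2
    have hbv : b • coord p y = -(a • coord p x) := by
      rw [hw] at hw0
      exact eq_neg_of_add_eq_zero_right hw0
    -- Both vectors have norm one, so opposite multiples of them have equal coefficients.
    have hsq : b ^ 2 = a ^ 2 := by
      have h1 := congrArg (fun v => chartMetric p (extChartAt (𝓡 n) p p) v v) hbv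
      simp only [map_neg, map_smul, neg_apply, smul_apply, smul_eq_mul, hself x hx hp.symm,
        hself y hy hyp] at h1
      linarith
    have hab : b = a := (pow_left_inj₀ hb.le ha.le two_ne_zero).1 hsq
    refine ⟨?_, Nat.cast_injective (R := ℝ) hab⟩
    rw [hab, ← smul_neg] at hbv
    have hv := smul_right_injective _ ha.ne' hbv
    have hv' : coord p y = coord p (revVec x) := by rw [coord_revVec]; exact hv
    have hpr : y.proj = (revVec x).proj := hyp.trans hp
    refine phase_injOn (q := p) (by rw [hyp]; exact hsrc) ?_ ?_
    · show x.proj ∈ _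
      rw [← hp]
      exact hsrc
    · show phase p y = phase p (revVec x)
      rw [phase, phase, hv', hpr]
  -- If only x carries arcs at p, testing the sum against x gives count zero.
  · exfalso
    have hset : (S.finite_darts (finite_singleton p)).toFinset = {x} := by
      ext z
      rw [hmem, Finset.mem_singleton]
      constructor
      · rintro ⟨h1, h2⟩
        rcases hxy z (h2.trans hp) h1 with h3 | h3
        · exact h3
        · by_contra hne
          exact hy ⟨h3 ▸ h1, h3 ▸ h2, h3 ▸ hne⟩
      · rintro rfl
        exact ⟨hx, hp.symm⟩
    have h1 := hsum (coord p x)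
    rw [hset, Finset.sum_singleton, weight_apply hp.symm, hself x hx hp.symm, mul_one] at h1
    have h2 : S.count x = 0 := by exact_mod_cast h1
    omega

end Balanced

end

/-! ### From systems of arcs back to stationary nets -/

section

open WeightedMultigraph

section Congr

variable {c c' : ℝ → M} {t : ℝ}

lemma velocity_congr (h : EqOn c c' (Icc 0 1)) (ht : t ∈ Icc (0 : ℝ) 1) :
    velocity (n := n) c t = velocity (n := n) c' t := by
  have key : ∀ (x y : M) (v w : 𝔼 n), x = y → v = w →
      (⟨x, v⟩ : TangentBundle (𝓡 n) M) = ⟨y, w⟩ := by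
    rintro x _ v _ rfl rfl
    rfl
  have h1 := mfderivWithin_congr (I := 𝓘(ℝ, ℝ)) (I' := 𝓡 n) (x := t) (s := Icc (0 : ℝ) 1) (f₁ := c)
    (f := c') (fun x hx => h hx) (h ht)
  exact key _ _ _ _ (h ht) (DFunLike.congr_fun h1 (1 : ℝ))

lemma speed_congr (h : EqOn c c' (Icc 0 1)) (ht : t ∈ Icc (0 : ℝ) 1) :
    speed (n := n) c t = speed (n := n) c' t :=
  congrArg (fun x : TangentBundle (𝓡 n) M => ‖x.snd‖) (velocity_congr h ht)

lemma unitVelocity_congr (h : EqOn c c' (Icc 0 1)) (ht : t ∈ Icc (0 : ℝ) 1) :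
    unitVelocity n c t = unitVelocity n c' t :=
  congrArg (fun x : TangentBundle (𝓡 n) M =>
    (⟨x.proj, ‖x.snd‖⁻¹ • x.snd⟩ : TangentBundle (𝓡 n) M)) (velocity_congr h ht)

lemma momentum_congr (h : EqOn c c' (Icc 0 1)) (ht : t ∈ Icc (0 : ℝ) 1) (q : M) :
    momentum (n := n) c q t = momentum (n := n) c' q t := by
  rw [momentum_eq, momentum_eq, unitVelocity_congr h ht, h ht]

lemma force_congr (h : EqOn c c' (Icc 0 1)) (ht : t ∈ Icc (0 : ℝ) 1) (q : M) :
    force (n := n) c q t = force (n := n) c' q t := by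
  rw [force, force, speed_congr h ht, velocity_congr h ht, h ht]

lemma IsGeodesicAt.congr (hc : IsGeodesicAt n c' t) (h : EqOn c c' (Icc 0 1))
    (ht : t ∈ Icc (0 : ℝ) 1) : IsGeodesicAt n c t := by
  intro q hq
  rw [h ht] at hq
  rw [force_congr h ht]
  exact (hc q hq).congr (fun τ hτ => momentum_congr h hτ q) (momentum_congr h ht q)

end Congr

section Stationary

variable {G : WeightedMultigraph} {g : G.Realization → M}

/-- The derivative of a curve at time zero, in a chart around its position. -/
def initialVelocity (k : ℝ → M) : 𝔼 n :=
  coord (n := n) (k 0) ⟨k 0, mfderiv 𝓘(ℝ, ℝ) (𝓡 n) k 0 (1 : ℝ)⟩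

/-- A net of geodesics which is balanced at its vertices is stationary. -/
theorem isStationary_of_isGeodesicAt (hg : IsNet (n := n) g)
    (hgeo : ∀ e, ∀ t ∈ Icc (0 : ℝ) 1, IsGeodesicAt n (edgePath g e) t)
    (hbal : ∀ ξ : G.V → 𝔼 n, ∑ e, (G.mult e : ℝ) *
      (momentum (edgePath g e) (edgePath g e 1) 1 (ξ (G.endpt e true)) -
        momentum (edgePath g e) (edgePath g e 0) 0 (ξ (G.endpt e false))) = 0) :
    IsStationary (n := n) g := by
  refine ⟨hg, fun δ hδ F hF => ?_⟩
  -- For geodesic edges only boundary terms remain, and these depend on the family through the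
  -- initial velocities of the vertices, shared by all edges at a vertex.
  have hL : ∀ e, HasDerivAt (fun s => (pathELength (𝓡 n) (edgeFamily F e s) 0 1).toReal)
      (momentum (n := n) (edgePath g e) (edgePath g e 1) 1
          (initialVelocity fun s => F s (G.vertexPt (G.endpt e true))) -
        momentum (n := n) (edgePath g e) (edgePath g e 0) 0
          (initialVelocity fun s => F s (G.vertexPt (G.endpt e false)))) 0 := by
    intro e
    have h0 := hF.edgeFamily_zero e
    have h1 : (fun s => F s (G.vertexPt (G.endpt e true))) = fun s => edgeFamily F e s 1 :=
      funext fun s => (edgePath_one (F s) e).symm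
    have h2 : (fun s => F s (G.vertexPt (G.endpt e false))) = fun s => edgeFamily F e s 0 :=
      funext fun s => (edgePath_zero (F s) e).symm
    have hp : ∀ t, pairing n (edgeFamily F e) t =
        momentum (n := n) (edgePath g e) (edgePath g e t) t
          (initialVelocity fun s => edgeFamily F e s t) := by
      intro t
      rw [pairing_eq (mem_chart_source _ _), ← h0]
      rfl
    have h3 := hasDerivAt_length_eq hδ (hF.contMDiffOn_edge e) (hF.speed_ne_zero e) (d := fun _ => 0)
      intervalIntegrable_const fun t ht => by
        have ht' := Ioo_subset_Icc_self ht
        rw [h0]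
        exact ⟨_, _, mem_chart_source _ _, hgeo e t ht' _ (mem_chart_source _ _), by simp⟩
    rw [hp, hp, intervalIntegral.integral_zero, add_zero] at h3
    rw [h1, h2]
    exact h3
  have h4 := hasDerivAt_net_length (n := n) hL
  rwa [hbal fun v => initialVelocity fun s => F s (G.vertexPt v)] at h4

end Stationary

section NetOfArcs

variable [T2Space M] {S : ArcSystem (geodesicFlow (n := n) (M := M))}

lemma exists_isGeoOn_arc (S : ArcSystem (geodesicFlow (n := n) (M := M))) (a : S.A) :
    ∃ γ : ℝ → TangentBundle (𝓡 n) M, IsGeoOn γ (Icc 0 (S.len a)) ∧ γ 0 = S.start a ∧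
      γ (S.len a) = revVec (S.start (S.rev a)) :=
  (S.rel a).2

/-- The geodesic along an arc. -/
def arcCurve (S : ArcSystem (geodesicFlow (n := n) (M := M))) (a : S.A) :
    ℝ → TangentBundle (𝓡 n) M := (exists_isGeoOn_arc S a).choose

lemma isGeoOn_arcCurve (a : S.A) : IsGeoOn (arcCurve S a) (Icc 0 (S.len a)) :=
  (exists_isGeoOn_arc S a).choose_spec.1

lemma arcCurve_zero (a : S.A) : arcCurve S a 0 = S.start a :=
  (exists_isGeoOn_arc S a).choose_spec.2.1

lemma arcCurve_len (a : S.A) : arcCurve S a (S.len a) = revVec (S.start (S.rev a)) :=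
  (exists_isGeoOn_arc S a).choose_spec.2.2

lemma arcCurve_eq_point {a : S.A} {t : ℝ} (ht : t ∈ Icc 0 (S.len a)) :
    arcCurve S a t = S.point a t := by
  have h := (isGeoOn_arcCurve a).geoRel le_rfl ht.1 ht.2
  rw [arcCurve_zero, sub_zero] at h
  exact (S.point_eq h).symm

/-- The net given by a system of arcs. -/
def netOfArcs (S : ArcSystem (geodesicFlow (n := n) (M := M))) : S.graph.Realization → M :=
  glueMap S.vertexPos (fun e t => base (arcCurve S e.1) (S.len e.1) t)
    (fun e => by
      show (arcCurve S e.1 (S.len e.1 * 0)).proj = _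
      rw [mul_zero, arcCurve_zero]
      rfl)
    (fun e => by
      show (arcCurve S e.1 (S.len e.1 * 1)).proj = _
      rw [mul_one, arcCurve_len]
      rfl)

lemma eqOn_edgePath_netOfArcs (e : S.graph.E) :
    EqOn (edgePath (netOfArcs S) e) (base (arcCurve S e.1) (S.len e.1)) (Icc 0 1) :=
  fun _ ht => edgePath_glueMap ht

lemma isNet_netOfArcs : IsNet (n := n) (netOfArcs S) where
  continuous := continuous_glueMap fun e =>
    (contMDiffOn_base (isGeoOn_arcCurve e.1) (S.len_pos _)).continuousOn
  contMDiffOn e := (contMDiffOn_base (isGeoOn_arcCurve e.1) (S.len_pos _)).congr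
    (eqOn_edgePath_netOfArcs e)
  immersion e t ht := by
    rw [← speed_ne_zero_iff, speed_congr (eqOn_edgePath_netOfArcs e) ht,
      speed_base (isGeoOn_arcCurve e.1) (S.len_pos _) ht]
    exact (S.len_pos _).ne'

lemma toReal_pathELength_netOfArcs (e : S.graph.E) :
    (pathELength (𝓡 n) (edgePath (netOfArcs S) e) 0 1).toReal = S.len e.1 := by
  rw [pathELength_congr (eqOn_edgePath_netOfArcs e),
    toReal_pathELength_base (isGeoOn_arcCurve e.1) (S.len_pos _)]

lemma unitVelocity_netOfArcs_zero (e : S.graph.E) :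
    unitVelocity n (edgePath (netOfArcs S) e) 0 = S.start (S.dart (e, false)) := by
  have h0 : (0 : ℝ) ∈ Icc (0 : ℝ) 1 := ⟨le_rfl, zero_le_one⟩
  rw [unitVelocity_congr (eqOn_edgePath_netOfArcs e) h0,
    unitVelocity_base (isGeoOn_arcCurve e.1) (S.len_pos _) h0, mul_zero, arcCurve_zero]
  rfl

lemma unitVelocity_netOfArcs_one (e : S.graph.E) :
    unitVelocity n (edgePath (netOfArcs S) e) 1 = revVec (S.start (S.dart (e, true))) := by
  have h1 : (1 : ℝ) ∈ Icc (0 : ℝ) 1 := ⟨zero_le_one, le_rfl⟩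
  rw [unitVelocity_congr (eqOn_edgePath_netOfArcs e) h1,
    unitVelocity_base (isGeoOn_arcCurve e.1) (S.len_pos _) h1, mul_one, arcCurve_len]
  rfl

/-- The net given by a system of arcs has these arcs. -/
def representsNetOfArcs (h : ∀ a, S.rev a ≠ a) : Represents S (netOfArcs S) where
  equiv := ArcSystem.dartEquiv h
  rev := ArcSystem.rev_dart
  mult e i := by
    cases i with
    | false => rfl
    | true => exact S.mult_rev _
  time e := OrderIso.mulLeft₀ (S.len e.1) (S.len_pos _)
  time_zero e := mul_zero _
  time_one e := mul_one _
  rel e t ht := by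
    rw [eqOn_edgePath_netOfArcs e ht]
    have h1 := arcCurve_eq_point (S := S) (a := e.1) (mapsTo_mul (S.len_pos e.1) ht)
    exact congrArg (fun x : TangentBundle (𝓡 n) M => x.proj) h1.symm

/-- The edges are geodesics by construction, so only the balance at the vertices is needed; it is
the hypothesis on weights at each vertex position, tested against the velocity of that vertex. -/
theorem isStationary_netOfArcs (h : ∀ a, S.rev a ≠ a)
    (hS : ∀ p w, ∑ a, (S.mult a : ℝ) * weight p w (S.start a) = 0) :
    IsStationary (n := n) (netOfArcs S) := by
  refine isStationary_of_isGeodesicAt isNet_netOfArcs (fun e t ht => ?_) fun ξ => ?_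
  · exact (isGeodesicAt_base (isGeoOn_arcCurve e.1) (S.len_pos _) ht).congr
      (eqOn_edgePath_netOfArcs e) ht
  · classical
    let _ : Fintype S.graph.V := Fintype.ofFinite _
    -- Summed over arcs first, each vertex contributes zero. Summed over vertices first, only the
    -- vertex where the arc starts survives, as distinct vertices have distinct positions.
    set m : S.A → ℝ := fun a => ∑ v : S.graph.V,
      (S.mult a : ℝ) * weight (S.vertexPos v) (ξ v) (S.start a) with hm
    have h1 : ∑ a, m a = 0 := by
      rw [hm, Finset.sum_comm]
      exact Finset.sum_eq_zero fun v _ => hS _ _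
    have h2 : ∀ a v, S.vertexPos v = (S.start a).proj → m a = (S.mult a : ℝ) *
        weight (S.start a).proj (ξ v) (S.start a) := by
      intro a v₀ hv₀
      rw [hm, ← hv₀]
      refine Finset.sum_eq_single v₀ (fun v _ hv => ?_) fun hv => absurd (Finset.mem_univ _) hv
      rw [weight_of_ne fun h => hv (ArcSystem.vertexPos_injective (h.symm.trans hv₀.symm)), mul_zero]
    rw [(representsNetOfArcs h).sum_eq] at h1
    refine Eq.trans ?_ (neg_eq_zero.2 h1)
    rw [← Finset.sum_neg_distrib]
    refine Finset.sum_congr rfl fun e _ => ?_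
    have e0 : (representsNetOfArcs h).equiv (e, false) = S.dart (e, false) := rfl
    have e1 : (representsNetOfArcs h).equiv (e, true) = S.dart (e, true) := rfl
    have m0 : S.mult (S.dart (e, false)) = S.graph.mult e := (representsNetOfArcs h).mult e false
    have m1 : S.mult (S.dart (e, true)) = S.graph.mult e := (representsNetOfArcs h).mult e true
    rw [e0, e1, h2 (S.dart (e, false)) (S.graph.endpt e false) rfl,
      h2 (S.dart (e, true)) (S.graph.endpt e true) rfl, m0, m1]
    have hp0 : edgePath (netOfArcs S) e 0 = (S.start (S.dart (e, false))).proj := edgePath_zero _ e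
    have hp1 : edgePath (netOfArcs S) e 1 = (S.start (S.dart (e, true))).proj := edgePath_one _ e
    rw [← weight_unitVelocity rfl, ← weight_unitVelocity rfl, unitVelocity_netOfArcs_zero,
      unitVelocity_netOfArcs_one, weight_revVec, hp0, hp1]
    ring

end NetOfArcs

/-! ### The embedded net -/

section Main

variable [T2Space M] [CompactSpace M] {G : WeightedMultigraph} {f : G.Realization → M}

theorem exists_embedded_isStationary (hG : G.NoIsolatedVertex) (hf : IsStationary (n := n) f) :
    ∃ (G' : WeightedMultigraph) (f' : G'.Realization → M),
      IsStationary (n := n) f' ∧ Function.Injective f' ∧ range f' = range f ∧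
      (∀ p : M, multiplicityAt f' p = multiplicityAt f p) ∧
      (∀ v : G'.V, (G'.component v).IsGood) ∧ length n f' = length n f := by
  obtain ⟨R, hR⟩ := exists_represents_arcsOfNet hf
  -- The simplified system has the counting function of the net, so multiplicities, image, balance
  -- and length all carry over.
  obtain ⟨S, hS⟩ := (arcsOfNet hf).exists_isSimplified (balanced_of_sum_eq_zero (sum_mult_weight hf))
  have hmult := R.multiplicityAt_congr (representsNetOfArcs hS.rev_ne) hS.count_eq
  refine ⟨S.graph, netOfArcs S, isStationary_netOfArcs hS.rev_ne fun p w => ?_,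
    ArcSystem.injective_of_represents hS (representsNetOfArcs hS.rev_ne) (fun _ => rfl)
      fun _ => rfl, ?_, hmult, ArcSystem.isGood_component hS, ?_⟩
  · exact (ArcSystem.sum_mult_start_eq (wt := weight p w) _ hS.count_eq p (weight_revVec p w)
      fun x hx => weight_of_ne hx).trans (sum_mult_weight hf p w)
  · rw [range_eq_of_multiplicityAt (ArcSystem.noIsolatedVertex_graph hS.rev_ne),
      range_eq_of_multiplicityAt hG]
    simp only [hmult]
  · have h1 := (representsNetOfArcs hS.rev_ne).sum_mult_len_eq
    have h2 := R.sum_mult_len_eq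
    rw [ArcSystem.sum_mult_len _ hS.count_eq, ← h2] at h1
    refine Eq.trans ?_ (h1.trans ?_)
    · exact Finset.sum_congr rfl fun e _ => congrArg _ (toReal_pathELength_netOfArcs e)
    · refine Finset.sum_congr rfl fun e _ => ?_
      rw [hR]
      rfl

end Main

end

end GeodesicNet

end

theorem mainTheorem5 {n : ℕ} {M : Type*} [TopologicalSpace M] [T2Space M] [CompactSpace M]
    [ChartedSpace (EuclideanSpace ℝ (Fin n)) M] [IsManifold (𝓡 n) ∞ M]
    (k : ℕ∞) (hk : 3 ≤ k)
    [RiemannianBundle (fun x : M => TangentSpace (𝓡 n) x)]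
    [IsContMDiffRiemannianBundle (𝓡 n) (k : ℕ∞ω) (EuclideanSpace ℝ (Fin n))
      (fun x : M => TangentSpace (𝓡 n) x)]
    (Γ : WeightedMultigraph) (hΓ : Γ.NoIsolatedVertex)
    (f : Γ.Realization → M) (hf : WeightedMultigraph.IsStationary (n := n) f) :
    ∃ (Γ' : WeightedMultigraph) (f' : Γ'.Realization → M),
      WeightedMultigraph.IsStationary (n := n) f' ∧
      Function.Injective f' ∧
      range f' = range f ∧
      (∀ p : M, WeightedMultigraph.multiplicityAt f' p = WeightedMultigraph.multiplicityAt f p) ∧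
      (∀ v : Γ'.V, (Γ'.component v).IsGood) ∧
      WeightedMultigraph.length n f' = WeightedMultigraph.length n f := by
  -- A C² metric is enough for the argument.
  have h2 : ((2 : ℕ∞) : ℕ∞ω) ≤ (k : ℕ∞ω) :=
    WithTop.coe_le_coe.2 (le_trans (by norm_num) hk)
  have : IsContMDiffRiemannianBundle (𝓡 n) 2 (EuclideanSpace ℝ (Fin n))
      (fun x : M => TangentSpace (𝓡 n) x) :=
    IsContMDiffRiemannianBundle.of_le h2
  exact GeodesicNet.exists_embedded_isStationary hΓ hf
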